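/- Let $P$ and $U$ be finite sets of points and of closed axis-parallel unit squares in $\mathbb{R}^2$ such that $U$ covers $P$. The ply of a set of squares is the largest cardinality of a subset with a nonempty common intersection, and $k^*=\operatorname{ply}^*(P,U)$ is the least ply of a subset of $U$ that covers $P$. Then $k^*\le\min\{|P|,|U|\}$. Moreover there are a single algorithm on the real RAM (unit-cost real arithmetic and comparisons, no floor function, integer words of $O(\log(|P|+|U|))$ bits, where $P$ is the point set given as input) and an absolute constant behind all $O(\cdot)$ below such that, for all such $P$ and $U$: 1. Given $P$ and $U$, the algorithm computes a subset of $U$ that covers $P$ and has ply at most $8k^*+32$, in time $$O\big(1+|U|^2|P|+|U|^8(k^*)^4\log(k^*+1)+|U|^8\log|U|\,\log(k^*+1)\big).$$ 2. Let $P'\subseteq P$ be obtained by reducing $P$ to one representative point per face, that is, $P'$ contains exactly one point of each face of the arrangement of $U$ that contains a point of $P$. (A face is a connected component of a set of all points that have the same position, interior, boundary or exterior, with respect to every square of $U$.) Then $|P'|\in O(|U|^2)$, and given $P'$ and $U$, the algorithm computes a subset of $U$ that covers the whole of $P$ and has ply at most $8k^*+32$, in time $$O\big(1+|P'|+|U|^8(k^*)^4\log(k^*+1)+|U|^8\log|U|\,\log(k^*+1)\big),$$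 which is in $O\big(1+|P|+|U|^8(k^*)^4\log(k^*+1)+|U|^8\log|U|\,\log(k^*+1)\big)$. Here $|U|^8\log|U|$ is read as $0$ if $U=\varnothing$. -/

import Mathlib

namespace PlyCover

/-! ### Unit squares, covers, ply -/

/-- Points of the plane. A unit square is identified with its lower left corner, so a set of
axis-parallel unit squares is a set of points too. -/
abbrev Plane : Type := ℝ × ℝ

/-- The closed axis-parallel unit square `[a.1, a.1 + 1] × [a.2, a.2 + 1]`. -/
def unitSquare (a : Plane) : Set Plane := Set.Icc a (a.1 + 1, a.2 + 1)

/-- The squares with lower left corners in `S` cover `P`. -/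
def Covers (S P : Finset Plane) : Prop := ∀ z ∈ P, ∃ s ∈ S, z ∈ unitSquare s

open Classical in
/-- The ply of a set of squares: the largest cardinality of a subset with a nonempty common
intersection. -/
noncomputable def ply (S : Finset Plane) : ℕ :=
  (S.powerset.filter fun T => (⋂ s ∈ T, unitSquare s).Nonempty).sup Finset.card

/-- The minimum ply cover number of `P` with `U`: the least ply of a subset of `U` that covers `P`
(meaningful if `U` covers `P`). -/
noncomputable def plyNumber (P U : Finset Plane) : ℕ :=
  sInf {k | ∃ S ⊆ U, Covers S P ∧ ply S = k}

/-! ### The arrangement of a set of squares -/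

/-- `z` and `w` are in the same position (interior, boundary or exterior) with respect to each
square of `U`. -/
def SamePosition (U : Finset Plane) (z w : Plane) : Prop :=
  ∀ s ∈ U, (z ∈ interior (unitSquare s) ↔ w ∈ interior (unitSquare s)) ∧
    (z ∈ frontier (unitSquare s) ↔ w ∈ frontier (unitSquare s))

/-- The face of the arrangement of `U` that contains `z`: the connected component of `z` in the set
of all points in the same position as `z`. Faces of all dimensions occur (open regions, pieces of
boundaries, crossing points), and they partition the plane. -/
def face (U : Finset Plane) (z : Plane) : Set Plane :=
  connectedComponentIn {w | SamePosition U w z} z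

/-- `Q` consists of one representative point of `P` for every face of the arrangement of `U` that
contains points of `P`. -/
def IsReduction (U P Q : Finset Plane) : Prop :=
  Q ⊆ P ∧ ∀ z ∈ P, ∃! r, r ∈ Q ∧ r ∈ face U z

/-! ### The real RAM -/

/-- Instructions of a real RAM. Registers are given by their numbers; `i`-instructions act on
registers that hold natural numbers ("words"), `r`-instructions on registers that hold reals.
Jump targets are positions in the program. There is no conversion of reals to words, and in
particular no floor function. -/
inductive Instr : Type
  /-- word register `d` := `v` -/
  | iconst (d v : ℕ)
  | iadd (d a b : ℕ)
  /-- truncated subtraction -/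
  | isub (d a b : ℕ)
  | imul (d a b : ℕ)
  /-- division with remainder dropped; fails for divisor zero -/
  | idiv (d a b : ℕ)
  /-- word register `d` := word memory cell whose address is in word register `a` -/
  | iload (d a : ℕ)
  /-- word memory cell whose address is in word register `a` := word register `b` -/
  | istore (a b : ℕ)
  /-- real register `d` := the integer constant `v` -/
  | rconst (d : ℕ) (v : ℤ)
  /-- real register `d` := word register `a` -/
  | rcast (d a : ℕ)
  | radd (d a b : ℕ)
  | rsub (d a b : ℕ)
  | rmul (d a b : ℕ)
  /-- fails for divisor zero -/
  | rdiv (d a b : ℕ)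
  /-- real register `d` := real memory cell whose address is in word register `a` -/
  | rload (d a : ℕ)
  /-- real memory cell whose address is in word register `a` := real register `b` -/
  | rstore (a b : ℕ)
  | jump (l : ℕ)
  /-- jump if word register `a` is less than word register `b` -/
  | ijlt (a b l : ℕ)
  /-- jump if real register `a` is less than real register `b` -/
  | rjlt (a b l : ℕ)
  | halt

/-- Configurations of a real RAM: program counter, word registers, real registers, word memory,
real memory. -/
structure Config : Type where
  pc : ℕ
  ireg : ℕ → ℕ
  rreg : ℕ → ℝ
  imem : ℕ → ℕ
  rmem : ℕ → ℝ

namespace Config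

/-- Put `v` into word register `d` and go on; this fails if `v` is not below the bound `W` on the
values that fit into a machine word. -/
def setI (W : ℕ) (c : Config) (d v : ℕ) : Option Config :=
  if v < W then some { c with pc := c.pc + 1, ireg := Function.update c.ireg d v } else none

/-- Put `v` into real register `d` and go on. -/
def setR (c : Config) (d : ℕ) (v : ℝ) : Config :=
  { c with pc := c.pc + 1, rreg := Function.update c.rreg d v }

end Config

open Classical in
/-- The effect of a single instruction, for words with values below `W`; `none` means that there is
no next configuration (the machine has halted, or the operation fails). -/
noncomputable def exec (W : ℕ) (c : Config) : Instr → Option Config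
  | .iconst d v => c.setI W d v
  | .iadd d a b => c.setI W d (c.ireg a + c.ireg b)
  | .isub d a b => c.setI W d (c.ireg a - c.ireg b)
  | .imul d a b => c.setI W d (c.ireg a * c.ireg b)
  | .idiv d a b => if c.ireg b = 0 then none else c.setI W d (c.ireg a / c.ireg b)
  | .iload d a => c.setI W d (c.imem (c.ireg a))
  | .istore a b =>
      some { c with pc := c.pc + 1, imem := Function.update c.imem (c.ireg a) (c.ireg b) }
  | .rconst d v => some (c.setR d v)
  | .rcast d a => some (c.setR d (c.ireg a))
  | .radd d a b => some (c.setR d (c.rreg a + c.rreg b))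
  | .rsub d a b => some (c.setR d (c.rreg a - c.rreg b))
  | .rmul d a b => some (c.setR d (c.rreg a * c.rreg b))
  | .rdiv d a b => if c.rreg b = 0 then none else some (c.setR d (c.rreg a / c.rreg b))
  | .rload d a => some (c.setR d (c.rmem (c.ireg a)))
  | .rstore a b =>
      some { c with pc := c.pc + 1, rmem := Function.update c.rmem (c.ireg a) (c.rreg b) }
  | .jump l => some { c with pc := l }
  | .ijlt a b l => some { c with pc := if c.ireg a < c.ireg b then l else c.pc + 1 }
  | .rjlt a b l => some { c with pc := if c.rreg a < c.rreg b then l else c.pc + 1 }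
  | .halt => none

/-- The configuration after exactly `t` steps of the program, every instruction counting as one
step; `none` if the machine does not make that many steps. -/
noncomputable def run (prog : List Instr) (W : ℕ) : ℕ → Config → Option Config
  | 0, c => some c
  | t + 1, c => (prog[c.pc]?.bind (exec W c)).bind (run prog W t)

/-- The initial configuration for the points `p 0, …, p (n - 1)` and the squares with lower left
corners `u 0, …, u (m - 1)`: the first two word registers hold `n` and `m`, the real memory holds
the coordinates of the points, in order, followed by those of the squares; all else is zero. -/
noncomputable def initial {n m : ℕ} (p : Fin n → Plane) (u : Fin m → Plane) : Config where
  pc := 0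
  ireg := fun i => if i = 0 then n else if i = 1 then m else 0
  rreg := fun _ => 0
  imem := fun _ => 0
  rmem := fun i =>
    let z : Plane :=
      if h : i / 2 < n then p ⟨i / 2, h⟩
      else if h : i / 2 - n < m then u ⟨i / 2 - n, h⟩
      else 0
    if i % 2 = 0 then z.1 else z.2

/-- The set of squares that a configuration describes: square number `j` is selected if and only if
cell `j` of the word memory is nonzero. -/
noncomputable def selected {m : ℕ} (u : Fin m → Plane) (c : Config) : Finset Plane :=
  (Finset.univ.filter fun j : Fin m => c.imem j ≠ 0).image u

/-- Started on the points `p` and the squares `u`, with words of `O(log (n + m))` bits (values below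
`(n + m + 2) ^ e`), the program halts after at most `T` steps, with a selection of squares that
covers `P` and has ply at most `b`. -/
def ComputesCover (prog : List Instr) (e : ℕ) {n m : ℕ} (p : Fin n → Plane) (u : Fin m → Plane)
    (P : Finset Plane) (b : ℕ) (T : ℝ) : Prop :=
  ∃ (t : ℕ) (c : Config), run prog ((n + m + 2) ^ e) t (initial p u) = some c ∧
    prog[c.pc]? = some Instr.halt ∧ (t : ℝ) ≤ T ∧
    Covers (selected u c) P ∧ ply (selected u c) ≤ b

end PlyCover

/-! Geometry. In each coordinate a greedy sweep puts a line at the right end of the leftmost square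
not yet stabbed (`Com.lines_spec`). The lines are more than 1 apart, so every unit square is stabbed
by exactly one vertical and one horizontal line. The lines cut the plane into half-open cells. If a
square contains a point of a cell, its two lines are among those that bound the cell, so it contains
a corner of the cell; the squares that matter for a cell thus fall into four corner groups, numbered
`g < 4`, where `g % 2` tells left from right and `g / 2` tells lower from upper. All squares of a
group share the corner, so a cover of ply `k` has at most `k` squares in each group
(`Com.Prepared.coverable`). For each cell around the crossing of the two lines of a square, the
algorithm finds the least `κ` such that the points in the cell can be covered by at most `κ` squares
from each group, and then a minimal set of squares that still allows this. The output is the union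
over the cells.

Feasibility. Inside the cell, a square of a corner group acts as a rectangle anchored at that
corner. In a sweep from left to right, rectangles anchored on the left only drop out and rectangles
anchored on the right only enter, and among the present ones only the one of largest vertical reach
matters. Keeping a current best square in each group needs at most as many changes as the group has
squares (`exists_tracks_antitone`, `exists_tracks_monotone`). So a dynamic program over four
counters and four current squares decides feasibility (`Com.Prepared.feasible_iff`). Points enter
only through their ranks among the sides of the squares, so one representative per rank pair
suffices.

Ply. By minimality each square chosen for a cell has a private point in that cell. Private points
restrict the squares of one cell through a common point `z` (`Com.Tidy.profile`): of two
neighbouring groups one contributes at most one square, and a group contributes at most two if the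
opposite group contributes any. Squares through `z` come from the nine cells around `z`. A diagonal
cell contributes at most `k`, a cell sharing a side at most `k + 1`. If squares of all four types
relative to the cell of `z` occur, four of them cover that cell, so `κ = 1` there and it contributes
at most 4; otherwise it contributes at most `k + 4`, but then one diagonal cell contributes nothing.
In both cases the total is at most `8 * k + 8` (`Com.sum_share_le`), below the claimed bound.

Time. With `m` squares and `n` points, a test handles about `k ^ 4 * m ^ 4` states in `2 * m + 1`
columns with `O(m)` work each; there are `O(m)` tests for a cell and `4 * m` visits to cells. This
gives `O(m * n + m ^ 8 * k ^ 4)`. The logarithm `log (k + 1)` is at least `1 / 2` for `k ≥ 1`, so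
the claimed bound follows; after the reduction `n ≤ 25 * m ^ 2`, and `m * n` is absorbed. The
reduction itself is harmless because points of one face lie in the same squares.

Machine. The algorithm is written in a small loop language whose commands have a state semantics and
a cost; compilation to the real RAM is proved correct once, with its cost and word size
(`Com.exists_run_program`). -/

namespace PlyCover

/-! ### A loop language -/

/-- States of the loop language: variables, arrays of words indexed by lists of words, and output
cells. -/
structure St : Type where
  var : ℕ → ℕ
  mem : ℕ → List ℕ → ℕ
  out : ℕ → ℕ

namespace St

/-- Assign `v` to the variable `x`. -/
def set (σ : St) (x v : ℕ) : St := { σ with var := Function.update σ.var x v }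

/-- Assign `v` to the cell `l` of the array `k`. -/
def put (σ : St) (k : ℕ) (l : List ℕ) (v : ℕ) : St :=
  { σ with mem := Function.update σ.mem k (Function.update (σ.mem k) l v) }

/-- Mark the output cell `j`. -/
def mark (σ : St) (j : ℕ) : St := { σ with out := Function.update σ.out j 1 }

@[simp] theorem set_var (σ : St) (x v y : ℕ) :
    (σ.set x v).var y = if y = x then v else σ.var y := Function.update_apply ..

@[simp] theorem set_mem (σ : St) (x v : ℕ) : (σ.set x v).mem = σ.mem := rfl

@[simp] theorem set_out (σ : St) (x v : ℕ) : (σ.set x v).out = σ.out := rfl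

@[simp] theorem put_var (σ : St) (k : ℕ) (l : List ℕ) (v : ℕ) : (σ.put k l v).var = σ.var := rfl

@[simp] theorem put_mem (σ : St) (k : ℕ) (l : List ℕ) (v k' : ℕ) (l' : List ℕ) :
    (σ.put k l v).mem k' l' = if k' = k ∧ l' = l then v else σ.mem k' l' := by
  by_cases h : k' = k
  · subst h
    simp [put, Function.update_apply]
  · simp [put, h]

@[simp] theorem put_out (σ : St) (k : ℕ) (l : List ℕ) (v : ℕ) : (σ.put k l v).out = σ.out := rfl

@[simp] theorem mark_var (σ : St) (j : ℕ) : (σ.mark j).var = σ.var := rfl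

@[simp] theorem mark_mem (σ : St) (j : ℕ) : (σ.mark j).mem = σ.mem := rfl

@[simp] theorem mark_out (σ : St) (j i : ℕ) :
    (σ.mark j).out i = if i = j then 1 else σ.out i := Function.update_apply ..

/-- All words of a state are at most `N`. -/
structure Bounded (σ : St) (N : ℕ) : Prop where
  var : ∀ x, σ.var x ≤ N
  mem : ∀ k l, σ.mem k l ≤ N

theorem Bounded.mono {σ : St} {N N' : ℕ} (h : σ.Bounded N) (hN : N ≤ N') : σ.Bounded N' :=
  ⟨fun x => (h.var x).trans hN, fun k l => (h.mem k l).trans hN⟩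

theorem Bounded.set {σ : St} {N : ℕ} (h : σ.Bounded N) {x v : ℕ} (hv : v ≤ N) :
    (σ.set x v).Bounded N := by
  refine ⟨fun y => ?_, fun k l => h.mem k l⟩
  rw [set_var]
  split_ifs
  exacts [hv, h.var y]

theorem Bounded.put {σ : St} {N : ℕ} (h : σ.Bounded N) {k : ℕ} {l : List ℕ} {v : ℕ} (hv : v ≤ N) :
    (σ.put k l v).Bounded N := by
  refine ⟨fun y => h.var y, fun k' l' => ?_⟩
  rw [put_mem]
  split_ifs
  exacts [hv, h.mem k' l']

end St

/-- Commands of the loop language. -/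
inductive Com : Type
  | skip
  | const (x v : ℕ)
  | copy (x y : ℕ)
  | succ (x y : ℕ)
  /-- `x := 1` if `y = z`, else `x := 0` -/
  | eq (x y z : ℕ)
  /-- `x := 1` if coordinate `d` of the first object plus `c` is less than coordinate `d` of the
  second object, else `x := 0`; objects are points, or squares if the flag is set -/
  | rlt (x d : ℕ) (s : Bool) (i : ℕ) (c : ℤ) (s' : Bool) (j : ℕ)
  | load (x k : ℕ) (l : List ℕ)
  | store (k : ℕ) (l : List ℕ) (y : ℕ)
  | mark (y : ℕ)
  | seq (a b : Com)
  /-- `a` if the variable `x` is nonzero, else `b` -/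
  | ite (x : ℕ) (a b : Com)
  /-- for `x` from `0` to `y - 1` -/
  | loop (x y : ℕ) (a : Com)

/-- Coordinate `d` of the point or square whose number is in the variable `i`. -/
def objVal (X : ℕ → ℝ) (σ : St) (d : ℕ) (s : Bool) (i : ℕ) : ℝ :=
  X (2 * (σ.var i + bif s then σ.var 0 else 0) + d)

/-- `n` rounds of an indexed transformation. -/
def iter {α : Type*} (f : ℕ → α → α) : ℕ → α → α
  | 0, a => a
  | n + 1, a => f n (iter f n a)

namespace Com

open Classical in
/-- The state after a command, for the input coordinates `X`. -/
noncomputable def eval (X : ℕ → ℝ) : Com → St → St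
  | skip, σ => σ
  | const x v, σ => σ.set x v
  | copy x y, σ => σ.set x (σ.var y)
  | succ x y, σ => σ.set x (σ.var y + 1)
  | eq x y z, σ => σ.set x (if σ.var y = σ.var z then 1 else 0)
  | rlt x d s i c s' j, σ => σ.set x (if objVal X σ d s i + c < objVal X σ d s' j then 1 else 0)
  | load x k l, σ => σ.set x (σ.mem k (l.map σ.var))
  | store k l y, σ => σ.put k (l.map σ.var) (σ.var y)
  | mark y, σ => σ.mark (σ.var y)
  | seq a b, σ => b.eval X (a.eval X σ)
  | ite x a b, σ => if σ.var x ≠ 0 then a.eval X σ else b.eval X σ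
  | loop x y a, σ => iter (fun i τ => a.eval X (τ.set x i)) (σ.var y) σ

open Classical in
/-- An upper bound on the number of machine steps for a command. -/
noncomputable def cost (X : ℕ → ℝ) : Com → St → ℕ
  | skip, _ => 0
  | const _ _, _ => 1
  | copy _ _, _ => 1
  | succ _ _, _ => 1
  | eq _ _ _, _ => 5
  | rlt _ _ _ _ _ _ _, _ => 15
  | load _ _ l, _ => 2 * l.length + 3
  | store _ l _, _ => 2 * l.length + 3
  | mark _, _ => 1
  | seq a b, σ => a.cost X σ + b.cost X (a.eval X σ)
  | ite x a b, σ => 2 + if σ.var x ≠ 0 then a.cost X σ else b.cost X σ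
  | loop x y a, σ => 4 + ∑ i ∈ Finset.range (σ.var y),
      (5 + a.cost X ((iter (fun i τ => a.eval X (τ.set x i)) i σ).set x i))

/-- Constants, array numbers and index lists are short. -/
def Small (N K : ℕ) : Com → Prop
  | const _ v => v ≤ N
  | rlt _ d _ _ _ _ _ => d ≤ N
  | load _ k l => k ≤ N ∧ l.length ≤ K
  | store k l _ => k ≤ N ∧ l.length ≤ K
  | seq a b => a.Small N K ∧ b.Small N K
  | ite _ a b => a.Small N K ∧ b.Small N K
  | loop _ _ a => a.Small N K
  | _ => True

theorem Small.mono {N N' K : ℕ} (hN : N ≤ N') : ∀ {a : Com}, a.Small N K → a.Small N' K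
  | skip, _ => trivial
  | const _ _, h => le_trans h hN
  | copy _ _, _ => trivial
  | succ _ _, _ => trivial
  | eq _ _ _, _ => trivial
  | rlt _ _ _ _ _ _ _, h => le_trans h hN
  | load _ _ _, h => ⟨h.1.trans hN, h.2⟩
  | store _ _ _, h => ⟨h.1.trans hN, h.2⟩
  | mark _, _ => trivial
  | seq _ _, h => ⟨Small.mono hN h.1, Small.mono hN h.2⟩
  | ite _ _ _, h => ⟨Small.mono hN h.1, Small.mono hN h.2⟩
  | loop _ _ a, h => Small.mono (a := a) hN h

/-! ### Compilation -/

/-- Code that puts the address of a cell into register 9. -/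
def addrCode (k : ℕ) (l : List ℕ) : List Instr :=
  [.iconst 9 k, .iadd 9 9 7] ++ l.flatMap fun v => [.imul 9 9 7, .iadd 9 9 (2 * v)]

/-- Code that puts a coordinate into the real register `r`. -/
def objCode (r d : ℕ) (s : Bool) (i : ℕ) : List Instr :=
  [.iadd 9 (2 * i) (bif s then 0 else 3), .iadd 9 9 9, .iconst 11 d, .iadd 9 9 11, .rload r 9]

/-- The code of a command, placed at position `p` and inside `e` loops. -/
def compile : Com → ℕ → ℕ → List Instr
  -- Variable `x` lives in register `2 * x`. Of the odd registers, 3 holds 0, 5 holds 1, 7 holds the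
  -- radix, and 9 and 11 are scratch; adding register 3 copies a word.
  | skip, _, _ => []
  | const x v, _, _ => [.iconst (2 * x) v]
  | copy x y, _, _ => [.iadd (2 * x) (2 * y) 3]
  | succ x y, _, _ => [.iadd (2 * x) (2 * y) 5]
  | eq x y z, _, _ => [.isub 9 (2 * y) (2 * z), .isub 11 (2 * z) (2 * y), .iadd 9 9 11,
      .iconst 11 1, .isub (2 * x) 11 9]
  | rlt x d s i c s' j, p, _ => objCode 0 d s i ++ (objCode 1 d s' j ++
      [.rconst 2 c, .radd 0 0 2, .iconst (2 * x) 1, .rjlt 0 1 (p + 15), .iconst (2 * x) 0])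
  | load x k l, _, _ => addrCode k l ++ [.iload (2 * x) 9]
  | store k l y, _, _ => addrCode k l ++ [.istore 9 (2 * y)]
  | mark y, _, _ => [.istore (2 * y) 5]
  | seq a b, p, e => a.compile p e ++ b.compile (p + (a.compile p e).length) e
  | ite x a b, p, e =>
      let cb := b.compile (p + 1) e
      let ca := a.compile (p + 2 + cb.length) e
      [.ijlt 3 (2 * x) (p + 2 + cb.length)] ++
        (cb ++ ([.jump (p + 2 + cb.length + ca.length)] ++ ca))
  | loop x y a, p, e =>
      let ca := a.compile (p + 5) (e + 1)
      -- Registers `4 * e + 21` and `4 * e + 23` hold the counter and the bound of the loop at depth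
      -- `e`. The bound is copied at the start, so the body may change the variable `y`.
      [.iadd (4 * e + 21) 3 3, .iadd (4 * e + 23) (2 * y) 3,
        .ijlt (4 * e + 21) (4 * e + 23) (p + 4), .jump (p + 7 + ca.length),
        .iadd (2 * x) (4 * e + 21) 3] ++
        (ca ++ [.iadd (4 * e + 21) (4 * e + 21) 5, .jump (p + 2)])

/-! ### Boundedness -/

theorem iter_bounded {X : ℕ → ℝ} {a : Com} {x N : ℕ} {σ : St} (n : ℕ) (hσ : σ.Bounded N)
    (hn : n ≤ N)
    (ih : ∀ {σ : St} {N' : ℕ}, N ≤ N' → σ.Bounded N' → (a.eval X σ).Bounded (N' + a.cost X σ)) :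
    (iter (fun i τ => a.eval X (τ.set x i)) n σ).Bounded (N + ∑ i ∈ Finset.range n,
      (5 + a.cost X ((iter (fun i τ => a.eval X (τ.set x i)) i σ).set x i))) := by
  induction n with
  | zero => simpa [iter] using hσ
  | succ n ih' =>
    have h := ih' (by omega)
    rw [Finset.sum_range_succ]
    refine (ih (Nat.le_add_right _ _) (h.set (x := x) (v := n) (by omega))).mono ?_
    omega

/-- Only `succ` can exceed all words present, by one, and it costs one step; constants, flags and
loop indices are covered by the initial bound. Hence words are bounded in terms of the running time.
-/
theorem eval_bounded {X : ℕ → ℝ} (a : Com) : ∀ {N K : ℕ} {σ : St}, 1 ≤ N → a.Small N K →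
    σ.Bounded N → (a.eval X σ).Bounded (N + a.cost X σ) := by
  induction a with
  | skip => intro N K σ _ _ h; exact h
  | const x v => intro N K σ _ hs h; exact (h.set hs).mono (by simp)
  | copy x y => intro N K σ _ _ h; exact (h.set (h.var y)).mono (by simp)
  | succ x y =>
    intro N K σ _ _ h
    exact (h.mono (Nat.le_succ N)).set (Nat.succ_le_succ (h.var y))
  | eq x y z =>
    intro N K σ h1 _ h
    refine (h.set ?_).mono (Nat.le_add_right _ _)
    split_ifs <;> omega
  | rlt x d s i c s' j =>
    intro N K σ h1 _ h
    refine (h.set ?_).mono (Nat.le_add_right _ _)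
    split_ifs <;> omega
  | load x k l => intro N K σ _ _ h; exact (h.set (h.mem _ _)).mono (by simp)
  | store k l y => intro N K σ _ _ h; exact (h.put (h.var y)).mono (by simp)
  | mark y => intro N K σ _ _ h; exact ⟨fun x => (h.var x).trans (by simp), fun k l =>
      (h.mem k l).trans (by simp)⟩
  | seq a b iha ihb =>
    intro N K σ h1 hs h
    have := ihb (K := K) (by omega) (hs.2.mono (Nat.le_add_right _ _)) (iha h1 hs.1 h)
    rwa [Nat.add_assoc] at this
  | ite x a b iha ihb =>
    intro N K σ h1 hs h
    simp only [eval, cost]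
    split_ifs
    · exact (iha h1 hs.1 h).mono (by omega)
    · exact (ihb h1 hs.2 h).mono (by omega)
  | loop x y a iha =>
    intro N K σ h1 hs h
    refine (iter_bounded _ h (h.var y) fun hN hσ => iha (K := K) (by omega) (hs.mono hN) hσ).mono ?_
    simp only [cost]
    omega

end Com

/-! ### Runs of the machine -/

theorem run_add (prog : List Instr) (W : ℕ) (s t : ℕ) (c : Config) :
    run prog W (s + t) c = (run prog W s c).bind (run prog W t) := by
  induction s generalizing c with
  | zero => simp [run]
  | succ s ih =>
    rw [Nat.succ_add, run, run, show run prog W (s + t) = _ from funext ih, ← Option.bind_assoc]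

theorem run_trans {prog : List Instr} {W s t : ℕ} {c c' c'' : Config}
    (h : run prog W s c = some c') (h' : run prog W t c' = some c'') :
    run prog W (s + t) c = some c'' := by
  rw [run_add, h, Option.bind_some, h']

theorem run_one {prog : List Instr} {W : ℕ} {c c' : Config} {i : Instr}
    (hi : prog[c.pc]? = some i) (hc : exec W c i = some c') : run prog W 1 c = some c' := by
  simp [run, hi, hc]

theorem run_cons {prog : List Instr} {W t : ℕ} {c c' c'' : Config} {i : Instr}
    (hi : prog[c.pc]? = some i) (hc : exec W c i = some c') (h : run prog W t c' = some c'') :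
    run prog W (t + 1) c = some c'' := by
  rw [Nat.add_comm]
  exact run_trans (run_one hi hc) h

/-- The program contains the code `is` at position `p`. -/
def CodeAt (prog : List Instr) (p : ℕ) (is : List Instr) : Prop :=
  ∀ k < is.length, prog[p + k]? = is[k]?

theorem CodeAt.left {prog : List Instr} {p : ℕ} {is js : List Instr}
    (h : CodeAt prog p (is ++ js)) : CodeAt prog p is := fun k hk => by
  rw [h k (by rw [List.length_append]; omega), List.getElem?_append_left hk]

theorem CodeAt.right {prog : List Instr} {p : ℕ} {is js : List Instr}
    (h : CodeAt prog p (is ++ js)) : CodeAt prog (p + is.length) js := fun k hk => by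
  rw [Nat.add_assoc, h _ (by rw [List.length_append]; omega),
    List.getElem?_append_right (Nat.le_add_right _ _), Nat.add_sub_cancel_left]

theorem CodeAt.head {prog : List Instr} {p : ℕ} {i : Instr} {is : List Instr}
    (h : CodeAt prog p (i :: is)) : prog[p]? = some i := h 0 (by simp)

theorem CodeAt.tail {prog : List Instr} {p : ℕ} {i : Instr} {is : List Instr}
    (h : CodeAt prog p (i :: is)) : CodeAt prog (p + 1) is :=
  CodeAt.right (is := [i]) h

/-! ### Addresses -/

/-- The address of cell `l` of array `k`. -/
def addr (R k : ℕ) (l : List ℕ) : ℕ := l.foldl (fun a v => a * R + v) (k + R)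

/-- An address is the base-`R` numeral with digits 1, `k`, `l`, most significant first. The leading
1 makes the number of digits recoverable, so index lists of all lengths share one memory without
collisions. -/
theorem addr_eq_ofDigits (R k : ℕ) (l : List ℕ) :
    addr R k l = Nat.ofDigits R (l.reverse ++ [k, 1]) := by
  induction l using List.reverseRecOn with
  | nil => simp [addr, Nat.ofDigits]
  | append_singleton l v ih =>
    simp only [addr, List.foldl_append, List.foldl_cons, List.foldl_nil] at ih ⊢
    rw [ih]
    simp [Nat.ofDigits_cons, mul_comm, add_comm]

theorem addr_injective {R k k' : ℕ} {l l' : List ℕ} (hR : 1 < R) (hk : k < R) (hk' : k' < R)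
    (hl : ∀ v ∈ l, v < R) (hl' : ∀ v ∈ l', v < R) (h : addr R k l = addr R k' l') :
    k = k' ∧ l = l' := by
  rw [addr_eq_ofDigits, addr_eq_ofDigits] at h
  have key : ∀ {k : ℕ} {l : List ℕ}, k < R → (∀ v ∈ l, v < R) →
      Nat.digits R (Nat.ofDigits R (l.reverse ++ [k, 1])) = l.reverse ++ [k, 1] := by
    intro k l hk hl
    refine Nat.digits_ofDigits R hR _ ?_ ?_
    · intro v hv
      simp only [List.mem_append, List.mem_reverse, List.mem_cons, List.not_mem_nil, or_false] at hv
      rcases hv with hv | rfl | rfl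
      exacts [hl v hv, hk, hR]
    · intro _
      simp
  have h' := congrArg (Nat.digits R) h
  rw [key hk hl, key hk' hl'] at h'
  have h'' := congrArg List.reverse h'
  simpa [and_assoc] using h''

/-- This leaves the addresses below `R` free for the output cells. -/
theorem le_addr {R : ℕ} (hR : 1 < R) (k : ℕ) (l : List ℕ) : R ≤ addr R k l := by
  induction l using List.reverseRecOn with
  | nil => simp [addr]
  | append_singleton l v ih =>
    simp only [addr, List.foldl_append, List.foldl_cons, List.foldl_nil] at ih ⊢
    nlinarith

theorem addr_lt {R k : ℕ} {l : List ℕ} (hk : k < R) (hl : ∀ v ∈ l, v < R) :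
    addr R k l < 2 * R ^ (l.length + 1) := by
  induction l using List.reverseRecOn with
  | nil => simp [addr]; omega
  | append_singleton l v ih =>
    have h := ih fun w hw => hl w (by simp [hw])
    have hv := hl v (by simp)
    simp only [addr, List.foldl_append, List.foldl_cons, List.foldl_nil, List.length_append,
      List.length_cons, List.length_nil] at h ⊢
    rw [pow_succ]
    nlinarith

/-! ### Simulation -/

/-- The configuration `c` represents the state `σ`. -/
structure Rel (X : ℕ → ℝ) (R : ℕ) (σ : St) (c : Config) : Prop where
  var : ∀ x, c.ireg (2 * x) = σ.var x
  zero : c.ireg 3 = 0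
  one : c.ireg 5 = 1
  radix : c.ireg 7 = R
  mem : ∀ k < R, ∀ l : List ℕ, (∀ v ∈ l, v < R) → c.imem (addr R k l) = σ.mem k l
  out : ∀ j < R, c.imem j = σ.out j
  rmem : c.rmem = X

/-- Configurations that agree on the real memory and on all odd registers except for `9`
and `11`. -/
structure Similar (c c' : Config) : Prop where
  rmem : c'.rmem = c.rmem
  ireg : ∀ r, r % 2 = 1 → r ≠ 9 → r ≠ 11 → c'.ireg r = c.ireg r

theorem Similar.refl (c : Config) : Similar c c := ⟨rfl, fun _ _ _ _ => rfl⟩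

theorem exec_iconst {W : ℕ} (c : Config) {d v : ℕ} (h : v < W) :
    exec W c (.iconst d v) =
      some { c with pc := c.pc + 1, ireg := Function.update c.ireg d v } := by
  simp [exec, Config.setI, h]

theorem exec_iadd {W : ℕ} (c : Config) {d a b : ℕ} (h : c.ireg a + c.ireg b < W) :
    exec W c (.iadd d a b) =
      some { c with pc := c.pc + 1, ireg := Function.update c.ireg d (c.ireg a + c.ireg b) } := by
  simp [exec, Config.setI, h]

theorem exec_isub {W : ℕ} (c : Config) {d a b : ℕ} (h : c.ireg a - c.ireg b < W) :
    exec W c (.isub d a b) =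
      some { c with pc := c.pc + 1, ireg := Function.update c.ireg d (c.ireg a - c.ireg b) } := by
  simp [exec, Config.setI, h]

theorem exec_imul {W : ℕ} (c : Config) {d a b : ℕ} (h : c.ireg a * c.ireg b < W) :
    exec W c (.imul d a b) =
      some { c with pc := c.pc + 1, ireg := Function.update c.ireg d (c.ireg a * c.ireg b) } := by
  simp [exec, Config.setI, h]

theorem exec_iload {W : ℕ} (c : Config) {d a : ℕ} (h : c.imem (c.ireg a) < W) :
    exec W c (.iload d a) =
      some { c with pc := c.pc + 1, ireg := Function.update c.ireg d (c.imem (c.ireg a)) } := by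
  simp [exec, Config.setI, h]

/-- The effect of address code. -/
structure AddrDone (c c' : Config) (len v : ℕ) : Prop where
  pc : c'.pc = c.pc + len
  ireg : c'.ireg = Function.update c.ireg 9 v
  rreg : c'.rreg = c.rreg
  imem : c'.imem = c.imem
  rmem : c'.rmem = c.rmem

/-- Horner's rule: each index costs a multiplication by the radix and an addition. Intermediate
results never exceed the final bound. -/
theorem run_addrCode {prog : List Instr} {W R k : ℕ} {c : Config} (hR : 1 < R)
    (hc : c.ireg 7 = R) (hk : k < R) : ∀ l : List ℕ, (∀ v ∈ l, c.ireg (2 * v) < R) →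
    2 * R ^ (l.length + 1) ≤ W → CodeAt prog c.pc (Com.addrCode k l) →
    ∃ c', run prog W (2 * l.length + 2) c = some c' ∧
      AddrDone c c' (2 * l.length + 2) (addr R k (l.map fun v => c.ireg (2 * v))) := by
  intro l
  induction l using List.reverseRecOn with
  | nil =>
    intro _ hW hp
    simp only [List.length_nil, Nat.zero_add, pow_one] at hW
    have h0 := hp.head
    have h1 := hp.tail.head
    refine ⟨_, run_cons h0 (exec_iconst c (by omega)) (run_one h1 (exec_iadd _ ?_)), ?_⟩
    · simp [hc]; omega
    · constructor <;> simp [hc, addr]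
  | append_singleton l v ih =>
    intro hl hW hp
    have hlen : Com.addrCode k (l ++ [v]) =
        Com.addrCode k l ++ [.imul 9 9 7, .iadd 9 9 (2 * v)] := by simp [Com.addrCode]
    have hlen' : (Com.addrCode k l).length = 2 * l.length + 2 := by
      simp [Com.addrCode, List.length_flatMap, mul_comm]
    have hpos : 0 < R := by omega
    rw [hlen] at hp
    obtain ⟨c', hrun, hd⟩ := ih (fun w hw => hl w (by simp [hw]))
      ((Nat.mul_le_mul_left 2 (Nat.pow_le_pow_right hpos (by simp))).trans hW) hp.left
    have hp' := hp.right
    rw [hlen', ← hd.pc] at hp'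
    have hv := hl v (by simp)
    have hlt : addr R k ((l ++ [v]).map fun v => c.ireg (2 * v)) < W := by
      refine lt_of_lt_of_le (addr_lt hk ?_) ((by simp : _ ≤ _).trans hW)
      intro w hw
      obtain ⟨w', hw', rfl⟩ := List.mem_map.1 hw
      exact hl w' hw'
    have hval : addr R k ((l ++ [v]).map fun v => c.ireg (2 * v)) =
        addr R k (l.map fun v => c.ireg (2 * v)) * R + c.ireg (2 * v) := by
      simp [addr]
    rw [hval] at hlt
    have h2 : c'.ireg 9 = addr R k (l.map fun v => c.ireg (2 * v)) := by simp [hd.ireg]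
    have h3 : c'.ireg 7 = R := by simp [hd.ireg, hc]
    have h4 : c'.ireg (2 * v) = c.ireg (2 * v) := by
      rw [hd.ireg, Function.update_of_ne (by omega)]
    refine ⟨{ c' with
        pc := c'.pc + 1 + 1
        ireg := Function.update c'.ireg 9 (c'.ireg 9 * R + c'.ireg (2 * v)) }, ?_, ?_⟩
    · rw [List.length_append, show 2 * (l.length + [v].length) + 2 = (2 * l.length + 2) + (1 + 1) by
        simp; ring]
      refine run_trans hrun (run_cons hp'.head (exec_imul _ ?_) (run_one hp'.tail.head ?_))
      · rw [h2, h3]; omega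
      · have h5 : ∀ w, Function.update c'.ireg 9 w (2 * v) = c'.ireg (2 * v) := fun w =>
          Function.update_of_ne (by omega) _ _
        rw [exec_iadd]
        · simp [h3, h5]
        · simp only [Function.update_self, h2, h3, h5, h4]
          omega
    · constructor
      · simp [hd.pc]; ring
      · rw [hval, h4, h2, hd.ireg]; simp
      · exact hd.rreg
      · exact hd.imem
      · exact hd.rmem

/-- The effect of code that fetches a coordinate. -/
structure ObjDone (c c' : Config) (r : ℕ) (v : ℝ) : Prop where
  pc : c'.pc = c.pc + 5
  ireg : ∀ r, r ≠ 9 → r ≠ 11 → c'.ireg r = c.ireg r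
  rreg : c'.rreg = Function.update c.rreg r v
  imem : c'.imem = c.imem
  rmem : c'.rmem = c.rmem

/-- The factor 5 comes from the index `2 * (i + n) + d` into the real memory, where `i`, `n` and `d`
are all at most `N`. -/
theorem run_objCode {prog : List Instr} {X : ℕ → ℝ} {W R N r d i : ℕ} {s : Bool} {σ : St}
    {c : Config} (h : Rel X R σ c) (hb : σ.Bounded N) (hN : N < R) (hd : d ≤ N) (hW : 5 * R ≤ W)
    (hp : CodeAt prog c.pc (Com.objCode r d s i)) :
    ∃ c', run prog W 5 c = some c' ∧ ObjDone c c' r (objVal X σ d s i) := by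
  have hi := hb.var i
  have h0 := hb.var 0
  have hv := h.var i
  have hv0 := h.var 0
  have hz := h.zero
  have hs : c.ireg (2 * i) + c.ireg (bif s then 0 else 3) =
      σ.var i + bif s then σ.var 0 else 0 := by
    cases s
    · simp [hv, hz]
    · simpa [hv] using hv0
  have hs' : (σ.var i + bif s then σ.var 0 else 0) ≤ 2 * N := by
    cases s <;> simp <;> omega
  refine ⟨_, run_cons hp.head (exec_iadd _ ?_) (run_cons hp.tail.head (exec_iadd _ ?_)
    (run_cons hp.tail.tail.head (exec_iconst _ ?_) (run_cons hp.tail.tail.tail.head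
    (exec_iadd _ ?_) (run_one hp.tail.tail.tail.tail.head rfl)))), ?_⟩
  · rw [hs]; omega
  · simp [hs]; omega
  · omega
  · simp [hs]; omega
  · constructor
    · simp [Config.setR]
    · intro r h1 h2
      simp [Config.setR, Function.update_of_ne, h1, h2]
    · simp [Config.setR, hs, h.rmem, objVal, ← two_mul]
    · rfl
    · rfl

/-- Passing from a representation of `σ` to one of a state that differs in one variable. -/
theorem Rel.set {X : ℕ → ℝ} {R x v : ℕ} {σ : St} {c c' : Config} (h : Rel X R σ c)
    (hx : c'.ireg (2 * x) = v) (hy : ∀ y, y ≠ x → c'.ireg (2 * y) = c.ireg (2 * y))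
    (hs : Similar c c') (hm : c'.imem = c.imem) : Rel X R (σ.set x v) c' where
  var y := by
    by_cases hyx : y = x
    · simp [hyx, hx]
    · simp [hyx, hy, h.var]
  zero := (hs.ireg 3 (by simp) (by simp) (by simp)).trans h.zero
  one := (hs.ireg 5 (by simp) (by simp) (by simp)).trans h.one
  radix := (hs.ireg 7 (by simp) (by simp) (by simp)).trans h.radix
  mem k hk l hl := by rw [hm]; exact h.mem k hk l hl
  out j hj := by rw [hm]; exact h.out j hj
  rmem := hs.rmem.trans h.rmem

theorem Rel.pc {X : ℕ → ℝ} {R p : ℕ} {σ : St} {c : Config} (h : Rel X R σ c) :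
    Rel X R σ { c with pc := p } :=
  ⟨h.var, h.zero, h.one, h.radix, h.mem, h.out, h.rmem⟩

/-- The effect of the code of a command: the registers that control the enclosing loops are
preserved. -/
structure Done (X : ℕ → ℝ) (R e : ℕ) (σ' : St) (p' : ℕ) (c c' : Config) : Prop where
  rel : Rel X R σ' c'
  pc : c'.pc = p'
  keep : ∀ r < 4 * e + 20, r % 2 = 1 → 20 < r → c'.ireg r = c.ireg r

theorem Done.of_similar {X : ℕ → ℝ} {R e p' : ℕ} {σ' : St} {c c' : Config} (h : Rel X R σ' c')
    (hp : c'.pc = p') (hs : Similar c c') : Done X R e σ' p' c c' :=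
  ⟨h, hp, fun r _ h2 h3 => hs.ireg r h2 (by omega) (by omega)⟩

open Function (update)

/-- Assigning a value to a variable in the last step of a computation. -/
theorem Rel.assign {X : ℕ → ℝ} {R x v : ℕ} {σ : St} {c c' : Config} (h : Rel X R σ c)
    (hi : ∀ r, r ≠ 9 → r ≠ 11 → r ≠ 2 * x → c'.ireg r = c.ireg r) (hx : c'.ireg (2 * x) = v)
    (hm : c'.imem = c.imem) (hr : c'.rmem = c.rmem) :
    Rel X R (σ.set x v) c' ∧ Similar c c' :=
  have hs : Similar c c' := ⟨hr, fun r h1 h2 h3 => hi r h2 h3 (by omega)⟩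
  ⟨h.set hx (fun y hy => hi _ (by omega) (by omega) (by omega)) hs hm, hs⟩

theorem Done.assign {X : ℕ → ℝ} {R e p' x v : ℕ} {σ : St} {c c' : Config} (h : Rel X R σ c)
    (hp : c'.pc = p') (hi : ∀ r, r ≠ 9 → r ≠ 11 → r ≠ 2 * x → c'.ireg r = c.ireg r)
    (hx : c'.ireg (2 * x) = v) (hm : c'.imem = c.imem) (hr : c'.rmem = c.rmem) :
    Done X R e (σ.set x v) p' c c' :=
  let ⟨h1, h2⟩ := h.assign hi hx hm hr
  .of_similar h1 hp h2

namespace Com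

theorem length_addrCode (k : ℕ) (l : List ℕ) : (addrCode k l).length = 2 * l.length + 2 := by
  simp [addrCode, List.length_flatMap, mul_comm]

/-- Running the compiled code of a command. -/
def Simulated (X : ℕ → ℝ) (prog : List Instr) (W R : ℕ) (a : Com) : Prop :=
  ∀ {N e : ℕ} {σ : St} {c : Config}, CodeAt prog c.pc (a.compile c.pc e) → Rel X R σ c →
    σ.Bounded N → 1 ≤ N → a.Small N 8 → N + a.cost X σ < R →
    ∃ t ≤ a.cost X σ, ∃ c', run prog W t c = some c' ∧
      Done X R e (a.eval X σ) (c.pc + (a.compile c.pc e).length) c c'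

variable {X : ℕ → ℝ} {prog : List Instr} {W R : ℕ}

/-- No branching is needed: the sum of the two truncated differences vanishes exactly for equal
words, and truncated subtraction from 1 turns it into the flag. -/
theorem simulated_eq (hW : 5 * R ≤ W) (x y z : ℕ) : Simulated X prog W R (eq x y z) := by
  intro N e σ c hp h hb h1 hs hR
  have hy := hb.var y
  have hz := hb.var z
  have hvy := h.var y
  have hvz := h.var z
  simp only [cost] at hR
  refine ⟨5, le_rfl, _, run_cons hp.head (exec_isub _ ?_) (run_cons hp.tail.head (exec_isub _ ?_)
    (run_cons hp.tail.tail.head (exec_iadd _ ?_) (run_cons hp.tail.tail.tail.head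
    (exec_iconst _ ?_) (run_one hp.tail.tail.tail.tail.head (exec_isub _ ?_))))), ?_⟩
  · omega
  · simp only [Function.update_of_ne (show 2 * z ≠ 9 by omega),
      Function.update_of_ne (show 2 * y ≠ 9 by omega)]
    omega
  · simp [Function.update_of_ne (show 2 * z ≠ 9 by omega),
      Function.update_of_ne (show 2 * y ≠ 9 by omega)]
    omega
  · omega
  · simp; omega
  · refine Done.assign h ?_ ?_ ?_ rfl rfl
    · simp [compile]
    · intro r h2 h3 h4
      simp [h2, h3, h4]
    · simp only [Function.update_self, Function.update_of_ne (show 2 * z ≠ 9 by omega),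
        Function.update_of_ne (show 2 * y ≠ 9 by omega), hvy, hvz,
        Function.update_of_ne (show (9 : ℕ) ≠ 11 by decide)]
      split_ifs <;> omega

/-- The flag is set to 1 before the comparison, and a successful jump skips the instruction that
resets it to 0. -/
theorem simulated_rlt (hW : 5 * R ≤ W) (x d : ℕ) (s : Bool) (i : ℕ) (z : ℤ) (s' : Bool) (j : ℕ) :
    Simulated X prog W R (rlt x d s i z s' j) := by
  intro N e σ c hp h hb h1 hs hR
  simp only [cost] at hR
  obtain ⟨c₁, hr₁, hd₁⟩ := run_objCode (r := 0) h hb (by omega) hs hW hp.left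
  have h' : Rel X R σ c₁ := by
    refine ⟨fun x => ?_, ?_, ?_, ?_, fun k hk l hl => ?_, fun j hj => ?_, ?_⟩
    · rw [hd₁.ireg _ (by omega) (by omega), h.var]
    · rw [hd₁.ireg _ (by omega) (by omega), h.zero]
    · rw [hd₁.ireg _ (by omega) (by omega), h.one]
    · rw [hd₁.ireg _ (by omega) (by omega), h.radix]
    · rw [hd₁.imem, h.mem k hk l hl]
    · rw [hd₁.imem, h.out j hj]
    · rw [hd₁.rmem, h.rmem]
  have hp₁ := hp.right
  rw [show (objCode 0 d s i).length = 5 from rfl, ← hd₁.pc] at hp₁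
  obtain ⟨c₂, hr₂, hd₂⟩ := run_objCode (r := 1) h' hb (by omega) hs hW hp₁.left
  have hp₂ := hp₁.right
  rw [show (objCode 1 d s' j).length = 5 from rfl, ← hd₂.pc] at hp₂
  have hi : ∀ r, r ≠ 9 → r ≠ 11 → c₂.ireg r = c.ireg r := fun r h2 h3 => by
    rw [hd₂.ireg r h2 h3, hd₁.ireg r h2 h3]
  have hv0 : c₂.rreg 0 = objVal X σ d s i := by
    rw [hd₂.rreg, Function.update_of_ne (by decide), hd₁.rreg, Function.update_self]
  have hv1 : c₂.rreg 1 = objVal X σ d s' j := by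
    rw [hd₂.rreg, Function.update_self]
  have hr := run_trans hr₁ (run_trans hr₂ (run_cons hp₂.head rfl (run_cons hp₂.tail.head rfl
    (run_one hp₂.tail.tail.head (exec_iconst _ (by omega))))))
  have hpc : c₂.pc + 5 = c.pc + 15 := by rw [hd₂.pc, hd₁.pc]
  by_cases hlt : objVal X σ d s i + z < objVal X σ d s' j
  · refine ⟨_, ?_, _, run_trans hr (run_one hp₂.tail.tail.tail.head rfl), ?_⟩
    · simp [cost]
    · simp only [eval, if_pos hlt]
      refine Done.assign h ?_ ?_ ?_ ?_ ?_
      · simp [Config.setR, hv0, hv1, hlt, compile, objCode]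
      · intro r h2 h3 h4
        simp [Config.setR, Function.update_of_ne h4, hi r h2 h3]
      · simp [Config.setR]
      · exact hd₂.imem.trans hd₁.imem
      · exact hd₂.rmem.trans hd₁.rmem
  · refine ⟨_, ?_, _, run_trans hr (run_cons hp₂.tail.tail.tail.head rfl
      (run_one (i := .iconst (2 * x) 0) ?_ (exec_iconst _ ?_))), ?_⟩
    · simp [cost]
    · have := hp₂.tail.tail.tail.tail.head
      simpa [Config.setR, hv0, hv1, hlt] using this
    · omega
    · simp only [eval, if_neg hlt]
      refine Done.assign h ?_ ?_ ?_ ?_ ?_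
      · simp [Config.setR, hv0, hv1, hlt, compile, objCode, hd₂.pc, hd₁.pc]
      · intro r h2 h3 h4
        simp [Config.setR, Function.update_of_ne h4, hi r h2 h3]
      · simp [Config.setR]
      · exact hd₂.imem.trans hd₁.imem
      · exact hd₂.rmem.trans hd₁.rmem

/-- Running the address code in a configuration that represents a state. -/
theorem exists_run_addrCode {σ : St} {c : Config} {N k : ℕ} {l : List ℕ} (hW : 2 * R ^ 9 ≤ W)
    (h : Rel X R σ c) (hb : σ.Bounded N) (hN : N < R) (h1 : 1 ≤ N) (hk : k ≤ N)
    (hl : l.length ≤ 8) (hp : CodeAt prog c.pc (addrCode k l)) :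
    ∃ c', run prog W (2 * l.length + 2) c = some c' ∧
      AddrDone c c' (2 * l.length + 2) (addr R k (l.map σ.var)) := by
  have := run_addrCode (by omega) h.radix (by omega : k < R) l
    (fun v _ => by rw [h.var]; exact (hb.var v).trans_lt hN)
    ((Nat.mul_le_mul_left 2 (Nat.pow_le_pow_right (by omega) (by omega))).trans hW) hp
  simpa only [h.var] using this

theorem simulated_load (hW : 2 * R ^ 9 ≤ W) (hW' : 5 * R ≤ W) (x k : ℕ) (l : List ℕ) :
    Simulated X prog W R (load x k l) := by
  intro N e σ c hp h hb h1 hs hR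
  simp only [cost] at hR
  obtain ⟨c₁, hr, hd⟩ := exists_run_addrCode hW h hb (by omega) h1 hs.1 hs.2 hp.left
  have hp' := hp.right
  rw [length_addrCode, ← hd.pc] at hp'
  have hval : c₁.imem (c₁.ireg 9) = σ.mem k (l.map σ.var) := by
    rw [hd.ireg, Function.update_self, hd.imem, h.mem k (by have := hs.1; omega)]
    intro v hv
    obtain ⟨w, _, rfl⟩ := List.mem_map.1 hv
    exact (hb.var w).trans_lt (by omega)
  have := hb.mem k (l.map σ.var)
  refine ⟨_, ?_, _, run_trans hr (run_one hp'.head (exec_iload _ ?_)), ?_⟩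
  · simp [cost]
  · omega
  · refine Done.assign h ?_ ?_ ?_ hd.imem hd.rmem
    · simp [compile, length_addrCode, hd.pc, add_assoc]
    · intro r h2 h3 h4
      simp [hd.ireg, h2, h4]
    · simpa using hval

/-- Other array cells are unaffected by `addr_injective`, output cells by `le_addr`. -/
theorem simulated_store (hW : 2 * R ^ 9 ≤ W) (k : ℕ) (l : List ℕ) (y : ℕ) :
    Simulated X prog W R (store k l y) := by
  intro N e σ c hp h hb h1 hs hR
  simp only [cost] at hR
  obtain ⟨c₁, hr, hd⟩ := exists_run_addrCode hW h hb (by omega) h1 hs.1 hs.2 hp.left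
  have hp' := hp.right
  rw [length_addrCode, ← hd.pc] at hp'
  have hi : ∀ r, r ≠ 9 → c₁.ireg r = c.ireg r := fun r hr => by simp [hd.ireg, hr]
  have h9 : c₁.ireg 9 = addr R k (l.map σ.var) := by rw [hd.ireg, Function.update_self]
  have hk := hs.1
  have hlt : ∀ v ∈ l.map σ.var, v < R := by
    intro v hv
    obtain ⟨w, _, rfl⟩ := List.mem_map.1 hv
    exact (hb.var w).trans_lt (by omega)
  refine ⟨_, ?_, _, run_trans hr (run_one hp'.head rfl), ?_⟩
  · simp [cost]
  · refine Done.of_similar ?_ ?_ ?_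
    · refine ⟨fun x => ?_, ?_, ?_, ?_, fun k' hk' l' hl' => ?_, fun j hj => ?_, ?_⟩
      · simp [hi _ (show 2 * x ≠ 9 by omega), h.var, eval]
      · simp [hi, h.zero]
      · simp [hi, h.one]
      · simp [hi, h.radix]
      · simp only [eval, St.put_mem, h9, hi _ (show 2 * y ≠ 9 by omega), h.var, hd.imem]
        split_ifs with hkl
        · rw [hkl.1, hkl.2, Function.update_self]
        · rw [Function.update_of_ne, h.mem k' hk' l' hl']
          intro hne
          exact hkl (addr_injective (by omega) hk' (by omega) hl' hlt hne)
      · have := le_addr (R := R) (by omega) k (l.map σ.var)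
        simp only [eval, St.put_out, h9]
        rw [Function.update_of_ne (by omega), hd.imem, h.out j hj]
      · exact hd.rmem.trans h.rmem
    · simp [compile, length_addrCode, hd.pc, add_assoc]
    · exact ⟨hd.rmem, fun r _ h3 _ => hi r h3⟩

theorem simulated_mark (y : ℕ) : Simulated X prog W R (mark y) := by
  intro N e σ c hp h hb h1 hs hR
  simp only [cost] at hR
  have hy := hb.var y
  refine ⟨1, le_rfl, _, run_one hp.head rfl, Done.of_similar ?_ rfl ⟨rfl, fun _ _ _ _ => rfl⟩⟩
  refine ⟨h.var, h.zero, h.one, h.radix, fun k hk l hl => ?_, fun j hj => ?_, h.rmem⟩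
  · have := le_addr (R := R) (by omega) k l
    simp only [h.var, eval]
    rw [Function.update_of_ne (by omega), h.mem k hk l hl]
    rfl
  · simp only [h.var, h.one, eval, St.mark_out, Function.update_apply, h.out j hj]

theorem Simulated.seq {a b : Com} (ha : Simulated X prog W R a) (hb : Simulated X prog W R b) :
    Simulated X prog W R (seq a b) := by
  intro N e σ c hp h hbd h1 hs hR
  simp only [cost] at hR
  obtain ⟨t₁, ht₁, c₁, hr₁, hd₁⟩ := ha hp.left h hbd h1 hs.1 (by omega)
  have hp' := hp.right
  rw [← hd₁.pc] at hp'
  obtain ⟨t₂, ht₂, c₂, hr₂, hd₂⟩ := hb hp' hd₁.rel (eval_bounded a h1 hs.1 hbd) (by omega)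
    (hs.2.mono (Nat.le_add_right _ _)) (by omega)
  refine ⟨t₁ + t₂, by simp only [cost]; omega, c₂, run_trans hr₁ hr₂, hd₂.rel, ?_, ?_⟩
  · rw [hd₂.pc, hd₁.pc]
    simp [compile, add_assoc]
  · intro r h2 h3 h4
    rw [hd₂.keep r h2 h3 h4, hd₁.keep r h2 h3 h4]

theorem Simulated.ite {a b : Com} (x : ℕ) (ha : Simulated X prog W R a)
    (hb : Simulated X prog W R b) : Simulated X prog W R (ite x a b) := by
  intro N e σ c hp h hbd h1 hs hR
  simp only [cost] at hR
  simp only [compile] at hp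
  have hx := h.var x
  have hz := h.zero
  by_cases hcase : σ.var x ≠ 0
  · rw [if_pos hcase] at hR
    have hlt : c.ireg 3 < c.ireg (2 * x) := by omega
    have hp' := hp.right.right.right
    have hpc : ({ c with pc := c.pc + 2 + (b.compile (c.pc + 1) e).length } : Config).pc =
        c.pc + 1 + (b.compile (c.pc + 1) e).length + 1 := by simp only; omega
    simp only [List.length_cons, List.length_nil, Nat.zero_add] at hp'
    rw [← hpc] at hp'
    obtain ⟨t, ht, c', hr, hd⟩ := ha hp' h.pc hbd h1 hs.1 (by omega)
    refine ⟨t + 1, ?_, c', run_cons (c' := { c with pc := _ }) hp.head ?_ hr, ?_, ?_, ?_⟩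
    · simp only [cost, if_pos hcase]; omega
    · simp [exec, hlt]
    · simpa only [eval, if_pos hcase] using hd.rel
    · rw [hd.pc]
      simp [compile]
      omega
    · exact hd.keep
  · rw [if_neg hcase] at hR
    have hlt : ¬ c.ireg 3 < c.ireg (2 * x) := by omega
    obtain ⟨t, ht, c', hr, hd⟩ := hb (c := { c with pc := c.pc + 1 }) hp.right.left h.pc hbd h1
      hs.2 (by omega)
    have hj := hp.right.right.head
    simp only [List.length_cons, List.length_nil, Nat.zero_add] at hj
    rw [← hd.pc] at hj
    refine ⟨t + 1 + 1, ?_, _, run_cons (c' := { c with pc := c.pc + 1 }) hp.head ?_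
      (run_trans hr (run_one hj rfl)), ?_, ?_, ?_⟩
    · simp only [cost, if_neg hcase]; omega
    · simp [exec, hlt]
    · simpa only [eval, if_neg hcase] using hd.rel.pc
    · simp [compile]
      omega
    · exact hd.keep

end Com

namespace Com

variable {X : ℕ → ℝ} {prog : List Instr} {W R : ℕ}

/-- The body is compiled at depth `e + 1` and therefore keeps the odd registers from 21 up to `4 * e
+ 23`, which include counter and bound of this loop and of all enclosing ones. -/
theorem Simulated.loop {a : Com} (x y : ℕ) (hW : R ≤ W) (ha : Simulated X prog W R a) :
    Simulated X prog W R (loop x y a) := by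
  intro N e σ c hp h hbd h1 hs hR
  simp only [cost] at hR
  simp only [compile] at hp
  set L := (a.compile (c.pc + 5) (e + 1)).length with hL
  have hy := hbd.var y
  have hhead := hp.left
  have hbody := hp.right.left
  have htail := hp.right.right
  simp only [List.length_cons, List.length_nil, Nat.zero_add, Nat.reduceAdd] at hbody htail
  rw [← hL] at htail
  have key : ∀ i ≤ σ.var y, ∃ t ≤ 2 + ∑ j ∈ Finset.range i,
      (5 + a.cost X ((iter (fun i τ => a.eval X (τ.set x i)) j σ).set x j)), ∃ c',
      run prog W t c = some c' ∧ c'.ireg (4 * e + 21) = i ∧ c'.ireg (4 * e + 23) = σ.var y ∧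
        Done X R e (iter (fun i τ => a.eval X (τ.set x i)) i σ) (c.pc + 2) c c' := by
    intro i
    induction i with
    | zero =>
      intro _
      have hy' := h.var y
      have hz := h.zero
      refine ⟨2, by simp, _, run_cons hhead.head (exec_iadd _ ?_) (run_one hhead.tail.head
        (exec_iadd _ ?_)), ?_, ?_, ?_⟩
      · omega
      · simp [Function.update_of_ne (show 2 * y ≠ 4 * e + 21 by omega)]
        omega
      · simp [hz]
      · simp [Function.update_of_ne (show 2 * y ≠ 4 * e + 21 by omega),
          hy', hz]
      · refine ⟨⟨fun x => ?_, ?_, ?_, ?_, h.mem, h.out, h.rmem⟩, rfl, fun r h2 h3 h4 => ?_⟩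
        · simp only []
          rw [Function.update_of_ne (by omega), Function.update_of_ne (by omega), h.var x]
          rfl
        · simp only []
          rw [Function.update_of_ne (by omega), Function.update_of_ne (by omega), h.zero]
        · simp only []
          rw [Function.update_of_ne (by omega), Function.update_of_ne (by omega), h.one]
        · simp only []
          rw [Function.update_of_ne (by omega), Function.update_of_ne (by omega), h.radix]
        · simp only []
          rw [Function.update_of_ne (by omega), Function.update_of_ne (by omega)]
    | succ i ih =>
      intro hi
      obtain ⟨t, ht, c₁, hr₁, hcnt, hbnd, hd⟩ := ih (by omega)
      set τ := iter (fun i τ => a.eval X (τ.set x i)) i σ with hτ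
      have hsum : ∑ j ∈ Finset.range (i + 1),
          (5 + a.cost X ((iter (fun i τ => a.eval X (τ.set x i)) j σ).set x j)) ≤
          ∑ j ∈ Finset.range (σ.var y),
          (5 + a.cost X ((iter (fun i τ => a.eval X (τ.set x i)) j σ).set x j)) :=
        Finset.sum_le_sum_of_subset (Finset.range_mono hi)
      rw [Finset.sum_range_succ, ← hτ] at hsum ⊢
      have hτb := iter_bounded (x := x) i hbd (by omega)
        fun hN hσ => eval_bounded (X := X) (K := 8) a (by omega) (hs.mono hN) hσ
      rw [← hτ] at hτb
      have hlt : c₁.ireg (4 * e + 21) < c₁.ireg (4 * e + 23) := by omega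
      have hz := hd.rel.zero
      let c₂ : Config := { c₁ with pc := c.pc + 4 }
      let c₃ : Config := { c₁ with pc := c.pc + 5, ireg := Function.update c₁.ireg (2 * x) i }
      have hr₂ : run prog W 1 c₁ = some c₂ := by
        refine run_one ?_ ?_ (i := .ijlt (4 * e + 21) (4 * e + 23) (c.pc + 4))
        · rw [hd.pc]
          exact hhead.tail.tail.head
        · simp [exec, hlt, c₂]
      have hr₃ : run prog W 1 c₂ = some c₃ := by
        refine run_one (i := .iadd (2 * x) (4 * e + 21) 3) hhead.tail.tail.tail.tail.head ?_
        rw [exec_iadd]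
        · simp [c₂, c₃, hcnt, hz]
        · simp [c₂, hcnt, hz]; omega
      have hrel₃ : Rel X R (τ.set x i) c₃ := by
        refine (hd.rel.assign (c' := c₃) ?_ ?_ rfl rfl).1
        · intro r _ _ h4
          simp [c₃, h4]
        · simp [c₃]
      obtain ⟨t', ht', c₄, hr₄, hd₄⟩ := ha (c := c₃) hbody hrel₃
        (hτb.set (x := x) (v := i) (by omega)) (by omega) (hs.mono (Nat.le_add_right _ _))
        (by omega)
      have hcnt₄ : c₄.ireg (4 * e + 21) = i := by
        rw [hd₄.keep _ (by omega) (by omega) (by omega)]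
        simp only [c₃]
        rw [Function.update_of_ne (by omega), hcnt]
      have hbnd₄ : c₄.ireg (4 * e + 23) = σ.var y := by
        rw [hd₄.keep _ (by omega) (by omega) (by omega)]
        simp only [c₃]
        rw [Function.update_of_ne (by omega), hbnd]
      have hone := hd₄.rel.one
      let c₅ : Config :=
        { c₄ with pc := c₄.pc + 1, ireg := Function.update c₄.ireg (4 * e + 21) (i + 1) }
      let c₆ : Config :=
        { c₄ with pc := c.pc + 2, ireg := Function.update c₄.ireg (4 * e + 21) (i + 1) }
      rw [← show c₄.pc = c.pc + 5 + L from hd₄.pc] at htail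
      have hr₅ : run prog W 1 c₄ = some c₅ := by
        refine run_one htail.head ?_
        rw [exec_iadd, hcnt₄, hone]
        rw [hcnt₄, hone]
        omega
      have hr₆ : run prog W 1 c₅ = some c₆ :=
        run_one (i := .jump (c.pc + 2)) htail.tail.head rfl
      refine ⟨t + (1 + (1 + (t' + (1 + 1)))), ?_, c₆, run_trans hr₁ (run_trans hr₂ (run_trans hr₃
        (run_trans hr₄ (run_trans hr₅ hr₆)))), ?_, ?_, ?_, rfl, fun r h2 h3 h4 => ?_⟩
      · omega
      · simp [c₆]
      · simp [c₆, hbnd₄]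
      · refine ⟨fun x => ?_, ?_, ?_, ?_, hd₄.rel.mem, hd₄.rel.out, hd₄.rel.rmem⟩ <;>
          simp only [c₆] <;> rw [Function.update_of_ne (by omega)]
        · exact hd₄.rel.var x
        · exact hd₄.rel.zero
        · exact hd₄.rel.one
        · exact hd₄.rel.radix
      · simp only [c₆]
        rw [Function.update_of_ne (by omega), hd₄.keep r (by omega) h3 h4]
        simp only [c₃]
        rw [Function.update_of_ne (by omega), hd.keep r h2 h3 h4]
  obtain ⟨t, ht, c₁, hr₁, hcnt, hbnd, hd⟩ := key _ le_rfl
  refine ⟨t + (1 + 1), by simp only [cost]; omega, { c₁ with pc := c.pc + 7 + L },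
    run_trans hr₁ (run_cons (i := .ijlt (4 * e + 21) (4 * e + 23) (c.pc + 4))
    (c' := { c₁ with pc := c.pc + 3 }) ?_ ?_
    (run_one (i := .jump (c.pc + 7 + L)) hhead.tail.tail.tail.head rfl)), hd.rel.pc, ?_, hd.keep⟩
  · rw [hd.pc]
    exact hhead.tail.tail.head
  · simp [exec, hcnt, hbnd, hd.pc]
  · simp [compile, ← hL]
    omega

theorem simulated (hW : 2 * R ^ 9 ≤ W) (hW' : 5 * R ≤ W) (a : Com) :
    Simulated X prog W R a := by
  have hRW : R ≤ W := by omega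
  induction a with
  | skip =>
    intro N e σ c hp h hb h1 hs hR
    exact ⟨0, Nat.zero_le _, c, rfl, .of_similar h rfl (.refl c)⟩
  | const x v =>
    intro N e σ c hp h hb h1 hs hR
    have hv : v ≤ N := hs
    refine ⟨1, le_rfl, _, run_one hp.head (exec_iconst _ (by omega)),
      Done.assign h rfl (fun r _ _ h4 => ?_) ?_ rfl rfl⟩
    · simp [h4]
    · simp
  | copy x y =>
    intro N e σ c hp h hb h1 hs hR
    have hy := hb.var y
    have hz := h.zero
    have hv := h.var y
    refine ⟨1, le_rfl, _, run_one hp.head (exec_iadd _ (by omega)),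
      Done.assign h rfl (fun r _ _ h4 => ?_) ?_ rfl rfl⟩
    · simp [h4]
    · simp [hz, hv]
  | succ x y =>
    intro N e σ c hp h hb h1 hs hR
    have hy := hb.var y
    have ho := h.one
    have hv := h.var y
    simp only [cost] at hR
    refine ⟨1, le_rfl, _, run_one hp.head (exec_iadd _ (by omega)),
      Done.assign h rfl (fun r _ _ h4 => ?_) ?_ rfl rfl⟩
    · simp [h4]
    · simp [ho, hv]
  | eq x y z => exact simulated_eq hW' x y z
  | rlt x d s i c s' j => exact simulated_rlt hW' x d s i c s' j
  | load x k l => exact simulated_load hW hW' x k l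
  | store k l y => exact simulated_store hW k l y
  | mark y => exact simulated_mark y
  | seq a b iha ihb => exact iha.seq ihb
  | ite x a b iha ihb => exact iha.ite x ihb
  | loop x y a iha => exact iha.loop x y hRW

/-! ### The complete machine program: prologue and compiled command -/

/-- The initial state for `n` points and `m` squares. -/
def start (n m : ℕ) : St where
  var x := if x = 0 then n else if x = 1 then m else 0
  mem _ _ := 0
  out _ := 0

/-- The program that halts at once if there are no points, and otherwise computes the radix
`(n + m + 2) ^ e` for the addresses and runs the command. -/
def program (a : Com) (e : ℕ) : List Instr :=
  -- Register 3 still holds 0, so the jump is taken exactly if there are points. Without points `k*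
  -- = 0` and the time must be constant, so not even a pass over the squares is allowed. Afterwards
  -- `m` moves from register 1 to register 2, the place of variable 1.
  [.ijlt 3 0 2, .halt] ++ ([.iadd 2 1 3, .iconst 5 1, .iadd 13 0 2, .iconst 11 2, .iadd 13 13 11,
    .iconst 7 1] ++ (List.replicate e (.imul 7 7 13) ++ (a.compile (8 + e) 0 ++ [.halt])))

theorem program_halt {n m : ℕ} (p : Fin n → Plane) (u : Fin m → Plane) (a : Com) (e W : ℕ)
    (hn : n = 0) : ∃ c, run (a.program e) W 1 (initial p u) = some c ∧
      (a.program e)[c.pc]? = some .halt ∧ c.imem = fun _ => 0 := by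
  refine ⟨{ initial p u with pc := 1 }, ?_, rfl, rfl⟩
  refine run_one (i := .ijlt 3 0 2) rfl ?_
  simp [exec, initial, hn]

theorem run_power {B W : ℕ} : ∀ (e : ℕ) {c : Config}, c.ireg 13 = B → c.ireg 7 * B ^ e < W →
    1 ≤ B → CodeAt prog c.pc (List.replicate e (.imul 7 7 13)) →
    run prog W e c = some { c with
      pc := c.pc + e
      ireg := Function.update c.ireg 7 (c.ireg 7 * B ^ e) } := by
  intro e
  induction e with
  | zero => intro c _ _ _ _; simp [run]
  | succ e ih =>
    intro c hB hW h1 hp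
    rw [List.replicate_succ] at hp
    have hlt : c.ireg 7 * c.ireg 13 < W := by
      refine lt_of_le_of_lt ?_ hW
      rw [hB, pow_succ']
      exact Nat.mul_le_mul_left _ (Nat.le_mul_of_pos_right _ (by positivity))
    refine run_cons hp.head (exec_imul _ hlt) ?_
    rw [ih (by simp [hB]) (by simpa [hB, pow_succ', mul_assoc] using hW) h1 hp.tail]
    simp [hB, pow_succ', mul_assoc, add_comm, add_left_comm]

/-- The compiled program computes what the command says. -/
theorem exists_run_program {n m : ℕ} (p : Fin n → Plane) (u : Fin m → Plane) (a : Com) (e K : ℕ)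
    (hn : n ≠ 0) (he : 1 ≤ e) (hs : a.Small K 8)
    (hc : n + m + K + a.cost (initial p u).rmem (start n m) < (n + m + 2) ^ e) :
    ∃ t ≤ 7 + e + a.cost (initial p u).rmem (start n m), ∃ c,
      run (a.program e) ((n + m + 2) ^ (9 * e + 1)) t (initial p u) = some c ∧
      (a.program e)[c.pc]? = some .halt ∧
      ∀ j < m, c.imem j = (a.eval (initial p u).rmem (start n m)).out j := by
  set B := n + m + 2 with hB
  set W := B ^ (9 * e + 1) with hW
  set X := (initial p u).rmem with hX
  set prog := a.program e with hprog
  have hBR : B ≤ B ^ e := Nat.le_self_pow (by omega) B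
  -- The factor `B ≥ 2` beyond `(B ^ e) ^ 9` pays for the leading digit 1 in addresses with up to
  -- eight indices.
  have hRW : 2 * (B ^ e) ^ 9 ≤ W := by
    rw [hW, mul_comm 9 e, pow_succ' B, pow_mul]
    exact Nat.mul_le_mul_right _ (by omega)
  have h5 : 5 * B ^ e ≤ W := by
    refine le_trans ?_ hRW
    have h3 : 3 ^ 8 ≤ (B ^ e) ^ 8 := Nat.pow_le_pow_left (by omega) 8
    rw [pow_succ (B ^ e) 8, ← mul_assoc]
    exact Nat.mul_le_mul_right _ (by omega)
  have hcode : CodeAt prog 0 prog := fun k _ => by rw [Nat.zero_add]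
  have hp₁ : CodeAt prog 0 [.ijlt 3 0 2, .halt] := hcode.left
  have hp₂ := hcode.right.left
  have hp₃ := hcode.right.right.left
  have hp₄ := hcode.right.right.right.left
  have hp₅ := hcode.right.right.right.right
  simp only [List.length_cons, List.length_nil, List.length_replicate, Nat.zero_add,
    Nat.reduceAdd] at hp₂ hp₃ hp₄ hp₅
  let c₁ : Config := { initial p u with pc := 2 }
  have hr₁ : run prog W 1 (initial p u) = some c₁ := by
    refine run_one hp₁.head ?_
    simp [exec, initial, c₁]
    omega
  have hireg : ∀ i, c₁.ireg i = if i = 0 then n else if i = 1 then m else 0 := fun i => rfl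
  obtain ⟨c₂, hr₂, hpc₂, hi₂, hm₂, hx₂⟩ : ∃ c₂, run prog W 6 c₁ = some c₂ ∧ c₂.pc = 8 ∧
      (∀ i, c₂.ireg i = if i = 0 then n else if i = 2 then m else if i = 13 then B
        else if i = 7 then 1 else if i = 5 then 1 else if i = 11 then 2 else if i = 1 then m
        else 0) ∧ c₂.imem = (fun _ => 0) ∧ c₂.rmem = X := by
    refine ⟨_, run_cons hp₂.head (exec_iadd _ ?_) (run_cons hp₂.tail.head (exec_iconst _ ?_)
      (run_cons hp₂.tail.tail.head (exec_iadd _ ?_) (run_cons hp₂.tail.tail.tail.head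
      (exec_iconst _ ?_) (run_cons hp₂.tail.tail.tail.tail.head (exec_iadd _ ?_)
      (run_one hp₂.tail.tail.tail.tail.tail.head (exec_iconst _ ?_)))))), rfl, ?_, rfl, rfl⟩
    · simp [hireg]; omega
    · omega
    · simp [hireg]; omega
    · omega
    · simp [hireg]; omega
    · omega
    · intro i
      simp only [Function.update_apply, hireg]
      by_cases h0 : i = 0
      · subst h0; simp
      by_cases h2 : i = 2
      · subst h2; simp
      by_cases h13 : i = 13
      · subst h13; simp [hB]
      by_cases h7 : i = 7
      · subst h7; simp
      by_cases h5 : i = 5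
      · subst h5; simp
      by_cases h11 : i = 11
      · subst h11; simp
      simp [h0, h2, h13, h7, h5, h11]
  have hr₃ := run_power (prog := prog) (B := B) (W := W) e (c := c₂) (by simp [hi₂])
    (by simp [hi₂]; omega) (by omega) (by rw [hpc₂]; exact hp₃)
  simp only [hpc₂] at hr₃
  set c₃ : Config := { c₂ with
      pc := 8 + e
      ireg := Function.update c₂.ireg 7 (c₂.ireg 7 * B ^ e) } with hc₃
  have hrel : Rel X (B ^ e) (start n m) c₃ := by
    refine ⟨fun x => ?_, ?_, ?_, ?_, fun k _ l _ => ?_, fun j _ => ?_, hx₂⟩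
    · simp only [hc₃]
      rw [Function.update_of_ne (by omega), hi₂]
      by_cases h0 : x = 0
      · simp [h0, start]
      by_cases h1 : x = 1
      · simp [h1, start]
      simp only [start, if_neg h0, if_neg h1]
      rw [if_neg (by omega), if_neg (by omega), if_neg (by omega), if_neg (by omega),
        if_neg (by omega), if_neg (by omega), if_neg (by omega)]
    · simp [hc₃, hi₂]
    · simp [hc₃, hi₂]
    · simp [hc₃, hi₂]
    · simp [hc₃, hm₂, start]
    · simp [hc₃, hm₂, start]
  have hbd : (start n m).Bounded (n + m + K + 1) := by
    refine ⟨fun x => ?_, fun k l => ?_⟩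
    · simp only [start]
      split_ifs <;> omega
    · simp [start]
  have hbd' : (start n m).Bounded (n + m + K) := by
    refine ⟨fun x => ?_, fun k l => ?_⟩
    · simp only [start]
      split_ifs <;> omega
    · simp [start]
  obtain ⟨t, ht, c₄, hr₄, hd⟩ := simulated (prog := prog) hRW h5 a (c := c₃) (N := n + m + K)
    (e := 0) hp₄ hrel hbd' (by omega) (hs.mono (by omega)) hc
  refine ⟨1 + (6 + (e + t)), by omega, c₄, run_trans hr₁ (run_trans hr₂ (run_trans hr₃ hr₄)), ?_,
    fun j hj => hd.rel.out j (by omega)⟩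
  rw [hd.pc]
  exact hp₅.head

end Com

namespace Com

/-! ### Reasoning about commands -/

/-- The variables that a command may change. -/
def modv : Com → ℕ → Bool
  | const x _, z => z == x
  | copy x _, z => z == x
  | succ x _, z => z == x
  | eq x _ _, z => z == x
  | rlt x _ _ _ _ _ _, z => z == x
  | load x _ _, z => z == x
  | seq a b, z => a.modv z || b.modv z
  | ite _ a b, z => a.modv z || b.modv z
  | loop x _ a, z => z == x || a.modv z
  | _, _ => false

/-- The arrays that a command may change. -/
def modm : Com → ℕ → Bool
  | store k _ _, z => z == k
  | seq a b, z => a.modm z || b.modm z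
  | ite _ a b, z => a.modm z || b.modm z
  | loop _ _ a, z => a.modm z
  | _, _ => false

/-- Whether a command may change the output. -/
def modo : Com → Bool
  | mark _ => true
  | seq a b => a.modo || b.modo
  | ite _ a b => a.modo || b.modo
  | loop _ _ a => a.modo
  | _ => false

/-- The states `σ` and `τ` differ only in places that `a` may change. -/
structure Frame (a : Com) (σ τ : St) : Prop where
  var : ∀ z, a.modv z = false → τ.var z = σ.var z
  mem : ∀ k, a.modm k = false → τ.mem k = σ.mem k
  out : a.modo = false → τ.out = σ.out

theorem Frame.refl (a : Com) (σ : St) : Frame a σ σ :=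
  ⟨fun _ _ => rfl, fun _ _ => rfl, fun _ => rfl⟩

theorem Frame.trans {a : Com} {σ τ υ : St} (h : Frame a σ τ) (h' : Frame a τ υ) : Frame a σ υ :=
  ⟨fun z hz => (h'.var z hz).trans (h.var z hz), fun k hk => (h'.mem k hk).trans (h.mem k hk),
    fun ho => (h'.out ho).trans (h.out ho)⟩

theorem Frame.set {a : Com} {σ τ : St} (h : Frame a σ τ) {x : ℕ} (hx : a.modv x = true) (v : ℕ) :
    Frame a σ (τ.set x v) := by
  refine ⟨fun z hz => ?_, h.mem, h.out⟩
  rw [St.set_var, if_neg, h.var z hz]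
  rintro rfl
  rw [hx] at hz
  cases hz

theorem frame (X : ℕ → ℝ) (a : Com) (σ : St) : Frame a σ (a.eval X σ) := by
  induction a generalizing σ with
  | skip => exact .refl _ _
  | mark y => exact ⟨fun _ _ => rfl, fun _ _ => rfl, fun h => by cases h⟩
  | store k l y =>
    refine ⟨fun _ _ => rfl, fun z hz => ?_, fun _ => rfl⟩
    have : z ≠ k := by simpa [modm] using hz
    funext l'
    simp [eval, this]
  | seq a b iha ihb =>
    have h1 := iha σ
    have h2 := ihb (a.eval X σ)
    refine ⟨fun z hz => ?_, fun z hz => ?_, fun hz => ?_⟩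
    · rw [modv, Bool.or_eq_false_iff] at hz
      exact (h2.var z hz.2).trans (h1.var z hz.1)
    · rw [modm, Bool.or_eq_false_iff] at hz
      exact (h2.mem z hz.2).trans (h1.mem z hz.1)
    · rw [modo, Bool.or_eq_false_iff] at hz
      exact (h2.out hz.2).trans (h1.out hz.1)
  | ite x a b iha ihb =>
    have h1 := iha σ
    have h2 := ihb σ
    refine ⟨fun z hz => ?_, fun z hz => ?_, fun hz => ?_⟩ <;> simp only [eval]
    · rw [modv, Bool.or_eq_false_iff] at hz
      split_ifs
      exacts [h1.var z hz.1, h2.var z hz.2]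
    · rw [modm, Bool.or_eq_false_iff] at hz
      split_ifs
      exacts [h1.mem z hz.1, h2.mem z hz.2]
    · rw [modo, Bool.or_eq_false_iff] at hz
      split_ifs
      exacts [h1.out hz.1, h2.out hz.2]
  | loop x y a iha =>
    simp only [eval]
    generalize σ.var y = n
    induction n with
    | zero => exact .refl _ _
    | succ n ih =>
      simp only [iter]
      generalize iter (fun i τ => a.eval X (τ.set x i)) n σ = τ at ih
      have h2 := iha (τ.set x n)
      refine ih.trans ((Frame.refl _ τ).set (x := x) (by simp [modv]) n |>.trans ⟨?_, ?_, ?_⟩)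
      · intro z hz
        rw [modv, Bool.or_eq_false_iff] at hz
        exact h2.var z hz.2
      · intro z hz
        exact h2.mem z hz
      · intro hz
        exact h2.out hz
  | _ =>
    refine ⟨fun z hz => ?_, fun _ _ => rfl, fun _ => rfl⟩
    simp only [modv, beq_eq_false_iff_ne] at hz
    simp [eval, hz]

variable {X : ℕ → ℝ}

theorem frame_iter (a : Com) (x y n : ℕ) (σ : St) :
    Frame (loop x y a) σ (iter (fun i τ => a.eval X (τ.set x i)) n σ) := by
  induction n with
  | zero => exact .refl _ _
  | succ n ih =>
    have h := frame X a ((iter (fun i τ => a.eval X (τ.set x i)) n σ).set x n)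
    refine ih.trans ((Frame.refl _ _).set (x := x) (by simp [modv]) n |>.trans ⟨?_, ?_, ?_⟩)
    · intro z hz
      rw [modv, Bool.or_eq_false_iff] at hz
      exact h.var z hz.2
    · exact fun z hz => h.mem z hz
    · exact fun hz => h.out hz

/-- The invariant rule for loops. -/
theorem loop_inv {a : Com} {x y : ℕ} {σ : St} (I : ℕ → St → Prop) (h0 : I 0 σ)
    (hstep : ∀ i < σ.var y, ∀ τ, Frame (loop x y a) σ τ → I i τ →
      I (i + 1) (a.eval X (τ.set x i))) :
    I (σ.var y) ((loop x y a).eval X σ) := by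
  simp only [eval]
  have : ∀ n ≤ σ.var y, I n (iter (fun i τ => a.eval X (τ.set x i)) n σ) := by
    intro n
    induction n with
    | zero => exact fun _ => h0
    | succ n ih => exact fun hn => hstep n hn _ (frame_iter a x y n σ) (ih (by omega))
  exact this _ le_rfl

/-- The invariant rule for the cost of a loop. -/
theorem loop_cost {a : Com} {x y T : ℕ} {σ : St} (I : ℕ → St → Prop) (h0 : I 0 σ)
    (hstep : ∀ i < σ.var y, ∀ τ, Frame (loop x y a) σ τ → I i τ →
      I (i + 1) (a.eval X (τ.set x i)) ∧ a.cost X (τ.set x i) ≤ T) :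
    (loop x y a).cost X σ ≤ 4 + σ.var y * (5 + T) := by
  have h : ∀ n ≤ σ.var y, I n (iter (fun i τ => a.eval X (τ.set x i)) n σ) := by
    intro n
    induction n with
    | zero => exact fun _ => h0
    | succ n ih => exact fun hn => (hstep n hn _ (frame_iter a x y n σ) (ih (by omega))).1
  simp only [cost]
  refine Nat.add_le_add_left ?_ _
  refine (Finset.sum_le_card_nsmul _ _ (5 + T) fun i hi => ?_).trans (by simp)
  have hi' := Finset.mem_range.1 hi
  exact Nat.add_le_add_left (hstep i hi' _ (frame_iter a x y i σ) (h i hi'.le)).2 _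

/-- The bound variables of the loops in a command. -/
def loopBounds : Com → List ℕ
  | seq a b => a.loopBounds ++ b.loopBounds
  | ite _ a b => a.loopBounds ++ b.loopBounds
  | loop _ y a => y :: a.loopBounds
  | _ => []

/-- A bound on the cost of a command from bounds `β` on the bound variables of its loops. -/
def bound (β : ℕ → ℕ) : Com → ℕ
  | skip => 0
  | const _ _ => 1
  | copy _ _ => 1
  | succ _ _ => 1
  | eq _ _ _ => 5
  | rlt _ _ _ _ _ _ _ => 15
  | load _ _ l => 2 * l.length + 3
  | store _ l _ => 2 * l.length + 3
  | mark _ => 1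
  | seq a b => a.bound β + b.bound β
  | ite _ a b => 2 + (a.bound β + b.bound β)
  | loop _ y a => 4 + β y * (5 + a.bound β)

/-- The command must not change the bound variables of its loops; then their initial values bound
every iteration, and no invariant is needed. -/
theorem cost_le_bound {β : ℕ → ℕ} (a : Com) {σ : St}
    (h : ∀ y ∈ a.loopBounds, a.modv y = false ∧ σ.var y ≤ β y) : a.cost X σ ≤ a.bound β := by
  induction a generalizing σ with
  | seq a b iha ihb =>
    simp only [loopBounds, List.mem_append, modv, Bool.or_eq_false_iff] at h
    refine Nat.add_le_add (iha fun y hy => ⟨(h y (.inl hy)).1.1, (h y (.inl hy)).2⟩)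
      (ihb fun y hy => ⟨(h y (.inr hy)).1.2, ?_⟩)
    rw [(frame X a σ).var y (h y (.inr hy)).1.1]
    exact (h y (.inr hy)).2
  | ite x a b iha ihb =>
    simp only [loopBounds, List.mem_append, modv, Bool.or_eq_false_iff] at h
    have h1 := iha (σ := σ) fun y hy => ⟨(h y (.inl hy)).1.1, (h y (.inl hy)).2⟩
    have h2 := ihb (σ := σ) fun y hy => ⟨(h y (.inr hy)).1.2, (h y (.inr hy)).2⟩
    simp only [cost, bound]
    split_ifs <;> omega
  | loop x y a iha =>
    simp only [loopBounds, List.mem_cons, modv, Bool.or_eq_false_iff, beq_eq_false_iff_ne] at h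
    refine (loop_cost (T := a.bound β) (fun _ τ => True) trivial fun i _ τ hτ _ =>
      ⟨trivial, iha fun z hz => ⟨(h z (.inr hz)).1.2, ?_⟩⟩).trans ?_
    · have hz' := h z (.inr hz)
      rw [St.set_var, if_neg hz'.1.1, hτ.var z (by simp [modv, hz'.1])]
      exact hz'.2
    · exact Nat.add_le_add_left (Nat.mul_le_mul_right _ (h y (.inl rfl)).2) _
  | _ => exact le_rfl

/-- Commands one after the other. -/
def seqs : List Com → Com
  | [] => skip
  | [a] => a
  | a :: b :: l => seq a (seqs (b :: l))

/-- Nested loops. -/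
def nest : List (ℕ × ℕ) → Com → Com
  | [], a => a
  | p :: L, a => loop p.1 p.2 (nest L a)

theorem modv_nest (L : List (ℕ × ℕ)) (a : Com) (z : ℕ) (h : ∀ p ∈ L, z ≠ p.1)
    (ha : a.modv z = false) : (nest L a).modv z = false := by
  induction L with
  | nil => exact ha
  | cons p L ih =>
    simp only [List.mem_cons, forall_eq_or_imp] at h
    simp only [nest, modv, Bool.or_eq_false_iff, beq_eq_false_iff_ne]
    exact ⟨h.1, ih h.2⟩

/-- The invariant rule for nested loops over a body that establishes a persistent property `P τ` for
the tuple `τ` of loop values. -/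
theorem nest_inv {a : Com} : ∀ (L : List (ℕ × ℕ)) (I : St → Prop) (P : List ℕ → St → Prop),
    (L.map Prod.fst).Nodup → (∀ p ∈ L, ∀ q ∈ L, p.1 ≠ q.2) →
    (∀ p ∈ L, a.modv p.1 = false ∧ a.modv p.2 = false) →
    (∀ σ v, ∀ p ∈ L, I σ → I (σ.set p.1 v)) → (∀ τ σ v, ∀ p ∈ L, P τ σ → P τ (σ.set p.1 v)) →
    (∀ σ, I σ → (∀ p ∈ L, σ.var p.1 < σ.var p.2) →
      I (a.eval X σ) ∧ P (L.map fun p => σ.var p.1) (a.eval X σ) ∧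
        ∀ τ, P τ σ → P τ (a.eval X σ)) →
    ∀ σ, I σ → I ((nest L a).eval X σ) ∧ (∀ τ, P τ σ → P τ ((nest L a).eval X σ)) ∧
      ∀ τ, List.Forall₂ (· < ·) τ (L.map fun p => σ.var p.2) → P τ ((nest L a).eval X σ) := by
  intro L
  induction L with
  | nil =>
    intro I P _ _ _ _ _ hstep σ hσ
    obtain ⟨h1, h2, h3⟩ := hstep σ hσ (by simp)
    refine ⟨h1, h3, fun τ hτ => ?_⟩
    rw [List.map_nil, List.forall₂_nil_right_iff] at hτ
    subst hτ
    exact h2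
  | cons p L ih =>
    intro I P hnd hdis hmod hI hP hstep σ hσ
    simp only [List.map_cons, List.nodup_cons, List.mem_map, not_exists, not_and] at hnd
    have key : I ((nest (p :: L) a).eval X σ) ∧
        (∀ τ, P τ σ → P τ ((nest (p :: L) a).eval X σ)) ∧ ∀ i < σ.var p.2, ∀ τ,
          List.Forall₂ (· < ·) τ (L.map fun p => σ.var p.2) →
          P (i :: τ) ((nest (p :: L) a).eval X σ) := by
      refine loop_inv (fun i υ => I υ ∧ (∀ τ, P τ σ → P τ υ) ∧ ∀ i' < i, ∀ τ,
          List.Forall₂ (· < ·) τ (L.map fun p => σ.var p.2) → P (i' :: τ) υ) ⟨hσ, fun _ h => h, by simp⟩ ?_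
      rintro i hi υ hυ ⟨h1, h2, h3⟩
      have hbound : ∀ q ∈ p :: L, υ.var q.2 = σ.var q.2 := by
        intro q hq
        refine hυ.var _ ?_
        refine modv_nest (p :: L) a q.2 (fun r hr => (hdis r hr q hq).symm) (hmod q hq).2
      have hne : ∀ q ∈ L, q.1 ≠ p.1 := fun q hq => hnd.1 q hq
      -- The induction hypothesis is used for the property `P (i :: ·)`. The invariant additionally
      -- records the value of the outer loop variable, the loop bounds, and that nothing established
      -- before is lost.
      have := ih (fun υ' => I υ' ∧ υ'.var p.1 = i ∧ (∀ q ∈ p :: L, υ'.var q.2 = σ.var q.2) ∧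
          ∀ τ, P τ υ → P τ υ') (fun τ υ' => P (i :: τ) υ') hnd.2
        (fun q hq r hr => hdis q (.tail _ hq) r (.tail _ hr)) (fun q hq => hmod q (.tail _ hq))
        (fun υ' v q hq h => ⟨hI _ _ _ (.tail _ hq) h.1, by
            rw [St.set_var, if_neg (hne q hq).symm, h.2.1], fun r hr => by
            rw [St.set_var, if_neg (hdis q (.tail _ hq) r hr).symm, h.2.2.1 r hr],
            fun τ hτ => hP _ _ _ _ (.tail _ hq) (h.2.2.2 τ hτ)⟩)
        (fun τ υ' v q hq h => hP _ _ _ _ (.tail _ hq) h)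
        (fun υ' hυ' hlt => by
          obtain ⟨g1, g2, g3⟩ := hstep υ' hυ'.1 (by
            simp only [List.mem_cons, forall_eq_or_imp]
            refine ⟨?_, hlt⟩
            rw [hυ'.2.1, hυ'.2.2.1 p (.head _)]
            exact hi)
          rw [List.map_cons, hυ'.2.1] at g2
          refine ⟨⟨g1, ?_, fun q hq => ?_, fun τ hτ => g3 τ (hυ'.2.2.2 τ hτ)⟩, g2,
            fun τ hτ => g3 _ hτ⟩
          · rw [(frame X a υ').var _ (hmod p (.head _)).1, hυ'.2.1]
          · rw [(frame X a υ').var _ (hmod q hq).2, hυ'.2.2.1 q hq])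
        (υ.set p.1 i) ⟨hI _ _ _ (.head _) h1, by simp, fun q hq => by
          rw [St.set_var, if_neg (hdis p (.head _) q hq).symm, hbound q hq],
          fun τ hτ => hP _ _ _ _ (.head _) hτ⟩
      obtain ⟨⟨g1, -, -, g4⟩, -, g3⟩ := this
      refine ⟨g1, fun τ hτ => g4 τ (h2 τ hτ), fun i' hi' τ hτ => ?_⟩
      rcases Nat.lt_succ_iff_lt_or_eq.1 hi' with hlt | rfl
      · exact g4 _ (h3 i' hlt τ hτ)
      · refine g3 τ ?_
        rwa [List.map_congr_left (g := fun q => σ.var q.2) fun q hq => ?_]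
        rw [St.set_var, if_neg (hdis p (.head _) q (.tail _ hq)).symm, hbound q (.tail _ hq)]
    refine ⟨key.1, key.2.1, fun τ hτ => ?_⟩
    obtain ⟨i, τ', hi, hτ', rfl⟩ := List.forall₂_cons_right_iff.1 hτ
    exact key.2.2 i hi τ' hτ'

end Com

/-! ### The program

Variables: 0 and 1 hold the numbers `n` of points and `m` of squares; 2, 3 and 4 hold `m + 1`,
`2 * m + 1` and the counter bound plus one; 5 is the counter bound, 13 and 14 are the coordinates of
the current cell, 17 is the result of the feasibility test, 20 to 27 are the counters and the
current squares of the four corner groups.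

Arrays: 0 incidences, 1 occupied rank pairs, 2 their representatives, 3 and 4 flags of stabbed
squares, 5 and 6 stabbing lines of squares, 7 and 8 numbers of lines before points, 9 squares in
use, 10 reachable states, 11 finished cells. -/

namespace Com

/-- Run `a` if point 6 lies in square 7. -/
def whenInside (a : Com) : Com :=
  seqs [rlt 8 0 false 6 0 true 7, ite 8 skip (seqs [rlt 8 1 false 6 0 true 7, ite 8 skip
    (seqs [rlt 8 0 true 7 1 false 6, ite 8 skip (seqs [rlt 8 1 true 7 1 false 6, ite 8 skip a])])])]

/-- Compute the incidences. -/
def incidences : Com := loop 6 0 (loop 7 1 (whenInside (seqs [const 9 1, store 0 [6, 7] 9])))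

/-- Put the rank of coordinate `d` of point 6 among the coordinates of the squares into `x`. -/
def rankOf (d x : ℕ) : Com :=
  seqs [const x 0, loop 7 1 (seqs [rlt 8 d false 6 0 true 7, ite 8 skip (succ x x),
    rlt 8 d true 7 1 false 6, ite 8 (succ x x) skip])]

/-- Choose representatives of the points. -/
def table : Com :=
  loop 6 0 (seqs [rankOf 0 15, rankOf 1 16, const 9 1, store 1 [15, 16] 9, store 2 [15, 16] 6])

/-- Put the leftmost square not stabbed by lines so far into variable 10. -/
def leftmost (d : ℕ) : Com :=
  seqs [copy 10 1, loop 7 1 (seqs [load 8 (3 + d) [7], ite 8 skip (seqs [eq 9 10 1,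
    ite 9 (copy 10 7) (seqs [rlt 8 d true 7 0 true 10, ite 8 (copy 10 7) skip])])])]

/-- Assign squares to the line at the right end of square 10. -/
def stab (d : ℕ) : Com :=
  seqs [const 12 1, loop 7 1 (seqs [load 8 (3 + d) [7], ite 8 skip (seqs [rlt 8 d true 10 1 true 7,
    ite 8 skip (seqs [store (3 + d) [7] 12, store (5 + d) [7] 11])])])]

/-- Count the line at the right end of square 10 for the points behind it. -/
def pass (d : ℕ) : Com :=
  seqs [succ 12 11, loop 6 0 (seqs [rlt 8 d false 6 (-1) true 10, ite 8 skip (store (7 + d) [6] 12)])]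

/-- Choose the stabbing lines for coordinate `d`. -/
def lines (d : ℕ) : Com :=
  loop 11 1 (seqs [leftmost d, eq 9 10 1, ite 9 skip (seqs [stab d, pass d])])

/-- The variables of a state of the feasibility test. -/
def stateVars : List ℕ := [20, 21, 22, 23, 24, 25, 26, 27]

/-- The loops through all states of the feasibility test. -/
def stateLoops : List (ℕ × ℕ) :=
  -- Counters run below variable 4, the counter bound plus one. Current squares run below variable
  -- 2, which is `m + 1`, since the number `m` stands for no current square.
  [(20, 4), (21, 4), (22, 4), (23, 4), (24, 2), (25, 2), (26, 2), (27, 2)]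

/-- Run `a` if the line of square 7 stored in array `k` is the first (or the second, if `b`) of the
two lines that bound the cell with coordinate in variable `c`. -/
def whenLine (k c : ℕ) (b : Bool) (a : Com) : Com :=
  seqs [load 8 k [7], bif b then skip else succ 8 8, eq 8 8 c, ite 8 a skip]

/-- From the current state of the test, switch to square 7 in group `g` if possible. -/
def switch (g : ℕ) : Com :=
  seqs [load 8 9 [7], ite 8 (whenLine 5 13 (g % 2 == 1) (whenLine 6 14 (g / 2 == 1)
    (store 10 ((stateVars.set g 28).set (4 + g) 7) 9))) skip]

/-- Switch squares of group `g` in all states. -/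
def switchAll (g : ℕ) : Com :=
  nest stateLoops (seqs [load 8 10 stateVars, ite 8 (seqs [eq 8 (20 + g) 5, ite 8 skip
    (seqs [succ 28 (20 + g), const 9 1, loop 7 1 (switch g)])]) skip])

/-- Discard the current state if the representative of rank pair 18, 19 lies in the current cell but
in none of the current squares. -/
def checkPoint : Com :=
  seqs [load 8 1 [18, 19], ite 8 (seqs [load 6 2 [18, 19], load 8 7 [6], eq 8 8 13,
    ite 8 (seqs [load 8 8 [6], eq 8 8 14, ite 8 (seqs [load 8 0 [6, 24], ite 8 skip
      (seqs [load 8 0 [6, 25], ite 8 skip (seqs [load 8 0 [6, 26], ite 8 skip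
      (seqs [load 8 0 [6, 27], ite 8 skip (seqs [const 9 0, store 10 stateVars 9])])])])]) skip])
    skip]) skip]

/-- Discard the states that miss a point of column 18. -/
def checkAll : Com :=
  nest stateLoops (seqs [load 8 10 stateVars, ite 8 (loop 19 3 checkPoint) skip])

/-- Only the state without squares is reachable. -/
def initStates : Com :=
  seqs [const 9 0, nest stateLoops (store 10 stateVars 9), const 20 0, const 21 0, const 22 0,
    const 23 0, copy 24 1, copy 25 1, copy 26 1, copy 27 1, const 9 1, store 10 stateVars 9]

/-- Whether a state is reachable. -/
def findState : Com :=
  seqs [const 17 0, nest stateLoops (seqs [load 8 10 stateVars, ite 8 (const 17 1) skip])]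

/-- Process column 18. -/
def column : Com := seqs [switchAll 0, switchAll 1, switchAll 2, switchAll 3, checkAll]

/-- Test whether the representatives in the current cell can be covered by squares in use, with at
most as many squares of each corner group as variable 5 says. -/
def feasible : Com := seqs [initStates, loop 18 3 column, findState]

/-- Find the least counter bound. -/
def search : Com :=
  seqs [const 5 0, const 17 0, loop 11 1 (ite 17 skip (seqs [succ 5 5, succ 4 5, feasible]))]

/-- Remove squares while this is possible. -/
def shrink : Com :=
  loop 11 1 (seqs [const 9 0, store 9 [11] 9, feasible,
    ite 17 skip (seqs [const 9 1, store 9 [11] 9])])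

/-- Output the squares in use. -/
def output : Com := loop 7 1 (seqs [load 8 9 [7], ite 8 (mark 7) skip])

/-- Cover the points of the current cell. -/
def cell : Com :=
  seqs [load 8 11 [13, 14], ite 8 skip (seqs [const 9 1, store 11 [13, 14] 9,
    loop 7 1 (store 9 [7] 9), search, shrink, output])]

/-- Process the four cells of each square. -/
def cells : Com :=
  loop 29 1 (seqs [load 30 5 [29], load 31 6 [29], succ 32 30, succ 33 31,
    copy 13 30, copy 14 31, cell, copy 13 32, copy 14 31, cell,
    copy 13 30, copy 14 33, cell, copy 13 32, copy 14 33, cell])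

/-- Set the loop bounds. -/
def setup : Com := seqs [succ 2 1, const 3 1, loop 7 1 (succ 3 3), loop 7 1 (succ 3 3)]

/-- The whole computation. -/
def main : Com := seqs [setup, incidences, table, lines 0, lines 1, cells]

/-- States, with their eight components, are the longest index lists; 20 is a generous bound for
constants and array numbers. -/
theorem small_main : main.Small 20 8 := by
  simp [main, setup, incidences, table, lines, cells, cell, output, shrink, search, feasible, column,
    findState, initStates, checkAll, checkPoint, switchAll, switch, whenLine, stateLoops, stateVars,
    pass, stab, leftmost, rankOf, whenInside, seqs, nest, Small]

end Com

@[simp] theorem St.set_set (σ : St) (x v w : ℕ) : (σ.set x v).set x w = σ.set x w := by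
  simp [St.set]

/-! ### The feasibility test: switching squares -/

namespace Com

variable {X : ℕ → ℝ}

/-- Square `j` is in corner group `g` of the current cell. -/
def InGroup (σ : St) (g j : ℕ) : Prop :=
  σ.mem 5 [j] + 1 = σ.var 13 + g % 2 ∧ σ.mem 6 [j] + 1 = σ.var 14 + g / 2

/-- Square `j` is in use and in corner group `g` of the current cell. -/
def Usable (σ : St) (g j : ℕ) : Prop := σ.mem 9 [j] ≠ 0 ∧ InGroup σ g j

/-- The state after a switch to square `j` in group `g`. -/
def move (τ : List ℕ) (g j : ℕ) : List ℕ := (τ.set g (τ.getD g 0 + 1)).set (4 + g) j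

/-- The tuples that occur in the loops through all states. -/
def InRange (σ : St) (τ : List ℕ) : Prop :=
  List.Forall₂ (· < ·) τ (stateLoops.map fun p => σ.var p.2)

theorem inRange_map {σ : St} (h : ∀ p ∈ stateLoops, σ.var p.1 < σ.var p.2) :
    InRange σ (stateVars.map σ.var) := by
  simp only [stateLoops, List.mem_cons, List.not_mem_nil, or_false, forall_eq_or_imp,
    forall_eq] at h
  simp [InRange, stateLoops, stateVars, h]

theorem switch_mem (g : ℕ) (hg : g < 4) (σ : St) (τ : List ℕ) [Decidable (Usable σ g (σ.var 7))] :
    ((switch g).eval X σ).mem 10 τ =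
      if Usable σ g (σ.var 7) ∧ τ = ((stateVars.map σ.var).set g (σ.var 28)).set (4 + g) (σ.var 7)
      then σ.var 9 else σ.mem 10 τ := by
  have hmap : ((stateVars.set g 28).set (4 + g) 7).map σ.var =
      ((stateVars.map σ.var).set g (σ.var 28)).set (4 + g) (σ.var 7) := by
    simp only [List.map_set]
  rw [← hmap]
  -- Variable 8 is scratch and not among the indices of the new state, so loading into it does not
  -- move the target cell.
  have key : ∀ v, List.map (σ.set 8 v).var ((stateVars.set g 28).set (4 + g) 7) =
      List.map σ.var ((stateVars.set g 28).set (4 + g) 7) := by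
    intro v
    refine List.map_congr_left fun z hz => ?_
    rw [St.set_var, if_neg]
    rintro rfl
    revert hz
    interval_cases g <;> decide
  by_cases h : σ.mem 9 [σ.var 7] = 0
  · simp [switch, seqs, eval, h, Usable]
  · interval_cases g <;>
      simp only [switch, whenLine, seqs, eval, Usable, InGroup, St.set_set, St.set_var, St.set_mem,
        List.map_cons, List.map_nil] <;> simp [eval, key] <;> split_ifs <;>
      simp_all

theorem getD_stateVars {g : ℕ} (hg : g < 4) (σ : St) :
    (stateVars.map σ.var).getD g 0 = σ.var (20 + g) := by
  interval_cases g <;> rfl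

theorem map_stateVars_congr {σ υ : St} (h : ∀ z, 20 ≤ z → z < 28 → υ.var z = σ.var z) :
    stateVars.map υ.var = stateVars.map σ.var := by
  simp [stateVars, h]

/-- Switching squares of group `g` in a single state. -/
theorem switchLoop_mem (g : ℕ) (hg : g < 4) (σ : St) (h28 : σ.var 28 = σ.var (20 + g) + 1)
    (h9 : σ.var 9 = 1) (τ : List ℕ) :
    ((loop 7 1 (switch g)).eval X σ).mem 10 τ ≠ 0 ↔ σ.mem 10 τ ≠ 0 ∨
      ∃ j < σ.var 1, Usable σ g j ∧ τ = move (stateVars.map σ.var) g j := by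
  classical
  revert τ
  refine loop_inv (fun i υ => ∀ τ, υ.mem 10 τ ≠ 0 ↔ σ.mem 10 τ ≠ 0 ∨
      ∃ j < i, Usable σ g j ∧ τ = move (stateVars.map σ.var) g j) (by simp) ?_
  intro i _ υ hυ ih τ
  have hv : ∀ z, z ≠ 7 → z ≠ 8 → υ.var z = σ.var z := by
    intro z h7 h8
    refine hυ.var z ?_
    simp [modv, switch, whenLine, seqs, h7, h8]
    interval_cases g <;> simp [modv, h8]
  have hm : ∀ k, k ≠ 10 → υ.mem k = σ.mem k := by
    intro k h10
    refine hυ.mem k ?_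
    simp [modm, switch, whenLine, seqs, h10]
    interval_cases g <;> simp [modm]
  rw [switch_mem g hg]
  have hu : Usable (υ.set 7 i) g ((υ.set 7 i).var 7) ↔ Usable σ g i := by
    simp [Usable, InGroup, hm, hv]
  have hmap : stateVars.map (υ.set 7 i).var = stateVars.map σ.var :=
    map_stateVars_congr fun z h1 h2 => by
      rw [St.set_var, if_neg (by omega), hv z (by omega) (by omega)]
  have hτ : ((stateVars.map (υ.set 7 i).var).set g ((υ.set 7 i).var 28)).set (4 + g)
      ((υ.set 7 i).var 7) = move (stateVars.map σ.var) g i := by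
    rw [hmap, move, getD_stateVars hg, ← h28]
    simp [hv]
  rw [hτ, hu]
  have h9' : (υ.set 7 i).var 9 = 1 := by simp [hv, h9]
  split_ifs with hc
  · simp only [h9', ne_eq, one_ne_zero, not_false_eq_true, true_iff]
    exact .inr ⟨i, Nat.lt_succ_self i, hc⟩
  · rw [St.set_mem, ih]
    refine or_congr_right ⟨fun ⟨j, hj, h⟩ => ⟨j, by omega, h⟩, fun ⟨j, hj, h⟩ => ⟨j, ?_, h⟩⟩
    rcases Nat.lt_succ_iff_lt_or_eq.1 hj with hlt | rfl
    exacts [hlt, (hc h).elim]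

/-- The parts of the state that the feasibility test reads only. -/
structure Same (σ υ : St) : Prop where
  var : ∀ z ∈ [1, 2, 3, 4, 5, 13, 14], υ.var z = σ.var z
  mem : ∀ k, k ≠ 10 → υ.mem k = σ.mem k

theorem Same.refl (σ : St) : Same σ σ := ⟨fun _ _ => rfl, fun _ _ => rfl⟩

theorem Same.trans {σ υ ω : St} (h : Same σ υ) (h' : Same υ ω) : Same σ ω :=
  ⟨fun z hz => (h'.var z hz).trans (h.var z hz), fun k hk => (h'.mem k hk).trans (h.mem k hk)⟩

theorem Same.set {σ υ : St} (h : Same σ υ) {x : ℕ} (hx : x ∉ [1, 2, 3, 4, 5, 13, 14]) (v : ℕ) :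
    Same σ (υ.set x v) := by
  refine ⟨fun z hz => ?_, h.mem⟩
  rw [St.set_var, if_neg, h.var z hz]
  rintro rfl
  exact hx hz

theorem Same.eval {σ υ : St} (h : Same σ υ) (a : Com)
    (hv : ∀ z ∈ [1, 2, 3, 4, 5, 13, 14], a.modv z = false)
    (hm : ∀ k, k ≠ 10 → a.modm k = false) : Same σ (a.eval X υ) :=
  h.trans ⟨fun z hz => (frame X a υ).var z (hv z hz), fun k hk => (frame X a υ).mem k (hm k hk)⟩

theorem Same.inRange {σ υ : St} (h : Same σ υ) (τ : List ℕ) : InRange υ τ ↔ InRange σ τ := by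
  simp [InRange, stateLoops, h.var]

theorem Same.usable {σ υ : St} (h : Same σ υ) (g j : ℕ) : Usable υ g j ↔ Usable σ g j := by
  simp [Usable, InGroup, h.var, h.mem]

theorem stateLoops_nodup : (stateLoops.map Prod.fst).Nodup := by decide

theorem stateLoops_ne : ∀ p ∈ stateLoops, ∀ q ∈ stateLoops, p.1 ≠ q.2 := by decide

/-- The pass works in place, so a state created by it may be switched again in the same pass.
Soundness therefore asks for a property `Φ` that is closed under moves; completeness promises only
single moves from states present at the start, which is all that a schedule needs. -/
theorem switchAll_spec (g : ℕ) (hg : g < 4) (σ : St) (h4 : σ.var 4 = σ.var 5 + 1)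
    (Φ : List ℕ → Prop) (h0 : ∀ τ, InRange σ τ → σ.mem 10 τ ≠ 0 → Φ τ)
    (hΦ : ∀ τ j, Φ τ → τ.getD g 0 < σ.var 5 → j < σ.var 1 → Usable σ g j → Φ (move τ g j)) :
    Same σ ((switchAll g).eval X σ) ∧
    (∀ τ, InRange σ τ → ((switchAll g).eval X σ).mem 10 τ ≠ 0 → Φ τ) ∧
    (∀ τ, σ.mem 10 τ ≠ 0 → ((switchAll g).eval X σ).mem 10 τ ≠ 0) ∧
    ∀ τ, InRange σ τ → σ.mem 10 τ ≠ 0 → τ.getD g 0 < σ.var 5 → ∀ j < σ.var 1, Usable σ g j →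
      ((switchAll g).eval X σ).mem 10 (move τ g j) ≠ 0 := by
  have hmodv : ∀ z, z ≠ 7 → z ≠ 8 → z ≠ 9 → z ≠ 28 → (seqs [load 8 10 stateVars, ite 8 (seqs
      [eq 8 (20 + g) 5, ite 8 skip (seqs [succ 28 (20 + g), const 9 1, loop 7 1 (switch g)])])
      skip]).modv z = false := by
    intro z h1 h2 h3 h4
    interval_cases g <;> simp [modv, seqs, switch, whenLine, h1, h2, h3, h4]
  have hmodm : ∀ k, k ≠ 10 → (seqs [load 8 10 stateVars, ite 8 (seqs
      [eq 8 (20 + g) 5, ite 8 skip (seqs [succ 28 (20 + g), const 9 1, loop 7 1 (switch g)])])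
      skip]).modm k = false := by
    intro k h1
    interval_cases g <;> simp [modm, seqs, switch, whenLine, h1]
  have := nest_inv (X := X) stateLoops (fun υ => Same σ υ ∧
      (∀ τ, InRange σ τ → υ.mem 10 τ ≠ 0 → Φ τ) ∧ ∀ τ, σ.mem 10 τ ≠ 0 → υ.mem 10 τ ≠ 0)
    (fun τ υ => σ.mem 10 τ ≠ 0 → τ.getD g 0 < σ.var 5 → ∀ j < σ.var 1, Usable σ g j →
      υ.mem 10 (move τ g j) ≠ 0) stateLoops_nodup stateLoops_ne
    (fun p hp => ⟨hmodv _ ?_ ?_ ?_ ?_, hmodv _ ?_ ?_ ?_ ?_⟩) ?_ ?_ ?_ σ ⟨.refl σ, h0, fun _ h => h⟩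
  · exact ⟨this.1.1, this.1.2.1, this.1.2.2, fun τ hτ => this.2.2 τ hτ⟩
  iterate 8 revert p; decide
  · intro υ v p hp h
    exact ⟨h.1.set (by revert p; decide) v, h.2⟩
  · exact fun τ υ v p _ h => h
  · rintro υ ⟨hs, hΦυ, hmono⟩ hlt
    have hr : InRange σ (stateVars.map υ.var) := (hs.inRange _).1 (inRange_map hlt)
    have hsame := hs.eval (X := X) _ (fun z hz => hmodv z (by rintro rfl; simp at hz)
      (by rintro rfl; simp at hz) (by rintro rfl; simp at hz) (by rintro rfl; simp at hz)) hmodm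
    have hc : υ.var (20 + g) < σ.var 4 := by
      rw [← hs.var 4 (by simp)]
      refine hlt (20 + g, 4) ?_
      interval_cases g <;> decide
    have key : ∀ τ, ((seqs [load 8 10 stateVars, ite 8 (seqs [eq 8 (20 + g) 5, ite 8 skip
        (seqs [succ 28 (20 + g), const 9 1, loop 7 1 (switch g)])]) skip]).eval X υ).mem 10 τ ≠ 0 ↔
        υ.mem 10 τ ≠ 0 ∨ υ.mem 10 (stateVars.map υ.var) ≠ 0 ∧ υ.var (20 + g) ≠ σ.var 5 ∧
          ∃ j < σ.var 1, Usable σ g j ∧ τ = move (stateVars.map υ.var) g j := by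
      intro τ
      have h8 : 20 + g ≠ 8 := by omega
      by_cases h1 : υ.mem 10 (stateVars.map υ.var) = 0
      · simp [seqs, eval, h1]
      by_cases h2 : υ.var (20 + g) = υ.var 5
      · rw [← hs.var 5 (by simp)]
        simp [seqs, eval, h1, h2, h8]
      set ω := ((((υ.set 8 (υ.mem 10 (stateVars.map υ.var))).set 8 0).set 28
        (υ.var (20 + g) + 1)).set 9 1) with hω
      have hsω : Same σ ω := (((hs.set (by simp) _).set (by simp) _).set (by simp) _).set (by simp) _
      have hmapω : stateVars.map ω.var = stateVars.map υ.var :=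
        map_stateVars_congr fun z h1 h2 => by
          simp only [hω, St.set_var]
          rw [if_neg (by omega), if_neg (by omega), if_neg (by omega), if_neg (by omega)]
      have := switchLoop_mem (X := X) g hg ω (by
        simp [hω, show 20 + g ≠ 28 by omega, show 20 + g ≠ 9 by omega,
          show 20 + g ≠ 8 by omega]) (by simp [hω]) τ
      rw [hmapω] at this
      simp only [hsω.usable, hsω.var 1 (by simp)] at this
      have he : (seqs [load 8 10 stateVars, ite 8 (seqs [eq 8 (20 + g) 5, ite 8 skip
        (seqs [succ 28 (20 + g), const 9 1, loop 7 1 (switch g)])]) skip]).eval X υ =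
          (loop 7 1 (switch g)).eval X ω := by
        simp [seqs, eval, h1, h2, h8, hω]
      rw [he, this]
      have h2' : υ.var (20 + g) ≠ σ.var 5 := by rwa [← hs.var 5 (by simp)]
      have h3 : ω.mem = υ.mem := rfl
      rw [h3]
      tauto
    refine ⟨⟨hsame, fun τ hτ h => ?_, fun τ h => (key τ).2 (.inl (hmono τ h))⟩, ?_, ?_⟩
    · rcases (key τ).1 h with h | ⟨h1, h2, j, hj, hu, rfl⟩
      · exact hΦυ τ hτ h
      · refine hΦ _ j (hΦυ _ hr h1) ?_ hj hu
        rw [getD_stateVars hg]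
        omega
    · intro h1 h2 j hj hu
      refine (key _).2 (.inr ⟨hmono _ h1, ?_, j, hj, hu, rfl⟩)
      rw [show (stateLoops.map fun p => υ.var p.1) = stateVars.map υ.var from rfl,
        getD_stateVars hg] at h2
      omega
    · intro τ h h1 h2 j hj hu
      exact (key _).2 (.inl (h h1 h2 j hj hu))

end Com

/-! ### The feasibility test: discarding states, initial state and outcome -/

namespace Com

variable {X : ℕ → ℝ}

/-- The rank pair `x`, `y` has a representative in the current cell. -/
def Needed (σ : St) (x y : ℕ) : Prop :=
  σ.mem 1 [x, y] ≠ 0 ∧ σ.mem 7 [σ.mem 2 [x, y]] = σ.var 13 ∧ σ.mem 8 [σ.mem 2 [x, y]] = σ.var 14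

/-- The representative of `x`, `y` is in a current square of the state `τ`. -/
def Hit (σ : St) (τ : List ℕ) (x y : ℕ) : Prop :=
  ∃ g < 4, σ.mem 0 [σ.mem 2 [x, y], τ.getD (4 + g) 0] ≠ 0

theorem Same.needed {σ υ : St} (h : Same σ υ) (x y : ℕ) : Needed υ x y ↔ Needed σ x y := by
  simp [Needed, h.var, h.mem]

theorem Same.hit {σ υ : St} (h : Same σ υ) (τ : List ℕ) (x y : ℕ) :
    Hit υ τ x y ↔ Hit σ τ x y := by
  simp [Hit, h.mem]

theorem hit_stateVars (σ υ : St) (x y : ℕ) : Hit σ (stateVars.map υ.var) x y ↔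
    σ.mem 0 [σ.mem 2 [x, y], υ.var 24] ≠ 0 ∨ σ.mem 0 [σ.mem 2 [x, y], υ.var 25] ≠ 0 ∨
    σ.mem 0 [σ.mem 2 [x, y], υ.var 26] ≠ 0 ∨ σ.mem 0 [σ.mem 2 [x, y], υ.var 27] ≠ 0 := by
  simp only [Hit, stateVars]
  constructor
  · rintro ⟨g, hg, h⟩
    interval_cases g <;> simp_all
  · rintro (h | h | h | h)
    exacts [⟨0, by omega, h⟩, ⟨1, by omega, h⟩, ⟨2, by omega, h⟩, ⟨3, by omega, h⟩]

theorem checkPoint_mem (σ : St) (τ : List ℕ) : (checkPoint.eval X σ).mem 10 τ ≠ 0 ↔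
    σ.mem 10 τ ≠ 0 ∧ (τ = stateVars.map σ.var → Needed σ (σ.var 18) (σ.var 19) →
      Hit σ τ (σ.var 18) (σ.var 19)) := by
  have e : (τ = stateVars.map σ.var → Needed σ (σ.var 18) (σ.var 19) →
      Hit σ τ (σ.var 18) (σ.var 19)) ↔ (τ = stateVars.map σ.var →
      Needed σ (σ.var 18) (σ.var 19) → Hit σ (stateVars.map σ.var) (σ.var 18) (σ.var 19)) :=
    forall_congr' fun h => by rw [h]
  rw [e, hit_stateVars]
  by_cases h1 : σ.mem 1 [σ.var 18, σ.var 19] = 0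
  · simp [checkPoint, seqs, eval, Needed, h1]
  by_cases h2 : σ.mem 7 [σ.mem 2 [σ.var 18, σ.var 19]] = σ.var 13
  swap
  · simp [checkPoint, seqs, eval, Needed, h1, h2]
  by_cases h3 : σ.mem 8 [σ.mem 2 [σ.var 18, σ.var 19]] = σ.var 14
  swap
  · simp [checkPoint, seqs, eval, Needed, h1, h2, h3]
  by_cases h4 : σ.mem 0 [σ.mem 2 [σ.var 18, σ.var 19], σ.var 24] = 0
  swap
  · simp [checkPoint, seqs, eval, Needed, h1, h2, h3, h4]
  by_cases h5 : σ.mem 0 [σ.mem 2 [σ.var 18, σ.var 19], σ.var 25] = 0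
  swap
  · simp [checkPoint, seqs, eval, Needed, h1, h2, h3, h4, h5]
  by_cases h6 : σ.mem 0 [σ.mem 2 [σ.var 18, σ.var 19], σ.var 26] = 0
  swap
  · simp [checkPoint, seqs, eval, Needed, h1, h2, h3, h4, h5, h6]
  by_cases h7 : σ.mem 0 [σ.mem 2 [σ.var 18, σ.var 19], σ.var 27] = 0
  swap
  · simp [checkPoint, seqs, eval, Needed, h1, h2, h3, h4, h5, h6, h7]
  by_cases hτ : τ = [σ.var 20, σ.var 21, σ.var 22, σ.var 23, σ.var 24, σ.var 25, σ.var 26,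
    σ.var 27] <;>
  simp [checkPoint, seqs, eval, Needed, h1, h2, h3, h4, h5, h6, h7, stateVars, hτ]

theorem checkLoop_mem (σ : St) (τ : List ℕ) :
    ((loop 19 3 checkPoint).eval X σ).mem 10 τ ≠ 0 ↔
    σ.mem 10 τ ≠ 0 ∧ (τ = stateVars.map σ.var → ∀ y < σ.var 3, Needed σ (σ.var 18) y →
      Hit σ τ (σ.var 18) y) := by
  revert τ
  refine loop_inv (fun i υ => ∀ τ, υ.mem 10 τ ≠ 0 ↔ σ.mem 10 τ ≠ 0 ∧
    (τ = stateVars.map σ.var → ∀ y < i, Needed σ (σ.var 18) y → Hit σ τ (σ.var 18) y))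
    (by simp) ?_
  intro i _ υ hυ ih τ
  have hs : Same σ (υ.set 19 i) := by
    refine ((Same.refl σ).trans ⟨fun z hz => hυ.var z ?_, fun k hk => hυ.mem k ?_⟩).set
      (by simp) _
    · revert z; decide
    · simp [modm, checkPoint, seqs, hk]
  have h18 : υ.var 18 = σ.var 18 := hυ.var _ (by decide)
  have hmap : stateVars.map (υ.set 19 i).var = stateVars.map σ.var :=
    map_stateVars_congr fun z h1 h2 => by
      rw [St.set_var, if_neg (by omega), hυ.var]
      simp [modv, checkPoint, seqs]
      omega
  rw [checkPoint_mem, hmap, St.set_mem, ih, hs.needed, hs.hit]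
  simp only [St.set_var, if_true, h18, Nat.reduceEqDiff, if_false]
  constructor
  · rintro ⟨⟨h1, h2⟩, h3⟩
    refine ⟨h1, fun hτ y hy hn => ?_⟩
    rcases Nat.lt_succ_iff_lt_or_eq.1 hy with hlt | rfl
    exacts [h2 hτ y hlt hn, h3 hτ hn]
  · rintro ⟨h1, h2⟩
    exact ⟨⟨h1, fun hτ y hy => h2 hτ y (by omega)⟩, fun hτ => h2 hτ i (by omega)⟩

/-- Unlike a switch, a check alters only the cell of the current state. States do not interfere, so
survival is characterised exactly. -/
theorem checkAll_spec (σ : St) : Same σ (checkAll.eval X σ) ∧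
    ∀ τ, InRange σ τ → ((checkAll.eval X σ).mem 10 τ ≠ 0 ↔
      σ.mem 10 τ ≠ 0 ∧ ∀ y < σ.var 3, Needed σ (σ.var 18) y → Hit σ τ (σ.var 18) y) := by
  have hmodv : ∀ z, z ≠ 6 → z ≠ 8 → z ≠ 9 → z ≠ 19 →
      (seqs [load 8 10 stateVars, ite 8 (loop 19 3 checkPoint) skip]).modv z = false := by
    intro z h1 h2 h3 h4
    simp [modv, seqs, checkPoint, h1, h2, h3, h4]
  have hmodm : ∀ k, k ≠ 10 →
      (seqs [load 8 10 stateVars, ite 8 (loop 19 3 checkPoint) skip]).modm k = false := by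
    intro k h1
    simp [modm, seqs, checkPoint, h1]
  have := nest_inv (X := X) stateLoops (fun υ => Same σ υ ∧ υ.var 18 = σ.var 18 ∧
      (∀ τ, υ.mem 10 τ ≠ 0 → σ.mem 10 τ ≠ 0) ∧ ∀ τ, σ.mem 10 τ ≠ 0 →
        (∀ y < σ.var 3, Needed σ (σ.var 18) y → Hit σ τ (σ.var 18) y) → υ.mem 10 τ ≠ 0)
    (fun τ υ => υ.mem 10 τ ≠ 0 → ∀ y < σ.var 3, Needed σ (σ.var 18) y → Hit σ τ (σ.var 18) y)
    stateLoops_nodup stateLoops_ne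
    (fun p hp => ⟨hmodv _ ?_ ?_ ?_ ?_, hmodv _ ?_ ?_ ?_ ?_⟩) ?_ ?_ ?_ σ
    ⟨.refl σ, rfl, fun _ h => h, fun _ h _ => h⟩
  · exact ⟨this.1.1, fun τ hτ => ⟨fun h => ⟨this.1.2.2.1 τ h, this.2.2 τ hτ h⟩,
      fun h => this.1.2.2.2 τ h.1 h.2⟩⟩
  iterate 8 revert p; decide
  · intro υ v p hp h
    refine ⟨h.1.set (by revert p; decide) v, ?_, h.2.2⟩
    rw [St.set_var, if_neg (by revert p; decide), h.2.1]
  · exact fun τ υ v p _ h => h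
  · rintro υ ⟨hs, h18, hmono, hok⟩ hlt
    have hsame := hs.eval (X := X) _ (fun z hz => hmodv z (by rintro rfl; simp at hz)
      (by rintro rfl; simp at hz) (by rintro rfl; simp at hz) (by rintro rfl; simp at hz)) hmodm
    have key : ∀ τ, ((seqs [load 8 10 stateVars, ite 8 (loop 19 3 checkPoint) skip]).eval X υ).mem
        10 τ ≠ 0 ↔ υ.mem 10 τ ≠ 0 ∧ (τ = stateVars.map υ.var → ∀ y < σ.var 3,
          Needed σ (σ.var 18) y → Hit σ τ (σ.var 18) y) := by
      intro τ
      by_cases h1 : υ.mem 10 (stateVars.map υ.var) = 0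
      · simp [seqs, eval, h1]
        rintro h rfl
        exact (h h1).elim
      have hs' := hs.set (x := 8) (by simp) (υ.mem 10 (stateVars.map υ.var))
      have := checkLoop_mem (X := X) (υ.set 8 (υ.mem 10 (stateVars.map υ.var))) τ
      rw [map_stateVars_congr (σ := υ) (υ := υ.set 8 _) fun z h1 h2 => by
        rw [St.set_var, if_neg (by omega)]] at this
      simp only [hs'.needed, hs'.hit, hs'.var 3 (by simp)] at this
      simp only [St.set_var, Nat.reduceEqDiff, if_false, h18, St.set_mem] at this
      rw [← this]
      simp [seqs, eval, h1]
    have h18' : ((seqs [load 8 10 stateVars, ite 8 (loop 19 3 checkPoint) skip]).eval X υ).var 18 =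
        υ.var 18 := (frame X _ υ).var 18 (hmodv 18 (by simp) (by simp) (by simp) (by simp))
    refine ⟨⟨hsame, h18'.trans h18, fun τ h => hmono τ ((key τ).1 h).1, fun τ h h' =>
      (key τ).2 ⟨hok τ h h', fun _ => h'⟩⟩, fun h => ((key _).1 h).2 rfl, fun τ h h' =>
      h ((key τ).1 h').1⟩

theorem findState_spec (σ : St) : (findState.eval X σ).var 17 ≠ 0 ↔
    ∃ τ, InRange σ τ ∧ σ.mem 10 τ ≠ 0 := by
  have := nest_inv (X := X) (a := seqs [load 8 10 stateVars, ite 8 (const 17 1) skip]) stateLoops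
    (fun υ => Same σ υ ∧ υ.mem 10 = σ.mem 10 ∧
      (υ.var 17 ≠ 0 → ∃ τ, InRange σ τ ∧ σ.mem 10 τ ≠ 0))
    (fun τ υ => σ.mem 10 τ ≠ 0 → υ.var 17 ≠ 0) stateLoops_nodup stateLoops_ne
    (by decide) ?_ ?_ ?_ (σ.set 17 0) ⟨(Same.refl σ).set (by simp) _, rfl, by simp⟩
  · refine ⟨this.1.2.2, fun ⟨τ, h1, h2⟩ => this.2.2 τ ?_ h2⟩
    exact (((Same.refl σ).set (by simp) 0).inRange τ).2 h1
  · intro υ v p hp h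
    refine ⟨h.1.set (by revert p; decide) v, h.2.1, ?_⟩
    rw [St.set_var, if_neg (by revert p; decide)]
    exact h.2.2
  · intro τ υ v p hp h
    rwa [St.set_var, if_neg (by revert p; decide)]
  · rintro υ ⟨hs, hm, hf⟩ hlt
    have hr : InRange σ (stateVars.map υ.var) := (hs.inRange _).1 (inRange_map hlt)
    refine ⟨⟨hs.eval _ (by decide) fun k hk => rfl, ?_, ?_⟩, ?_, fun τ h h' => ?_⟩
    · exact ((frame X _ υ).mem 10 rfl).trans hm
    · by_cases h1 : υ.mem 10 (stateVars.map υ.var) = 0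
      · simpa [seqs, eval, h1] using hf
      · exact fun _ => ⟨_, hr, by rwa [← hm]⟩
    · rw [show (stateLoops.map fun p => υ.var p.1) = stateVars.map υ.var from rfl, ← hm]
      intro h1
      simp [seqs, eval, h1]
    · by_cases h1 : υ.mem 10 (stateVars.map υ.var) = 0
      · simpa [seqs, eval, h1] using h h'
      · simp [seqs, eval, h1]

/-- Array 10 is cleared over the whole range because an earlier test may have left states in it. -/
theorem initStates_spec (σ : St) : Same σ (initStates.eval X σ) ∧
    ∀ τ, InRange σ τ → ((initStates.eval X σ).mem 10 τ ≠ 0 ↔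
      τ = [0, 0, 0, 0, σ.var 1, σ.var 1, σ.var 1, σ.var 1]) := by
  have := nest_inv (X := X) (a := store 10 stateVars 9) stateLoops
    (fun υ => Same σ υ ∧ υ.var 9 = 0) (fun τ υ => υ.mem 10 τ = 0) stateLoops_nodup stateLoops_ne
    (by decide) ?_ ?_ ?_ (σ.set 9 0) ⟨(Same.refl σ).set (by simp) _, by simp⟩
  · obtain ⟨⟨hs, h9⟩, -, hz⟩ := this
    refine ⟨(Same.refl σ).eval _ (by decide) fun k hk => ?_, fun τ hτ => ?_⟩
    · simp [modm, initStates, seqs, nest, stateLoops, hk]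
    · have hz' := hz τ ((((Same.refl σ).set (by simp) 0).inRange τ).2 hτ)
      have h1 := hs.var 1 (by simp)
      generalize hυ : (nest stateLoops (store 10 stateVars 9)).eval X (σ.set 9 0) = υ at *
      simp only [initStates, seqs, eval, hυ]
      simp [stateVars, hz', h1]
  · intro υ v p hp h
    refine ⟨h.1.set (by revert p; decide) v, ?_⟩
    rw [St.set_var, if_neg (by revert p; decide), h.2]
  · exact fun τ υ v p _ h => h
  · rintro υ ⟨hs, h9⟩ hlt
    refine ⟨⟨hs.eval _ (by decide) fun k hk => by simp [modm, hk], h9⟩, ?_, fun τ h => ?_⟩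
    · simp [eval, stateLoops, stateVars, h9]
    · simp [eval, h9, h]

end Com

/-! ### Soundness and completeness of the dynamic program -/

namespace Com

variable {X : ℕ → ℝ}

/-- Families of sets of squares in use, one for each corner group of the current cell. -/
def Admissible (σ : St) (S : ℕ → Finset ℕ) : Prop :=
  ∀ g < 4, ∀ s ∈ S g, s < σ.var 1 ∧ Usable σ g s

/-- The family covers the representatives in the current cell and the columns before `x`. -/
def CoversBefore (σ : St) (x : ℕ) (S : ℕ → Finset ℕ) : Prop :=
  ∀ x' < x, ∀ y < σ.var 3, Needed σ x' y → ∃ g < 4, ∃ s ∈ S g, σ.mem 0 [σ.mem 2 [x', y], s] ≠ 0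

/-- What reachability of the state `τ` before column `x` witnesses. -/
def Witness (σ : St) (x : ℕ) (τ : List ℕ) : Prop :=
  τ.length = 8 ∧ ∃ S : ℕ → Finset ℕ, Admissible σ S ∧ CoversBefore σ x S ∧
    ∀ g < 4, (S g).card ≤ τ.getD g 0 ∧ (τ.getD (4 + g) 0 = σ.var 1 ∨ τ.getD (4 + g) 0 ∈ S g)

theorem getD_move {τ : List ℕ} (hτ : τ.length = 8) {g : ℕ} (hg : g < 4) (j h : ℕ) :
    (move τ g j).getD h 0 =
      if h = 4 + g then j else if h = g then τ.getD g 0 + 1 else τ.getD h 0 := by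
  simp only [move, List.getD_eq_getElem?_getD, List.getElem?_set, List.length_set, hτ]
  by_cases h1 : h = 4 + g
  · simp [h1, show 4 + g < 8 by omega]
  by_cases h2 : h = g
  · simp [h2, show g < 8 by omega]
  simp [h1, h2, Ne.symm h1, Ne.symm h2]

/-- The witness family gains the new current square, so the set of the group grows by at most one,
as does the counter. Covered columns stay covered, since the family keeps the squares that the state
forgets. -/
theorem Witness.move {σ : St} {x : ℕ} {τ : List ℕ} (h : Witness σ x τ) {g j : ℕ} (hg : g < 4)
    (hj : j < σ.var 1) (hu : Usable σ g j) : Witness σ x (move τ g j) := by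
  obtain ⟨hl, S, hS, hc, hτ⟩ := h
  refine ⟨by simp [Com.move, hl], Function.update S g (insert j (S g)), ?_, ?_, ?_⟩
  · intro g' hg' s hs
    by_cases hgg : g' = g
    · subst hgg
      rw [Function.update_self, Finset.mem_insert] at hs
      rcases hs with rfl | hs
      exacts [⟨hj, hu⟩, hS _ hg' _ hs]
    · rw [Function.update_of_ne hgg] at hs
      exact hS _ hg' _ hs
  · intro x' hx' y hy hn
    obtain ⟨g', hg', s, hs, hi⟩ := hc x' hx' y hy hn
    refine ⟨g', hg', s, ?_, hi⟩
    by_cases hgg : g' = g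
    · subst hgg
      simp [hs]
    · rwa [Function.update_of_ne hgg]
  · intro g' hg'
    obtain ⟨h1, h2⟩ := hτ g' hg'
    rw [getD_move hl hg, getD_move hl hg]
    by_cases hgg : g' = g
    · subst hgg
      simp only [Function.update_self, if_true, Finset.mem_insert, true_or, or_true, and_true]
      rw [if_neg (by omega)]
      exact (Finset.card_insert_le _ _).trans (by omega)
    · rw [Function.update_of_ne hgg, if_neg (by omega), if_neg hgg, if_neg (by omega),
        if_neg (by omega)]
      exact ⟨h1, h2⟩

theorem Same.witness {σ υ : St} (h : Same σ υ) (x : ℕ) (τ : List ℕ) :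
    Witness υ x τ ↔ Witness σ x τ := by
  simp only [Witness, Admissible, CoversBefore, h.usable, h.needed, h.var 1 (by simp),
    h.var 3 (by simp), h.mem 0 (by simp), h.mem 2 (by simp)]

theorem inRange_iff {σ : St} {τ : List ℕ} : InRange σ τ ↔ τ.length = 8 ∧
    ∀ g < 4, τ.getD g 0 < σ.var 4 ∧ τ.getD (4 + g) 0 < σ.var 2 := by
  constructor
  · intro h
    have hl : τ.length = 8 := h.length_eq
    refine ⟨hl, ?_⟩
    match τ, hl with
    | [a, b, c, d, e, f, g, i], _ =>
      simp [InRange, stateLoops] at h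
      intro g hg
      interval_cases g <;> simp [h]
  · rintro ⟨hl, h⟩
    match τ, hl with
    | [a, b, c, d, e, f, g, i], _ =>
      have h0 := h 0 (by omega)
      have h1 := h 1 (by omega)
      have h2 := h 2 (by omega)
      have h3 := h 3 (by omega)
      simp at h0 h1 h2 h3
      simp [InRange, stateLoops, h0, h1, h2, h3]

/-- The representatives in the current cell can be covered with at most as many squares of each
group as variable 5 says. -/
def Feasible (σ : St) : Prop :=
  ∃ S : ℕ → Finset ℕ, Admissible σ S ∧ CoversBefore σ (σ.var 3) S ∧ ∀ g < 4, (S g).card ≤ σ.var 5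

/-- In a surviving state, the representatives of the column are covered by current squares. The
dummy number `m` covers nothing by `h0`, so a covering current square belongs to the witness family.
-/
theorem column_sound {σ : St} (h4 : σ.var 4 = σ.var 5 + 1) (h0 : ∀ i, σ.mem 0 [i, σ.var 1] = 0)
    (hW : ∀ τ, InRange σ τ → σ.mem 10 τ ≠ 0 → Witness σ (σ.var 18) τ) :
    Same σ (column.eval X σ) ∧ ∀ τ, InRange σ τ → (column.eval X σ).mem 10 τ ≠ 0 →
      Witness σ (σ.var 18 + 1) τ := by
  have step : ∀ {υ : St} (g : ℕ), g < 4 → Same σ υ →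
      (∀ τ, InRange σ τ → υ.mem 10 τ ≠ 0 → Witness σ (σ.var 18) τ) →
      Same σ ((switchAll g).eval X υ) ∧ ∀ τ, InRange σ τ →
        ((switchAll g).eval X υ).mem 10 τ ≠ 0 → Witness σ (σ.var 18) τ := by
    intro υ g hg hs hυ
    have := switchAll_spec (X := X) g hg υ (by rw [hs.var 4 (by simp), hs.var 5 (by simp), h4])
      (fun τ => Witness σ (σ.var 18) τ) (fun τ hτ => hυ τ ((hs.inRange τ).1 hτ))
      (fun τ j hτ _ hj hu => hτ.move hg (by rwa [← hs.var 1 (by simp)]) ((hs.usable g j).1 hu))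
    exact ⟨hs.trans this.1, fun τ hτ => this.2.1 τ ((hs.inRange τ).2 hτ)⟩
  obtain ⟨s0, w0⟩ := step 0 (by omega) (.refl σ) hW
  obtain ⟨s1, w1⟩ := step 1 (by omega) s0 w0
  obtain ⟨s2, w2⟩ := step 2 (by omega) s1 w1
  obtain ⟨s3, w3⟩ := step 3 (by omega) s2 w2
  have v18 : ((switchAll 3).eval X ((switchAll 2).eval X ((switchAll 1).eval X
      ((switchAll 0).eval X σ)))).var 18 = σ.var 18 := by
    rw [(frame X _ _).var 18 (by decide), (frame X _ _).var 18 (by decide),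
      (frame X _ _).var 18 (by decide), (frame X _ _).var 18 (by decide)]
  obtain ⟨s4, w4⟩ := checkAll_spec (X := X) ((switchAll 3).eval X ((switchAll 2).eval X
    ((switchAll 1).eval X ((switchAll 0).eval X σ))))
  refine ⟨s3.trans s4, fun τ hτ hne => ?_⟩
  obtain ⟨h1, h2⟩ := (w4 τ ((s3.inRange τ).2 hτ)).1 hne
  obtain ⟨hl, S, hS, hc, hg⟩ := w3 τ hτ h1
  rw [v18, s3.var 3 (by simp)] at h2
  refine ⟨hl, S, hS, fun x' hx' y hy hn => ?_, hg⟩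
  rcases Nat.lt_succ_iff_lt_or_eq.1 hx' with hlt | rfl
  · exact hc x' hlt y hy hn
  · obtain ⟨g, hg', hi⟩ := (s3.hit τ _ y).1 (h2 y hy ((s3.needed _ y).2 hn))
    refine ⟨g, hg', _, (hg g hg').2.resolve_left fun h => hi ?_, hi⟩
    rw [h, h0]

theorem feasible_sound {σ : St} (h4 : σ.var 4 = σ.var 5 + 1) (h0 : ∀ i, σ.mem 0 [i, σ.var 1] = 0)
    (h : (feasible.eval X σ).var 17 ≠ 0) : Feasible σ := by
  obtain ⟨s0, w0⟩ := initStates_spec (X := X) σ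
  have hloop := loop_inv (X := X) (a := column) (x := 18) (y := 3) (σ := initStates.eval X σ)
    (fun x υ => Same σ υ ∧ ∀ τ, InRange σ τ → υ.mem 10 τ ≠ 0 → Witness σ x τ) ⟨s0, ?_⟩ ?_
  · obtain ⟨s1, w1⟩ := hloop
    obtain ⟨τ, hτ, hne⟩ := (findState_spec (X := X) _).1 h
    have hτ' := (s1.inRange τ).1 hτ
    obtain ⟨-, S, hS, hc, hg⟩ := w1 τ hτ' hne
    rw [s0.var 3 (by simp)] at hc
    refine ⟨S, hS, hc, fun g hg' => ?_⟩
    have h1 := (hg g hg').1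
    have h2 := ((inRange_iff.1 hτ').2 g hg').1
    omega
  · intro τ hτ hne
    rw [w0 τ hτ] at hne
    subst hne
    refine ⟨rfl, fun _ => ∅, by simp [Admissible], by simp [CoversBefore], fun g hg => ?_⟩
    interval_cases g <;> simp
  · rintro x - υ - ⟨hs, hw⟩
    have hs' : Same σ (υ.set 18 x) := hs.set (by simp) x
    have := column_sound (X := X) (σ := υ.set 18 x)
      (by rw [hs'.var 4 (by simp), hs'.var 5 (by simp), h4])
      (by rw [hs'.mem 0 (by simp), hs'.var 1 (by simp)]; exact h0)
      (fun τ hτ hne => by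
        rw [hs'.witness]
        simpa using hw τ ((hs'.inRange τ).1 hτ) hne)
    refine ⟨hs'.trans this.1, fun τ hτ hne => ?_⟩
    have := this.2 τ ((hs'.inRange τ).2 hτ) hne
    rw [hs'.witness] at this
    simpa using this

/-- A schedule of current squares for the four groups, with counters: before column `x`, the current
square of group `g` is `cur g x` and `cnt g x` squares of the group have been used. -/
structure Schedule (σ : St) (cur cnt : ℕ → ℕ → ℕ) : Prop where
  cur_zero : ∀ g < 4, cur g 0 = σ.var 1
  cnt_zero : ∀ g < 4, cnt g 0 = 0
  step : ∀ g < 4, ∀ x, cur g (x + 1) = cur g x ∧ cnt g (x + 1) = cnt g x ∨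
    cnt g (x + 1) = cnt g x + 1 ∧ cur g (x + 1) < σ.var 1 ∧ Usable σ g (cur g (x + 1))
  cnt_le : ∀ g < 4, ∀ x, cnt g x ≤ σ.var 5
  covers : ∀ x < σ.var 3, ∀ y < σ.var 3, Needed σ x y →
    ∃ g < 4, σ.mem 0 [σ.mem 2 [x, y], cur g (x + 1)] ≠ 0

/-- The state in which the first `h` groups have been switched for column `x`. -/
def mixed (cur cnt : ℕ → ℕ → ℕ) (x h : ℕ) : List ℕ :=
  [cnt 0 (if 0 < h then x + 1 else x), cnt 1 (if 1 < h then x + 1 else x),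
    cnt 2 (if 2 < h then x + 1 else x), cnt 3 (if 3 < h then x + 1 else x),
    cur 0 (if 0 < h then x + 1 else x), cur 1 (if 1 < h then x + 1 else x),
    cur 2 (if 2 < h then x + 1 else x), cur 3 (if 3 < h then x + 1 else x)]

theorem Schedule.cur_le {σ : St} {cur cnt : ℕ → ℕ → ℕ} (h : Schedule σ cur cnt) {g : ℕ}
    (hg : g < 4) (x : ℕ) : cur g x ≤ σ.var 1 := by
  induction x with
  | zero => exact (h.cur_zero g hg).le
  | succ x ih =>
    rcases h.step g hg x with ⟨h1, -⟩ | ⟨-, h1, -⟩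
    exacts [h1.trans_le ih, h1.le]

theorem Schedule.inRange_mixed {σ : St} {cur cnt : ℕ → ℕ → ℕ} (hC : Schedule σ cur cnt)
    (h2 : σ.var 2 = σ.var 1 + 1) (h4 : σ.var 4 = σ.var 5 + 1) (x h : ℕ) :
    InRange σ (mixed cur cnt x h) := by
  have a : ∀ g < 4, ∀ x, cnt g x < σ.var 5 + 1 := fun g hg x => Nat.lt_succ_of_le (hC.cnt_le g hg x)
  have b : ∀ g < 4, ∀ x, cur g x < σ.var 1 + 1 := fun g hg x => Nat.lt_succ_of_le (hC.cur_le hg x)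
  simp [InRange, stateLoops, mixed, h2, h4, a, b]

theorem mixed_succ {cur cnt : ℕ → ℕ → ℕ} {x g : ℕ} (hg : g < 4)
    (h : cnt g (x + 1) = cnt g x + 1) :
    mixed cur cnt x (g + 1) = move (mixed cur cnt x g) g (cur g (x + 1)) := by
  interval_cases g <;> simp [mixed, move, h]

theorem mixed_succ_of_eq {cur cnt : ℕ → ℕ → ℕ} {x g : ℕ} (hg : g < 4)
    (h : cur g (x + 1) = cur g x) (h' : cnt g (x + 1) = cnt g x) :
    mixed cur cnt x (g + 1) = mixed cur cnt x g := by
  interval_cases g <;> simp [mixed, h, h']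

theorem column_complete {σ : St} {cur cnt : ℕ → ℕ → ℕ} (h2 : σ.var 2 = σ.var 1 + 1)
    (h4 : σ.var 4 = σ.var 5 + 1) (hC : Schedule σ cur cnt) (h18 : σ.var 18 < σ.var 3)
    (hne : σ.mem 10 (mixed cur cnt (σ.var 18) 0) ≠ 0) :
    Same σ (column.eval X σ) ∧ (column.eval X σ).mem 10 (mixed cur cnt (σ.var 18 + 1) 0) ≠ 0 := by
  have step : ∀ {υ : St} (g : ℕ), g < 4 → Same σ υ →
      υ.mem 10 (mixed cur cnt (σ.var 18) g) ≠ 0 → Same σ ((switchAll g).eval X υ) ∧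
      ((switchAll g).eval X υ).mem 10 (mixed cur cnt (σ.var 18) (g + 1)) ≠ 0 := by
    intro υ g hg hs hυ
    have := switchAll_spec (X := X) g hg υ (by rw [hs.var 4 (by simp), hs.var 5 (by simp), h4])
      (fun _ => True) (fun _ _ _ => trivial) (fun _ _ _ _ _ _ => trivial)
    refine ⟨hs.trans this.1, ?_⟩
    rcases hC.step g hg (σ.var 18) with ⟨e1, e2⟩ | ⟨e1, e2, e3⟩
    · rw [mixed_succ_of_eq hg e1 e2]
      exact this.2.2.1 _ hυ
    · rw [mixed_succ hg e1]
      refine this.2.2.2 _ ((hs.inRange _).2 (hC.inRange_mixed h2 h4 _ _)) hυ ?_ _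
        (by rwa [hs.var 1 (by simp)]) ((hs.usable _ _).2 e3)
      -- The counter after the move is within the bound, so the counter before it is strictly below
      -- the bound and the switch is permitted.
      have e4 := hC.cnt_le g hg (σ.var 18 + 1)
      rw [hs.var 5 (by simp)]
      have e5 : (mixed cur cnt (σ.var 18) g).getD g 0 = cnt g (σ.var 18) := by
        interval_cases g <;> rfl
      omega
  obtain ⟨s0, w0⟩ := step 0 (by omega) (.refl σ) hne
  obtain ⟨s1, w1⟩ := step 1 (by omega) s0 w0
  obtain ⟨s2, w2⟩ := step 2 (by omega) s1 w1
  obtain ⟨s3, w3⟩ := step 3 (by omega) s2 w2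
  have v18 : ((switchAll 3).eval X ((switchAll 2).eval X ((switchAll 1).eval X
      ((switchAll 0).eval X σ)))).var 18 = σ.var 18 := by
    rw [(frame X _ _).var 18 (by decide), (frame X _ _).var 18 (by decide),
      (frame X _ _).var 18 (by decide), (frame X _ _).var 18 (by decide)]
  obtain ⟨s4, w4⟩ := checkAll_spec (X := X) ((switchAll 3).eval X ((switchAll 2).eval X
    ((switchAll 1).eval X ((switchAll 0).eval X σ))))
  refine ⟨s3.trans s4, ?_⟩
  have hr := hC.inRange_mixed h2 h4 (σ.var 18) 4
  refine (w4 _ ((s3.inRange _).2 hr)).2 ⟨w3, fun y hy hn => ?_⟩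
  rw [v18] at hn ⊢
  rw [s3.var 3 (by simp)] at hy
  rw [s3.needed] at hn
  rw [s3.hit]
  obtain ⟨g, hg, hi⟩ := hC.covers _ h18 y hy hn
  refine ⟨g, hg, ?_⟩
  have : (mixed cur cnt (σ.var 18) 4).getD (4 + g) 0 = cur g (σ.var 18 + 1) := by
    interval_cases g <;> rfl
  rwa [this]

theorem feasible_complete {σ : St} {cur cnt : ℕ → ℕ → ℕ} (h2 : σ.var 2 = σ.var 1 + 1)
    (h4 : σ.var 4 = σ.var 5 + 1) (hC : Schedule σ cur cnt) :
    (feasible.eval X σ).var 17 ≠ 0 := by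
  obtain ⟨s0, w0⟩ := initStates_spec (X := X) σ
  have hloop := loop_inv (X := X) (a := column) (x := 18) (y := 3) (σ := initStates.eval X σ)
    (fun x υ => Same σ υ ∧ υ.mem 10 (mixed cur cnt x 0) ≠ 0) ⟨s0, ?_⟩ ?_
  · exact (findState_spec (X := X) _).2
      ⟨_, (hloop.1.inRange _).2 (hC.inRange_mixed h2 h4 _ _), hloop.2⟩
  · rw [w0 _ (hC.inRange_mixed h2 h4 _ _)]
    simp [mixed, hC.cur_zero, hC.cnt_zero]
  · rintro x hx υ - ⟨hs, hw⟩
    have hs' : Same σ (υ.set 18 x) := hs.set (by simp) x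
    have hC' : Schedule (υ.set 18 x) cur cnt := by
      obtain ⟨a, b, c, d, e⟩ := hC
      constructor <;> simpa only [hs'.var 1 (by simp), hs'.var 5 (by simp), hs'.var 3 (by simp),
        hs'.usable, hs'.needed, hs'.mem 0 (by simp), hs'.mem 2 (by simp)]
    have := column_complete (X := X) (σ := υ.set 18 x)
      (by rw [hs'.var 2 (by simp), hs'.var 1 (by simp), h2])
      (by rw [hs'.var 4 (by simp), hs'.var 5 (by simp), h4]) hC'
      (by rw [hs'.var 3 (by simp), ← s0.var 3 (by simp)]; simpa using hx) (by simpa using hw)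
    exact ⟨hs'.trans this.1, by simpa using this.2⟩

end Com

/-! ### Schedules -/

/-- Dependent choice along an invariant. The step function is made total by repeating the value
where the invariant fails. -/
theorem exists_seq {α : Type*} (I : ℕ → α → Prop) (R : ℕ → α → α → Prop) (a : α) (h0 : I 0 a)
    (h : ∀ x p, I x p → ∃ q, I (x + 1) q ∧ R x p q) :
    ∃ f : ℕ → α, f 0 = a ∧ (∀ x, I x (f x)) ∧ ∀ x, R x (f x) (f (x + 1)) := by
  have h' : ∀ x p, ∃ q, I x p → I (x + 1) q ∧ R x p q := by
    intro x p
    by_cases hp : I x p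
    · obtain ⟨q, hq⟩ := h x p hp
      exact ⟨q, fun _ => hq⟩
    · exact ⟨p, fun hp' => (hp hp').elim⟩
  choose F hF using h'
  have hI : ∀ x, I x (Nat.rec a F x) := by
    intro x
    induction x with
    | zero => exact h0
    | succ x ih => exact (hF x _ ih).1
  exact ⟨fun x => Nat.rec a F x, rfl, hI, fun x => (hF x _ (hI x)).2⟩

/-- A current element with a counter of the changes: the element is best among the candidates. -/
def Tracks (C : ℕ → Finset ℕ) (key : ℕ → ℝ) (S : Finset ℕ) (m : ℕ) (cur cnt : ℕ → ℕ) : Prop :=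
  cur 0 = m ∧ cnt 0 = 0 ∧ (∀ x, cnt x ≤ S.card) ∧
    (∀ x, cur (x + 1) = cur x ∧ cnt (x + 1) = cnt x ∨
      cnt (x + 1) = cnt x + 1 ∧ cur (x + 1) ∈ S) ∧
    ∀ x, ∀ s ∈ C x, cur (x + 1) ∈ C x ∧ key s ≤ key (cur (x + 1))

/-- The current candidate is kept as long as it remains one; being best, it stays best while
candidates drop out. When it is lost it never returns, so the number of changes plus the number of
other remaining candidates never exceeds the size of `S`. The condition on `m` makes the initial
dummy no candidate. -/
theorem exists_tracks_antitone {C : ℕ → Finset ℕ} (hC : Antitone C) (key : ℕ → ℝ) {S : Finset ℕ}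
    (hS : ∀ x, C x ⊆ S) {m : ℕ} (hm : m ∉ S) : ∃ cur cnt, Tracks C key S m cur cnt := by
  have hseq := exists_seq (α := ℕ × ℕ)
    (fun x p => p.2 + (C x \ {p.1}).card ≤ S.card ∧
      (p.1 ∈ C x → ∀ s ∈ C x, key s ≤ key p.1))
    (fun x p q => (q.1 = p.1 ∧ q.2 = p.2 ∨ q.2 = p.2 + 1 ∧ q.1 ∈ S) ∧
      ∀ s ∈ C x, q.1 ∈ C x ∧ key s ≤ key q.1) (m, 0)
    ⟨by simpa using Finset.card_le_card (Finset.sdiff_subset.trans (hS 0)),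
      fun h => (hm (hS 0 h)).elim⟩ ?_
  · obtain ⟨f, h0, hI, hR⟩ := hseq
    exact ⟨fun x => (f x).1, fun x => (f x).2, by simp [h0], by simp [h0],
      fun x => (Nat.le_add_right _ _).trans (hI x).1, fun x => (hR x).1, fun x => (hR x).2⟩
  · rintro x ⟨c, k⟩ ⟨h1, h2⟩
    have hsub : C (x + 1) ⊆ C x := hC (Nat.le_succ x)
    by_cases hc : c ∈ C x
    · refine ⟨(c, k), ⟨?_, fun _ s hs => h2 hc s (hsub hs)⟩, .inl ⟨rfl, rfl⟩,
        fun s hs => ⟨hc, h2 hc s hs⟩⟩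
      exact (Nat.add_le_add_left (Finset.card_le_card (Finset.sdiff_subset_sdiff hsub le_rfl)) _).trans
        h1
    rcases (C x).eq_empty_or_nonempty with he | hne
    · refine ⟨(c, k), ⟨?_, fun h => (hc (hsub h)).elim⟩, .inl ⟨rfl, rfl⟩, by simp [he]⟩
      exact (Nat.add_le_add_left (Finset.card_le_card (Finset.sdiff_subset_sdiff hsub le_rfl)) _).trans
        h1
    · obtain ⟨c', hc', hmax⟩ := (C x).exists_max_image key hne
      refine ⟨(c', k + 1), ⟨?_, fun _ s hs => hmax s (hsub hs)⟩, .inr ⟨rfl, hS x hc'⟩,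
        fun s hs => ⟨hc', hmax s hs⟩⟩
      simp only [Finset.sdiff_singleton_eq_erase, Finset.erase_eq_of_notMem hc] at h1 ⊢
      have := Finset.card_le_card (Finset.erase_subset_erase c' hsub)
      have := Finset.card_erase_add_one hc'
      omega

/-- The current candidate is replaced only when it is no longer best, and then by a best one. The
replacement cannot be an old candidate, because the previous square was best among those; so each
change is paid for by a newly entered candidate. -/
theorem exists_tracks_monotone {C : ℕ → Finset ℕ} (hC : Monotone C) (key : ℕ → ℝ) {S : Finset ℕ}
    (hS : ∀ x, C x ⊆ S) {m : ℕ} : ∃ cur cnt, Tracks C key S m cur cnt := by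
  -- The candidates one column earlier, none before the first column.
  let E : ℕ → Finset ℕ := fun x => Nat.casesOn x ∅ C
  have hE : ∀ x, E x ⊆ C x := by
    intro x
    cases x with
    | zero => exact Finset.empty_subset _
    | succ x => exact hC (Nat.le_succ x)
  have hseq := exists_seq (α := ℕ × ℕ)
    (fun x p => p.2 ≤ (E x).card ∧ ∀ s ∈ E x, p.1 ∈ E x ∧ key s ≤ key p.1)
    (fun x p q => q.1 = p.1 ∧ q.2 = p.2 ∨ q.2 = p.2 + 1 ∧ q.1 ∈ S) (m, 0)
    ⟨Nat.zero_le _, by simp [E]⟩ ?_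
  · obtain ⟨f, h0, hI, hR⟩ := hseq
    exact ⟨fun x => (f x).1, fun x => (f x).2, by simp [h0], by simp [h0],
      fun x => (hI x).1.trans (Finset.card_le_card ((hE x).trans (hS x))), fun x => hR x,
      fun x => (hI (x + 1)).2⟩
  · rintro x ⟨c, k⟩ ⟨h1, h2⟩
    by_cases hc : ∀ s ∈ C x, c ∈ C x ∧ key s ≤ key c
    · exact ⟨(c, k), ⟨h1.trans (Finset.card_le_card (hE x)), hc⟩, .inl ⟨rfl, rfl⟩⟩
    · push Not at hc
      obtain ⟨s, hs, hlt⟩ := hc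
      obtain ⟨c', hc', hmax⟩ := (C x).exists_max_image key ⟨s, hs⟩
      refine ⟨(c', k + 1), ⟨?_, fun s hs => ⟨hc', hmax s hs⟩⟩, .inr ⟨rfl, hS x hc'⟩⟩
      have : c' ∉ E x := fun h => by
        have h3 := h2 c' h
        exact absurd (hmax s hs) (not_le.2 (h3.2.trans_lt (hlt (hE x h3.1))))
      have h4 : insert c' (E x) ⊆ C x := Finset.insert_subset hc' (hE x)
      have h5 := Finset.card_le_card h4
      rw [Finset.card_insert_of_notMem this] at h5
      exact (Nat.succ_le_succ h1).trans h5

/-! ### The data of an instance -/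

/-- Coordinate `d` of point `i`. -/
def ptc (X : ℕ → ℝ) (d i : ℕ) : ℝ := X (2 * i + d)

/-- Coordinate `d` of the lower left corner of square `j`, in an instance with `n` points. -/
def sqc (X : ℕ → ℝ) (n d j : ℕ) : ℝ := X (2 * (j + n) + d)

/-- Point `i` lies in square `j`. -/
def Inside (X : ℕ → ℝ) (n i j : ℕ) : Prop :=
  ∀ d < 2, sqc X n d j ≤ ptc X d i ∧ ptc X d i ≤ sqc X n d j + 1

open Classical in
/-- The rank of `z` among coordinates `d` of the sides of `m` squares. -/
noncomputable def rank (X : ℕ → ℝ) (n m d : ℕ) (z : ℝ) : ℕ :=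
  ((Finset.range m).filter fun j => sqc X n d j ≤ z).card +
    ((Finset.range m).filter fun j => sqc X n d j + 1 < z).card

theorem rank_mono (X : ℕ → ℝ) (n m d : ℕ) : Monotone (rank X n m d) := by
  intro z w h
  refine Nat.add_le_add (Finset.card_le_card fun j => ?_) (Finset.card_le_card fun j => ?_)
  · simp only [Finset.mem_filter]
    exact fun hj => ⟨hj.1, hj.2.trans h⟩
  · simp only [Finset.mem_filter]
    exact fun hj => ⟨hj.1, hj.2.trans_le h⟩

theorem rank_lt (X : ℕ → ℝ) (n m d : ℕ) (z : ℝ) : rank X n m d z < 2 * m + 1 := by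
  have h1 := Finset.card_filter_le (Finset.range m) fun j => sqc X n d j ≤ z
  have h2 := Finset.card_filter_le (Finset.range m) fun j => sqc X n d j + 1 < z
  rw [Finset.card_range] at h1 h2
  unfold rank
  omega

theorem rank_lt_left {X : ℕ → ℝ} {n m d j : ℕ} (hj : j < m) {z : ℝ} (h : z < sqc X n d j) :
    rank X n m d z < rank X n m d (sqc X n d j) := by
  refine Nat.add_lt_add_of_lt_of_le (Finset.card_lt_card ?_) (Finset.card_le_card fun i => ?_)
  · refine ⟨fun i => ?_, fun hsub => ?_⟩
    · simp only [Finset.mem_filter]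
      exact fun hi => ⟨hi.1, hi.2.trans h.le⟩
    · have := hsub (x := j) (by simp [hj])
      simp only [Finset.mem_filter] at this
      exact absurd this.2 (not_le.2 h)
  · simp only [Finset.mem_filter]
    exact fun hi => ⟨hi.1, hi.2.trans h⟩

theorem rank_lt_right {X : ℕ → ℝ} {n m d j : ℕ} (hj : j < m) {z : ℝ} (h : sqc X n d j + 1 < z) :
    rank X n m d (sqc X n d j + 1) < rank X n m d z := by
  refine Nat.add_lt_add_of_le_of_lt (Finset.card_le_card fun i => ?_) (Finset.card_lt_card ?_)
  · simp only [Finset.mem_filter]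
    exact fun hi => ⟨hi.1, hi.2.trans h.le⟩
  · refine ⟨fun i => ?_, fun hsub => ?_⟩
    · simp only [Finset.mem_filter]
      exact fun hi => ⟨hi.1, hi.2.trans h⟩
    · have := hsub (x := j) (by simp [hj, h])
      simp at this

/-- The rank jumps when a left side is reached and again just after a right side is passed. This
matches closed squares, so comparisons with sides can be read off from ranks. -/
theorem left_le_iff {X : ℕ → ℝ} {n m d j : ℕ} (hj : j < m) {z : ℝ} :
    sqc X n d j ≤ z ↔ rank X n m d (sqc X n d j) ≤ rank X n m d z :=
  ⟨fun h => rank_mono X n m d h, fun h => not_lt.1 fun h' => (rank_lt_left hj h').not_ge h⟩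

theorem le_right_iff {X : ℕ → ℝ} {n m d j : ℕ} (hj : j < m) {z : ℝ} :
    z ≤ sqc X n d j + 1 ↔ rank X n m d z ≤ rank X n m d (sqc X n d j + 1) :=
  ⟨fun h => rank_mono X n m d h, fun h => not_lt.1 fun h' => (rank_lt_right hj h').not_ge h⟩

/-- This is why one representative per rank pair suffices and the cost of a feasibility test does
not depend on the number of points. -/
theorem inside_congr {X : ℕ → ℝ} {n m i i' j : ℕ} (hj : j < m)
    (h : ∀ d < 2, rank X n m d (ptc X d i) = rank X n m d (ptc X d i')) :
    Inside X n i j ↔ Inside X n i' j := by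
  refine forall₂_congr fun d hd => ?_
  rw [left_le_iff hj, le_right_iff hj, h d hd, ← left_le_iff hj, ← le_right_iff hj]

/-- The lines with coordinates `w` stab each square exactly once: `H j` is the number of lines before
square `j`, and `G i` is the number of lines before point `i` or through it, not counting `w 0`. -/
structure Lines (X : ℕ → ℝ) (n m d : ℕ) (H G : ℕ → ℕ) (w : ℕ → ℝ) : Prop where
  mono : StrictMono w
  before : ∀ j < m, w (H j) < sqc X n d j
  left : ∀ j < m, sqc X n d j ≤ w (H j + 1)
  right : ∀ j < m, w (H j + 1) ≤ sqc X n d j + 1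
  after : ∀ j < m, sqc X n d j + 1 < w (H j + 2)
  point : ∀ i < n, w (G i) ≤ ptc X d i ∧ ptc X d i < w (G i + 1)

/-- A line meets only squares stabbed by the neighbouring lines. -/
theorem Lines.eq_or_eq {X : ℕ → ℝ} {n m d : ℕ} {H G : ℕ → ℕ} {w : ℕ → ℝ}
    (h : Lines X n m d H G w) {z : ℝ} {c : ℕ} (hc : w c ≤ z) (hc' : z < w (c + 1)) {j : ℕ}
    (hj : j < m) (h1 : sqc X n d j ≤ z) (h2 : z ≤ sqc X n d j + 1) : H j + 1 = c ∨ H j = c := by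
  have h3 : H j < c + 1 := h.mono.lt_iff_lt.1 (((h.before j hj).trans_le h1).trans hc')
  have h4 : c < H j + 2 := h.mono.lt_iff_lt.1 ((hc.trans h2).trans_lt (h.after j hj))
  omega

/-! ### Correctness of the feasibility test for preprocessed data -/

namespace Com

/-- The state after the preprocessing. -/
structure Prepared (X : ℕ → ℝ) (n m : ℕ) (w : ℕ → ℕ → ℝ) (σ : St) : Prop where
  var0 : σ.var 0 = n
  var1 : σ.var 1 = m
  var2 : σ.var 2 = m + 1
  var3 : σ.var 3 = 2 * m + 1
  inc : ∀ i j, σ.mem 0 [i, j] ≠ 0 ↔ i < n ∧ j < m ∧ Inside X n i j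
  tab : ∀ x y, σ.mem 1 [x, y] ≠ 0 → σ.mem 2 [x, y] < n ∧
    rank X n m 0 (ptc X 0 (σ.mem 2 [x, y])) = x ∧ rank X n m 1 (ptc X 1 (σ.mem 2 [x, y])) = y
  rep : ∀ i < n, σ.mem 1 [rank X n m 0 (ptc X 0 i), rank X n m 1 (ptc X 1 i)] ≠ 0
  lines : ∀ d < 2, Lines X n m d (fun j => σ.mem (5 + d) [j]) (fun i => σ.mem (7 + d) [i]) (w d)

variable {X : ℕ → ℝ} {n m : ℕ} {w : ℕ → ℕ → ℝ} {σ : St}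

/-- How far a square in the first (or the second, if `b`) of two neighbouring groups reaches. -/
def reach (b : Bool) (a : ℝ) : ℝ := bif b then -a else a + 1

/-- The sign of a coordinate that goes with `reach`. -/
def dir (b : Bool) (z : ℝ) : ℝ := bif b then -z else z

/-- The square contains the line that bounds the strip on the side of its group, so within the strip
only its far side imposes a condition. The sign in `dir` and `reach` turns both sides into the same
inequality. -/
theorem mem_iff_reach {H G : ℕ → ℕ} {w : ℕ → ℝ} {d : ℕ} (h : Lines X n m d H G w) {j c : ℕ}
    (hj : j < m) {b : Bool} (hH : H j + 1 = c + b.toNat) {z : ℝ} (hc : w c ≤ z)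
    (hc' : z ≤ w (c + 1)) :
    (sqc X n d j ≤ z ∧ z ≤ sqc X n d j + 1) ↔ dir b z ≤ reach b (sqc X n d j) := by
  cases b with
  | false =>
    simp only [Bool.toNat_false, Nat.add_zero] at hH
    have := h.left j hj
    rw [hH] at this
    simp [dir, reach, this.trans hc]
  | true =>
    simp only [Bool.toNat_true, Nat.add_right_cancel_iff] at hH
    have := h.right j hj
    rw [hH] at this
    simp [dir, reach, hc'.trans this]

theorem toNat_mod (g : ℕ) : (g % 2 == 1).toNat = g % 2 := by
  rcases Nat.mod_two_eq_zero_or_one g with h | h <;> simp [h]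

theorem toNat_div {g : ℕ} (hg : g < 4) : (g / 2 == 1).toNat = g / 2 := by
  interval_cases g <;> rfl

theorem inside_iff {X : ℕ → ℝ} {n i j : ℕ} : Inside X n i j ↔
    (sqc X n 0 j ≤ ptc X 0 i ∧ ptc X 0 i ≤ sqc X n 0 j + 1) ∧
    (sqc X n 1 j ≤ ptc X 1 i ∧ ptc X 1 i ≤ sqc X n 1 j + 1) := by
  refine ⟨fun h => ⟨h 0 (by omega), h 1 (by omega)⟩, fun h d hd => ?_⟩
  interval_cases d
  exacts [h.1, h.2]

/-- Whether a point in a cell is inside a square of a corner group of that cell. -/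
theorem Prepared.inside_iff (h : Prepared X n m w σ) {i j cx cy g : ℕ} (hi : i < n) (hj : j < m)
    (hg : g < 4) (hix : σ.mem 7 [i] = cx) (hiy : σ.mem 8 [i] = cy)
    (hjx : σ.mem 5 [j] + 1 = cx + g % 2) (hjy : σ.mem 6 [j] + 1 = cy + g / 2) :
    Inside X n i j ↔ dir (g % 2 == 1) (ptc X 0 i) ≤ reach (g % 2 == 1) (sqc X n 0 j) ∧
      dir (g / 2 == 1) (ptc X 1 i) ≤ reach (g / 2 == 1) (sqc X n 1 j) := by
  subst hix hiy
  have p0 := (h.lines 0 (by omega)).point i hi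
  have p1 := (h.lines 1 (by omega)).point i hi
  rw [Com.inside_iff, mem_iff_reach (h.lines 0 (by omega)) hj (by rw [toNat_mod]; exact hjx) p0.1
    p0.2.le, mem_iff_reach (h.lines 1 (by omega)) hj (by rw [toNat_div hg]; exact hjy) p1.1 p1.2.le]

/-- A feasible family of sets of squares gives a schedule. -/
theorem Prepared.exists_schedule (h : Prepared X n m w σ) (hF : Feasible σ) :
    ∃ cur cnt, Schedule σ cur cnt := by
  classical
  obtain ⟨S, hS, hc, hk⟩ := hF
  have hSm : ∀ g < 4, ∀ s ∈ S g, s < m := fun g hg s hs => h.var1 ▸ (hS g hg s hs).1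
  -- The candidates of a group are its squares that extend horizontally to column `x`. For groups on
  -- the left line they drop out as `x` grows; for groups on the right line they enter.
  let C : ℕ → ℕ → Finset ℕ := fun g x => (S g).filter fun s =>
    if g % 2 = 0 then x ≤ rank X n m 0 (sqc X n 0 s + 1) else rank X n m 0 (sqc X n 0 s) ≤ x
  have key : ∀ g, ∃ cur cnt, g < 4 →
      Tracks (C g) (fun s => reach (g / 2 == 1) (sqc X n 1 s)) (S g) m cur cnt := by
    intro g
    by_cases hg : g < 4
    · have hsub : ∀ x, C g x ⊆ S g := fun x => Finset.filter_subset _ _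
      by_cases h0 : g % 2 = 0
      · obtain ⟨cur, cnt, hT⟩ := exists_tracks_antitone (C := C g) (fun x y hxy s => by
          simp only [C, Finset.mem_filter, if_pos h0]
          exact fun hs => ⟨hs.1, hxy.trans hs.2⟩) (fun s => reach (g / 2 == 1) (sqc X n 1 s)) hsub
          (m := m) fun hm => (hSm g hg m hm).false
        exact ⟨cur, cnt, fun _ => hT⟩
      · obtain ⟨cur, cnt, hT⟩ := exists_tracks_monotone (C := C g) (fun x y hxy s => by
          simp only [C, Finset.mem_filter, if_neg h0]
          exact fun hs => ⟨hs.1, hs.2.trans hxy⟩) (fun s => reach (g / 2 == 1) (sqc X n 1 s)) hsub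
          (m := m)
        exact ⟨cur, cnt, fun _ => hT⟩
    · exact ⟨fun _ => 0, fun _ => 0, fun h => (hg h).elim⟩
  choose cur cnt hT using key
  refine ⟨cur, cnt, fun g hg => by rw [h.var1]; exact (hT g hg).1, fun g hg => (hT g hg).2.1, ?_,
    fun g hg x => ((hT g hg).2.2.1 x).trans (hk g hg), ?_⟩
  · intro g hg x
    rcases (hT g hg).2.2.2.1 x with h1 | ⟨h1, h2⟩
    · exact .inl h1
    · exact .inr ⟨h1, hS g hg _ h2⟩
  · intro x hx y hy hn
    obtain ⟨g, hg, s, hs, hi⟩ := hc x hx y hy hn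
    refine ⟨g, hg, ?_⟩
    set i := σ.mem 2 [x, y]
    obtain ⟨hin, hrx, -⟩ := h.tab x y hn.1
    obtain ⟨-, hsm, hins⟩ := (h.inc i s).1 hi
    have hb : ∀ s ∈ S g, σ.mem 5 [s] + 1 = σ.var 13 + g % 2 ∧ σ.mem 6 [s] + 1 = σ.var 14 + g / 2 :=
      fun s hs => (hS g hg s hs).2.2
    have hmem : ∀ s ∈ S g, s ∈ C g x ↔
        dir (g % 2 == 1) (ptc X 0 i) ≤ reach (g % 2 == 1) (sqc X n 0 s) := by
      intro s hs
      simp only [C, Finset.mem_filter, hs, true_and]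
      rw [← hrx]
      rcases Nat.mod_two_eq_zero_or_one g with h0 | h0
      · rw [if_pos h0, h0, ← le_right_iff (hSm g hg s hs)]
        simp [dir, reach]
        exact Iff.rfl
      · rw [if_neg (by omega), h0, ← left_le_iff (hSm g hg s hs)]
        simp [dir, reach]
        exact Iff.rfl
    have hins' := (h.inside_iff hin hsm hg hn.2.1 hn.2.2 (hb s hs).1 (hb s hs).2).1 hins
    -- The current square is a candidate as well and reaches at least as far vertically as `s`, so
    -- it also contains the point.
    have hbest := (hT g hg).2.2.2.2 x s ((hmem s hs).2 hins'.1)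
    have hcur : cur g (x + 1) ∈ S g := (Finset.mem_filter.1 hbest.1).1
    refine (h.inc i _).2 ⟨hin, hSm g hg _ hcur, ?_⟩
    rw [h.inside_iff hin (hSm g hg _ hcur) hg hn.2.1 hn.2.2 (hb _ hcur).1 (hb _ hcur).2]
    exact ⟨(hmem _ hcur).1 hbest.1, hins'.2.trans hbest.2⟩

/-- The feasibility test is correct. -/
theorem Prepared.feasible_iff (h : Prepared X n m w σ) (h4 : σ.var 4 = σ.var 5 + 1) :
    (feasible.eval X σ).var 17 ≠ 0 ↔ Feasible σ := by
  refine ⟨feasible_sound h4 fun i => ?_, fun hF => ?_⟩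
  -- The number `m` of the dummy square has no incidences.
  · by_contra hne
    have := ((h.inc _ _).1 hne).2.1
    rw [h.var1] at this
    exact this.false
  · obtain ⟨cur, cnt, hC⟩ := h.exists_schedule hF
    exact feasible_complete (by rw [h.var2, h.var1]) h4 hC

end Com

namespace Com

variable {X : ℕ → ℝ}

/-! ### Processing a cell -/

/-- The invariant rule for loops together with the cost. -/
theorem loop_spec {a : Com} {x y T : ℕ} {σ : St} (I : ℕ → St → Prop) (h0 : I 0 σ)
    (hstep : ∀ i < σ.var y, ∀ τ, Frame (loop x y a) σ τ → I i τ →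
      I (i + 1) (a.eval X (τ.set x i)) ∧ a.cost X (τ.set x i) ≤ T) :
    I (σ.var y) ((loop x y a).eval X σ) ∧ (loop x y a).cost X σ ≤ 4 + σ.var y * (5 + T) :=
  ⟨loop_inv I h0 fun i hi τ hτ h => (hstep i hi τ hτ h).1, loop_cost I h0 hstep⟩

/-- The parts of the state that are constant after the preprocessing. -/
structure Static (ρ σ : St) : Prop where
  var : ∀ z ∈ [0, 1, 2, 3], σ.var z = ρ.var z
  mem : ∀ k ∈ [0, 1, 2, 5, 6, 7, 8], σ.mem k = ρ.mem k

theorem Static.refl (ρ : St) : Static ρ ρ := ⟨fun _ _ => rfl, fun _ _ => rfl⟩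

theorem Static.trans {ρ σ τ : St} (h : Static ρ σ) (h' : Static σ τ) : Static ρ τ :=
  ⟨fun z hz => (h'.var z hz).trans (h.var z hz), fun k hk => (h'.mem k hk).trans (h.mem k hk)⟩

theorem Static.set {ρ σ : St} (h : Static ρ σ) {x : ℕ} (hx : x ∉ [0, 1, 2, 3]) (v : ℕ) :
    Static ρ (σ.set x v) := by
  refine ⟨fun z hz => ?_, h.mem⟩
  rw [St.set_var, if_neg, h.var z hz]
  rintro rfl
  exact hx hz

theorem Static.put {ρ σ : St} (h : Static ρ σ) {k : ℕ} (hk : k ∉ [0, 1, 2, 5, 6, 7, 8])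
    (l : List ℕ) (v : ℕ) : Static ρ (σ.put k l v) := by
  refine ⟨h.var, fun z hz => ?_⟩
  rw [← h.mem z hz]
  funext l'
  rw [St.put_mem, if_neg]
  rintro ⟨rfl, -⟩
  exact hk hz

theorem Static.frame {ρ σ τ : St} {a : Com} (h : Static ρ σ) (hf : Frame a σ τ)
    (hv : ∀ z ∈ [0, 1, 2, 3], a.modv z = false)
    (hm : ∀ k ∈ [0, 1, 2, 5, 6, 7, 8], a.modm k = false) : Static ρ τ :=
  h.trans ⟨fun z hz => hf.var z (hv z hz), fun k hk => hf.mem k (hm k hk)⟩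

theorem Prepared.static {n m : ℕ} {w : ℕ → ℕ → ℝ} {ρ σ : St} (h : Prepared X n m w ρ)
    (hs : Static ρ σ) : Prepared X n m w σ := by
  obtain ⟨h0, h1, h2, h3, hi, ht, hr, hl⟩ := h
  refine ⟨?_, ?_, ?_, ?_, ?_, ?_, ?_, ?_⟩
  · rwa [hs.var 0 (by simp)]
  · rwa [hs.var 1 (by simp)]
  · rwa [hs.var 2 (by simp)]
  · rwa [hs.var 3 (by simp)]
  · rwa [hs.mem 0 (by simp)]
  · rwa [hs.mem 1 (by simp), hs.mem 2 (by simp)]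
  · rwa [hs.mem 1 (by simp)]
  · intro d hd
    rw [hs.mem (5 + d) (by interval_cases d <;> simp), hs.mem (7 + d) (by interval_cases d <;> simp)]
    exact hl d hd

/-- The representatives in the cell `cx`, `cy` can be covered by squares with the property `A`, with
at most `κ` squares from each corner group. -/
def Coverable (ρ : St) (A : ℕ → Prop) (κ cx cy : ℕ) : Prop :=
  ∃ S : ℕ → Finset ℕ,
    (∀ g < 4, ∀ s ∈ S g, s < ρ.var 1 ∧ A s ∧
      ρ.mem 5 [s] + 1 = cx + g % 2 ∧ ρ.mem 6 [s] + 1 = cy + g / 2) ∧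
    (∀ x < ρ.var 3, ∀ y < ρ.var 3, ρ.mem 1 [x, y] ≠ 0 → ρ.mem 7 [ρ.mem 2 [x, y]] = cx →
      ρ.mem 8 [ρ.mem 2 [x, y]] = cy →
      ∃ g < 4, ∃ s ∈ S g, ρ.mem 0 [ρ.mem 2 [x, y], s] ≠ 0) ∧
    ∀ g < 4, (S g).card ≤ κ

theorem Coverable.mono {ρ : St} {A B : ℕ → Prop} {κ cx cy : ℕ} (h : Coverable ρ A κ cx cy)
    (hAB : ∀ j < ρ.var 1, A j → B j) : Coverable ρ B κ cx cy := by
  obtain ⟨S, h1, h2⟩ := h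
  exact ⟨S, fun g hg s hs => ⟨(h1 g hg s hs).1, hAB _ (h1 g hg s hs).1 (h1 g hg s hs).2.1,
    (h1 g hg s hs).2.2⟩, h2⟩

/-- The squares in use. -/
def Used (σ : St) (j : ℕ) : Prop := σ.mem 9 [j] ≠ 0

theorem Static.feasible_iff {ρ σ : St} (h : Static ρ σ) :
    Feasible σ ↔ Coverable ρ (Used σ) (σ.var 5) (σ.var 13) (σ.var 14) := by
  simp only [Feasible, Coverable, Admissible, CoversBefore, Usable, InGroup, Needed, Used,
    h.var 1 (by simp), h.var 3 (by simp), h.mem 0 (by simp), h.mem 1 (by simp), h.mem 2 (by simp),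
    h.mem 5 (by simp), h.mem 6 (by simp), h.mem 7 (by simp), h.mem 8 (by simp), and_imp]

theorem modv_feasible : ∀ z ∈ [0, 1, 2, 3, 4, 5, 11, 13, 14, 29, 30, 31, 32, 33],
    feasible.modv z = false := by decide

theorem modm_feasible (k : ℕ) (hk : k ≠ 10) : feasible.modm k = false := by
  simp [feasible, seqs, modm, initStates, nest, stateLoops, column, switchAll, switch, whenLine,
    checkAll, checkPoint, findState, hk]

/-- A bound on the cost of a feasibility test with counter bound `k`. -/
def testCost (m k : ℕ) : ℕ :=
  feasible.bound fun z => if z = 1 then m else if z = 2 then m + 1 else if z = 3 then 2 * m + 1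
    else k + 1

theorem cost_feasible {σ : St} {m k : ℕ} (h1 : σ.var 1 = m) (h2 : σ.var 2 = m + 1)
    (h3 : σ.var 3 = 2 * m + 1) (h4 : σ.var 4 ≤ k + 1) : feasible.cost X σ ≤ testCost m k := by
  refine cost_le_bound _ fun y hy => ?_
  have : ∀ y ∈ feasible.loopBounds, y ∈ [1, 2, 3, 4] := by decide
  have hy := this y hy
  refine ⟨modv_feasible y (by revert hy; simp; omega), ?_⟩
  simp only [List.mem_cons, List.not_mem_nil, or_false] at hy
  rcases hy with rfl | rfl | rfl | rfl <;> simp [*]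

/-- A feasibility test in terms of the constant parts of the state. -/
theorem Prepared.test {n m : ℕ} {w : ℕ → ℕ → ℝ} {ρ σ : St} (h : Prepared X n m w ρ)
    (hs : Static ρ σ) (h4 : σ.var 4 = σ.var 5 + 1) :
    (feasible.eval X σ).var 17 ≠ 0 ↔ Coverable ρ (Used σ) (σ.var 5) (σ.var 13) (σ.var 14) := by
  rw [(h.static hs).feasible_iff h4, hs.feasible_iff]

/-- The search ends at the latest with the bound `k`, so every test runs with a counter bound of at
most `k`. This keeps the fourth power of `k`, instead of that of `m`, in the running time. -/
theorem Prepared.search_spec {n m k : ℕ} {w : ℕ → ℕ → ℝ} {ρ σ : St} (h : Prepared X n m w ρ)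
    (hs : Static ρ σ) (hk : 1 ≤ k) (hkm : k ≤ m)
    (hc : Coverable ρ (Used σ) k (σ.var 13) (σ.var 14)) :
    (1 ≤ (search.eval X σ).var 5 ∧ (search.eval X σ).var 5 ≤ k ∧
      (search.eval X σ).var 4 = (search.eval X σ).var 5 + 1 ∧
      Coverable ρ (Used σ) ((search.eval X σ).var 5) (σ.var 13) (σ.var 14) ∧
      ∀ κ, 1 ≤ κ → Coverable ρ (Used σ) κ (σ.var 13) (σ.var 14) → (search.eval X σ).var 5 ≤ κ) ∧
    search.cost X σ ≤ 6 + m * (9 + testCost m k) := by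
  have hm : ((σ.set 5 0).set 17 0).var 1 = m := by
    rw [← h.var1, ← hs.var 1 (by simp)]
    simp
  have hloop := loop_spec (X := X) (a := ite 17 skip (seqs [succ 5 5, succ 4 5, feasible])) (x := 11)
    (y := 1) (σ := (σ.set 5 0).set 17 0) (T := 4 + testCost m k)
    (fun l υ => υ.var 17 = 0 ∧ υ.var 5 = l ∧
        (∀ κ, 1 ≤ κ → κ ≤ l → ¬ Coverable ρ (Used σ) κ (σ.var 13) (σ.var 14)) ∨
      υ.var 17 ≠ 0 ∧ 1 ≤ υ.var 5 ∧ υ.var 5 ≤ k ∧ υ.var 4 = υ.var 5 + 1 ∧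
        Coverable ρ (Used σ) (υ.var 5) (σ.var 13) (σ.var 14) ∧
        ∀ κ, 1 ≤ κ → Coverable ρ (Used σ) κ (σ.var 13) (σ.var 14) → υ.var 5 ≤ κ)
    (.inl ⟨by simp, by simp, by omega⟩) ?_
  · obtain ⟨h1, h2⟩ := hloop
    rw [hm] at h1 h2
    refine ⟨?_, ?_⟩
    · rcases h1 with ⟨-, -, h1⟩ | ⟨-, h1⟩
      · exact (h1 k hk hkm hc).elim
      · exact h1
    · rw [show search.cost X σ = 1 + (1 + _) from rfl]
      refine (Nat.add_le_add_left (Nat.add_le_add_left h2 _) _).trans (le_of_eq (by ring))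
  · intro l hl υ hυ hI
    by_cases h17 : υ.var 17 = 0
    swap
    · rcases hI with hI | hI
      · exact (h17 hI.1).elim
      · simp only [eval, cost, St.set_var]
        simp only [show (17 : ℕ) ≠ 11 by decide, if_false, ne_eq, h17, not_false_eq_true, if_true]
        refine ⟨.inr ?_, by omega⟩
        simpa [h17] using hI
    rcases hI with hI | hI
    swap
    · exact (hI.1 h17).elim
    set ω := ((υ.set 11 l).set 5 (l + 1)).set 4 (l + 2) with hω
    have he : (ite 17 skip (seqs [succ 5 5, succ 4 5, feasible])).eval X (υ.set 11 l) =
        feasible.eval X ω := by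
      simp [eval, seqs, h17, hω, hI.2.1]
    have hcst : (ite 17 skip (seqs [succ 5 5, succ 4 5, feasible])).cost X (υ.set 11 l) =
        4 + feasible.cost X ω := by
      simp [eval, cost, seqs, h17, hω, hI.2.1]
      ring
    have hsυ : Static ρ υ := ((hs.set (x := 5) (by simp) 0).set (x := 17) (by simp) 0).frame hυ
      (by decide) (by decide)
    have hsω : Static ρ ω :=
      ((hsυ.set (by simp) _).set (by simp) _).set (by simp) _
    have hu : Used ω = Used σ := by
      funext j
      simp only [Used, hω, St.set_mem]
      rw [hυ.mem 9 (by decide)]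
      rfl
    have h13 : ω.var 13 = σ.var 13 := by
      have := hυ.var 13 (by decide)
      simpa [hω] using this
    have h14 : ω.var 14 = σ.var 14 := by
      have := hυ.var 14 (by decide)
      simpa [hω] using this
    have htest := h.test (X := X) hsω (by simp [hω])
    rw [hu, h13, h14] at htest
    have hω5 : ω.var 5 = l + 1 := by simp [hω]
    have hf4 := (frame X feasible ω).var 4 (modv_feasible 4 (by simp))
    have hf5 := (frame X feasible ω).var 5 (modv_feasible 5 (by simp))
    have hω4 : ω.var 4 = l + 2 := by simp [hω]
    rw [hω5] at htest hf5
    rw [hω4] at hf4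
    have hlk : l < k := by
      by_contra hlk
      exact hI.2.2 k hk (by omega) hc
    rw [he, hcst]
    refine ⟨?_, Nat.add_le_add_left (cost_feasible ?_ ?_ ?_ ?_) _⟩
    · by_cases h17' : (feasible.eval X ω).var 17 = 0
      · refine .inl ⟨h17', hf5, fun κ h1 h2 => ?_⟩
        rcases Nat.le_succ_iff.1 h2 with h2 | rfl
        · exact hI.2.2 κ h1 h2
        · exact fun hc => htest.2 hc h17'
      · refine .inr ⟨h17', ?_, ?_, ?_, ?_, ?_⟩ <;> rw [hf5]
        · omega
        · exact hlk
        · exact hf4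
        · exact htest.1 h17'
        · intro κ h1 h2
          by_contra h3
          exact hI.2.2 κ h1 (by omega) h2
    · rw [hsω.var 1 (by simp), h.var1]
    · rw [hsω.var 2 (by simp), h.var2]
    · rw [hsω.var 3 (by simp), h.var3]
    · omega

/-- One pass reaches a minimal set: `Coverable` is monotone in the squares allowed, so a square
whose removal has failed cannot be removed after further removals either. -/
theorem Prepared.shrink_spec {n m k : ℕ} {w : ℕ → ℕ → ℝ} {ρ σ : St} (h : Prepared X n m w ρ)
    (hs : Static ρ σ) (h4 : σ.var 4 = σ.var 5 + 1) (hk : σ.var 5 ≤ k) (ha : ∀ j < m, Used σ j)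
    (hc : Coverable ρ (Used σ) (σ.var 5) (σ.var 13) (σ.var 14)) :
    (Coverable ρ (Used (shrink.eval X σ)) (σ.var 5) (σ.var 13) (σ.var 14) ∧
      ∀ j < m, Used (shrink.eval X σ) j →
        ¬ Coverable ρ (fun i => Used (shrink.eval X σ) i ∧ i ≠ j) (σ.var 5) (σ.var 13) (σ.var 14)) ∧
    shrink.cost X σ ≤ 4 + m * (19 + testCost m k) := by
  have hm : σ.var 1 = m := by rw [← h.var1, ← hs.var 1 (by simp)]
  have hloop := loop_spec (X := X) (a := seqs [const 9 0, store 9 [11] 9, feasible,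
    ite 17 skip (seqs [const 9 1, store 9 [11] 9])]) (x := 11) (y := 1) (σ := σ)
    (T := 14 + testCost m k)
    (fun l υ => Coverable ρ (Used υ) (σ.var 5) (σ.var 13) (σ.var 14) ∧
      (∀ j, l ≤ j → j < m → Used υ j) ∧
      ∀ j < l, Used υ j →
        ¬ Coverable ρ (fun i => Used υ i ∧ i ≠ j) (σ.var 5) (σ.var 13) (σ.var 14))
    ⟨hc, fun j _ hj => ha j hj, by simp⟩ ?_
  · rw [hm] at hloop
    exact ⟨⟨hloop.1.1, hloop.1.2.2⟩, hloop.2.trans (le_of_eq (by ring))⟩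
  · rintro l hl υ hυ ⟨hI1, hI2, hI3⟩
    set ω := (((υ.set 11 l).set 9 0).put 9 [l] 0) with hω
    have hsυ : Static ρ υ := hs.frame hυ (by decide) (by decide)
    have hsω : Static ρ ω := ((hsυ.set (by simp) _).set (by simp) _).put (by simp) _ _
    have hv : ∀ z ∈ [4, 5, 13, 14], ω.var z = σ.var z := by
      intro z hz
      have h1 : (shrink).modv z = false := by revert z; decide
      have h2 : z ≠ 9 ∧ z ≠ 11 := by revert z; decide
      simp only [hω, St.put_var, St.set_var, h2.1, h2.2, if_false]
      exact hυ.var z h1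
    have hu : Used ω = fun i => Used υ i ∧ i ≠ l := by
      funext i
      simp only [Used, hω, St.put_mem, St.set_mem]
      by_cases hi : i = l <;> simp [hi]
    have htest := h.test (X := X) hsω (by rw [hv 4 (by simp), hv 5 (by simp), h4])
    rw [hv 5 (by simp), hv 13 (by simp), hv 14 (by simp), hu] at htest
    have hcst : feasible.cost X ω ≤ testCost m k := by
      refine cost_feasible ?_ ?_ ?_ ?_
      · rw [hsω.var 1 (by simp), h.var1]
      · rw [hsω.var 2 (by simp), h.var2]
      · rw [hsω.var 3 (by simp), h.var3]
      · rw [hv 4 (by simp)]; omega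
    have hf11 : (feasible.eval X ω).var 11 = l := by
      rw [(frame X feasible ω).var 11 (modv_feasible 11 (by simp))]
      simp [hω]
    have hf9 : (feasible.eval X ω).mem 9 = ω.mem 9 :=
      (frame X feasible ω).mem 9 (modm_feasible 9 (by simp))
    have hevω : (store 9 [11] 9).eval X ((const 9 0).eval X (υ.set 11 l)) = ω := by
      simp [eval, hω]
    have he : (seqs [const 9 0, store 9 [11] 9, feasible, ite 17 skip (seqs [const 9 1,
        store 9 [11] 9])]).eval X (υ.set 11 l) =
        (ite 17 skip (seq (const 9 1) (store 9 [11] 9))).eval X (feasible.eval X ω) := by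
      rw [← hevω]
      rfl
    have hc' : (seqs [const 9 0, store 9 [11] 9, feasible, ite 17 skip (seqs [const 9 1,
        store 9 [11] 9])]).cost X (υ.set 11 l) = 1 + (5 + (feasible.cost X ω +
        (ite 17 skip (seq (const 9 1) (store 9 [11] 9))).cost X (feasible.eval X ω))) := by
      rw [← hevω]
      rfl
    rw [he, hc']
    by_cases h17 : (feasible.eval X ω).var 17 = 0
    · have hu' : Used ((ite 17 skip (seq (const 9 1) (store 9 [11] 9))).eval X
          (feasible.eval X ω)) = Used υ := by
        funext i
        simp only [Used, eval, h17, ne_eq, not_true_eq_false, if_false, St.put_mem, St.set_mem, hf9,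
          List.map_cons, List.map_nil, St.set_var, show (11 : ℕ) ≠ 9 by decide, hf11]
        by_cases hi : i = l
        · subst hi
          have : υ.mem 9 [i] ≠ 0 := hI2 i le_rfl (by omega)
          simpa [hf11] using this
        · simp [hi, hω]
      rw [hu']
      refine ⟨⟨hI1, fun j hj => hI2 j (by omega), fun j hj hj' => ?_⟩, ?_⟩
      · rcases Nat.lt_succ_iff_lt_or_eq.1 hj with hj | rfl
        · exact hI3 j hj hj'
        · exact fun hc => htest.2 hc h17
      · simp [cost, h17]
        omega
    · have hu' : Used ((ite 17 skip (seq (const 9 1) (store 9 [11] 9))).eval X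
          (feasible.eval X ω)) = Used ω := by
        funext i
        simp [Used, eval, h17, hf9]
      rw [hu', hu]
      refine ⟨⟨htest.1 h17, fun j hj hj' => ⟨hI2 j (by omega) hj', by omega⟩, ?_⟩, ?_⟩
      · rintro j hj ⟨hj1, hj2⟩ hcj
        exact hI3 j (by omega) hj1 (hcj.mono fun i _ hi => ⟨hi.1.1, hi.2⟩)
      · simp [cost, h17]
        omega

/-- A minimal cover of the representatives in the cell `cx`, `cy`, for the least bound on the sizes
of the corner groups. -/
def Optimal (ρ : St) (k cx cy : ℕ) (A : Finset ℕ) : Prop :=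
  (∀ j ∈ A, j < ρ.var 1) ∧ ∃ κ, 1 ≤ κ ∧ κ ≤ k ∧ Coverable ρ (· ∈ A) κ cx cy ∧
    (∀ κ', 1 ≤ κ' → Coverable ρ (fun _ => True) κ' cx cy → κ ≤ κ') ∧
    ∀ j ∈ A, ¬ Coverable ρ (fun i => i ∈ A ∧ i ≠ j) κ cx cy

/-- A bound on the cost of processing a cell. -/
def cellCost (m k : ℕ) : ℕ := 36 + m * (54 + 2 * testCost m k)

theorem output_out (σ : St) (j : ℕ) :
    (output.eval X σ).out j ≠ 0 ↔ σ.out j ≠ 0 ∨ j < σ.var 1 ∧ Used σ j := by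
  have := loop_inv (X := X) (a := seqs [load 8 9 [7], ite 8 (mark 7) skip]) (x := 7) (y := 1) (σ := σ)
    (fun l υ => υ.out j ≠ 0 ↔ σ.out j ≠ 0 ∨ j < l ∧ Used σ j) (by simp) ?_
  · exact this
  · intro l _ υ hυ hI
    have h9 : υ.mem 9 = σ.mem 9 := hυ.mem 9 (by decide)
    by_cases hl : σ.mem 9 [l] = 0
    · simp only [seqs, eval, List.map, St.set_var, St.set_mem, h9]
      simp only [if_true, hl, ne_eq, not_true_eq_false, if_false, St.set_out]
      rw [← ne_eq, hI]
      refine or_congr_right (and_congr_left fun hu => ?_)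
      have : j ≠ l := by rintro rfl; exact hu hl
      omega
    · simp only [seqs, eval, List.map, St.set_var, St.set_mem, h9]
      simp only [if_true, hl, ne_eq, not_false_eq_true, St.mark_out, St.set_out]
      by_cases hj : j = l
      · simp [hj, Used, hl]
      · simp only [show (7 : ℕ) ≠ 8 by decide, if_false, hj]
        rw [← ne_eq, hI]
        refine or_congr_right (and_congr_left fun _ => ?_)
        omega

/-- All cells finished so far have been covered optimally. -/
def Progress (ρ : St) (k : ℕ) (σ : St) : Prop :=
  Static ρ σ ∧ ∃ F : ℕ → ℕ → Finset ℕ,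
    (∀ cx cy, σ.mem 11 [cx, cy] ≠ 0 → Optimal ρ k cx cy (F cx cy)) ∧
    ∀ j, σ.out j ≠ 0 ↔ ∃ cx cy, σ.mem 11 [cx, cy] ≠ 0 ∧ j ∈ F cx cy

theorem Prepared.cell_spec {n m k : ℕ} {w : ℕ → ℕ → ℝ} {ρ σ : St} (h : Prepared X n m w ρ)
    (hk : 1 ≤ k) (hkm : k ≤ m) (hσ : Progress ρ k σ)
    (hc : Coverable ρ (fun _ => True) k (σ.var 13) (σ.var 14)) :
    Progress ρ k (cell.eval X σ) ∧
      (∀ cx cy, (cell.eval X σ).mem 11 [cx, cy] ≠ 0 ↔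
        σ.mem 11 [cx, cy] ≠ 0 ∨ cx = σ.var 13 ∧ cy = σ.var 14) ∧
      cell.cost X σ ≤ cellCost m k := by
  classical
  obtain ⟨hs, F, hF, hout⟩ := hσ
  have hm : σ.var 1 = m := by rw [← h.var1, ← hs.var 1 (by simp)]
  by_cases hd : σ.mem 11 [σ.var 13, σ.var 14] = 0
  swap
  · have he : cell.eval X σ = σ.set 8 (σ.mem 11 [σ.var 13, σ.var 14]) := by
      simp [cell, seqs, eval, hd]
    rw [he]
    refine ⟨⟨hs.set (by simp) _, F, hF, hout⟩, ?_, ?_⟩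
    · rintro cx cy
      refine ⟨.inl, ?_⟩
      rintro (h | ⟨rfl, rfl⟩)
      exacts [h, hd]
    · simp [cell, seqs, cost, eval, hd, cellCost]
      omega
  set σ₁ := ((σ.set 8 0).set 9 1).put 11 [σ.var 13, σ.var 14] 1 with hσ₁
  set σ₂ := (loop 7 1 (store 9 [7] 9)).eval X σ₁ with hσ₂
  set σ₃ := search.eval X σ₂ with hσ₃
  set σ₄ := shrink.eval X σ₃ with hσ₄
  have he : cell.eval X σ = output.eval X σ₄ := by
    simp [cell, seqs, eval, hd, hσ₄, hσ₃, hσ₂, hσ₁]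
  have hcost : cell.cost X σ = 17 + ((loop 7 1 (store 9 [7] 9)).cost X σ₁ + (search.cost X σ₂ +
      (shrink.cost X σ₃ + output.cost X σ₄))) := by
    simp only [cell, seqs]
    simp [cost, eval, hd, hσ₄, hσ₃, hσ₂, hσ₁]
    ring
  have s1 : Static ρ σ₁ := ((hs.set (by simp) _).set (by simp) _).put (by simp) _ _
  have f2 : Frame _ σ₁ σ₂ := frame X _ _
  have f3 : Frame search σ₂ σ₃ := frame X _ _
  have f4 : Frame shrink σ₃ σ₄ := frame X _ _
  have s2 : Static ρ σ₂ := s1.frame f2 (by decide) (by decide)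
  have s3 : Static ρ σ₃ := s2.frame f3 (by decide) (by decide)
  have s4 : Static ρ σ₄ := s3.frame f4 (by decide) (by decide)
  have s5 : Static ρ (output.eval X σ₄) := s4.frame (frame X _ _) (by decide) (by decide)
  have a2 : ∀ j < m, Used σ₂ j := by
    have := loop_inv (X := X) (a := store 9 [7] 9) (x := 7) (y := 1) (σ := σ₁)
      (fun l υ => υ.var 9 = 1 ∧ ∀ j < l, Used υ j) ⟨by simp [hσ₁], by simp⟩ ?_
    · rw [s1.var 1 (by simp), h.var1] at this
      exact this.2
    · rintro l _ υ - ⟨h9, hI⟩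
      refine ⟨by simp [eval, h9], fun j hj => ?_⟩
      rcases Nat.lt_succ_iff_lt_or_eq.1 hj with hj | rfl
      · have := hI j hj
        simp only [Used, eval, St.put_mem, St.set_mem] at this ⊢
        split_ifs
        · simp [h9]
        · exact this
      · simp [Used, eval, h9]
  have hcell : ∀ z ∈ [13, 14], σ₂.var z = σ.var z ∧ σ₃.var z = σ.var z := by
    intro z hz
    have hmod : ∀ z ∈ [13, 14], (loop 7 1 (store 9 [7] 9)).modv z = false ∧
        search.modv z = false := by decide
    have h2 := f2.var z (hmod z hz).1
    have h3 := f3.var z (hmod z hz).2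
    have h1 : σ₁.var z = σ.var z := by
      simp only [List.mem_cons, List.not_mem_nil, or_false] at hz
      rcases hz with rfl | rfl <;> simp [hσ₁]
    exact ⟨h2.trans h1, h3.trans (h2.trans h1)⟩
  obtain ⟨⟨k1, k2, k3, k4, k5⟩, k6⟩ := h.search_spec (X := X) s2 hk hkm (by
    rw [(hcell 13 (by simp)).1, (hcell 14 (by simp)).1]
    exact hc.mono fun j hj _ => a2 j (by rwa [h.var1] at hj))
  rw [(hcell 13 (by simp)).1, (hcell 14 (by simp)).1] at k4 k5
  rw [← hσ₃] at k1 k2 k3 k4 k5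
  have hu3 : Used σ₃ = Used σ₂ := by
    funext j
    simp only [Used]
    rw [f3.mem 9 (by decide)]
  obtain ⟨⟨l1, l2⟩, l3⟩ := h.shrink_spec (X := X) s3 k3 k2 (by rwa [hu3]) (by
    rw [(hcell 13 (by simp)).2, (hcell 14 (by simp)).2, hu3]
    exact k4)
  rw [(hcell 13 (by simp)).2, (hcell 14 (by simp)).2] at l1 l2
  rw [← hσ₄] at l1 l2
  have m11 : (output.eval X σ₄).mem 11 = σ₁.mem 11 := by
    rw [(frame X output σ₄).mem 11 (by decide), f4.mem 11 (by decide), f3.mem 11 (by decide),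
      f2.mem 11 (by decide)]
  have o4 : σ₄.out = σ.out := by
    rw [f4.out (by decide), f3.out (by decide), f2.out (by decide)]
    rfl
  have hm11 : ∀ cx cy, (cell.eval X σ).mem 11 [cx, cy] ≠ 0 ↔
        σ.mem 11 [cx, cy] ≠ 0 ∨ cx = σ.var 13 ∧ cy = σ.var 14 := by
    intro cx cy
    rw [he, m11, hσ₁, St.put_mem]
    by_cases hcc : cx = σ.var 13 ∧ cy = σ.var 14
    · simp [hcc]
    · rw [if_neg (by simpa using hcc)]
      simp [hcc]
  refine ⟨⟨he ▸ s5, fun cx cy => if cx = σ.var 13 ∧ cy = σ.var 14 then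
    (Finset.range m).filter fun j => Used σ₄ j else F cx cy, ?_, ?_⟩, hm11, ?_⟩
  · intro cx cy hne
    rw [hm11] at hne
    beta_reduce
    by_cases hcc : cx = σ.var 13 ∧ cy = σ.var 14
    · rw [if_pos hcc, hcc.1, hcc.2]
      refine ⟨fun j hj => ?_, σ₃.var 5, k1, k2, l1.mono fun j hj hu => ?_,
        fun κ' h1 h2 => k5 κ' h1 (h2.mono fun j hj _ => a2 j (by rwa [h.var1] at hj)),
        fun j hj hcj => ?_⟩
      · rw [h.var1]
        exact Finset.mem_range.1 (Finset.mem_filter.1 hj).1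
      · rw [h.var1] at hj
        simp [hj, hu]
      · simp only [Finset.mem_filter, Finset.mem_range] at hj hcj
        exact l2 j hj.1 hj.2 (hcj.mono fun i _ hi => ⟨hi.1.2, hi.2⟩)
    · rw [if_neg hcc]
      exact hF cx cy (hne.resolve_right hcc)
  · intro j
    rw [he, output_out, o4, hout, s4.var 1 (by simp), h.var1, ← he]
    simp only [hm11]
    constructor
    · rintro (⟨cx, cy, h1, h2⟩ | h1)
      · refine ⟨cx, cy, .inl h1, ?_⟩
        rwa [if_neg]
        rintro ⟨rfl, rfl⟩
        exact h1 hd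
      · refine ⟨_, _, .inr ⟨rfl, rfl⟩, ?_⟩
        rw [if_pos ⟨rfl, rfl⟩]
        simpa using h1
    · rintro ⟨cx, cy, h1, h2⟩
      by_cases hcc : cx = σ.var 13 ∧ cy = σ.var 14
      · rw [if_pos hcc] at h2
        exact .inr (by simpa using h2)
      · rw [if_neg hcc] at h2
        exact .inl ⟨cx, cy, h1.resolve_right hcc, h2⟩
  · have c1 : (loop 7 1 (store 9 [7] 9)).cost X σ₁ ≤ 4 + m * 10 := by
      have := cost_le_bound (X := X) (β := fun _ => m) (loop 7 1 (store 9 [7] 9)) (σ := σ₁) (by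
        simp [loopBounds, modv, hσ₁, hm])
      simpa [bound] using this
    have c2 : output.cost X σ₄ ≤ 4 + m * 13 := by
      have := cost_le_bound (X := X) (β := fun _ => m) output (σ := σ₄) (by
        have := s4.var 1 (by simp)
        rw [h.var1] at this
        simp [output, seqs, loopBounds, modv, this])
      simpa [bound, output, seqs] using this
    rw [hcost, cellCost]
    nlinarith

end Com

/-! ### Processing all cells -/

namespace Com

variable {X : ℕ → ℝ} {n m k : ℕ} {w : ℕ → ℕ → ℝ} {ρ σ : St}

theorem Progress.congr {σ' : St} (h : Progress ρ k σ) (hs : Static ρ σ')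
    (hm : σ'.mem 11 = σ.mem 11) (ho : σ'.out = σ.out) : Progress ρ k σ' := by
  obtain ⟨-, F, h1, h2⟩ := h
  refine ⟨hs, F, ?_, ?_⟩
  · rwa [hm]
  · rwa [hm, ho]

theorem Progress.set (h : Progress ρ k σ) {x : ℕ} (hx : x ∉ [0, 1, 2, 3]) (v : ℕ) :
    Progress ρ k (σ.set x v) :=
  h.congr (h.1.set hx v) rfl rfl

theorem Prepared.cellAt_spec (h : Prepared X n m w ρ) (hk : 1 ≤ k) (hkm : k ≤ m)
    (hσ : Progress ρ k σ) (hc : ∀ cx cy, Coverable ρ (fun _ => True) k cx cy) {a b : ℕ}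
    (hb : 29 ≤ b) {τ : St}
    (hτ : τ = cell.eval X ((copy 14 b).eval X ((copy 13 a).eval X σ))) :
    Progress ρ k τ ∧ τ.mem 11 [σ.var a, σ.var b] ≠ 0 ∧
      (∀ cx cy, σ.mem 11 [cx, cy] ≠ 0 → τ.mem 11 [cx, cy] ≠ 0) ∧
      (∀ z ∈ [29, 30, 31, 32, 33], τ.var z = σ.var z) ∧
      cell.cost X ((copy 14 b).eval X ((copy 13 a).eval X σ)) ≤ cellCost m k := by
  subst hτ
  set ω := (copy 14 b).eval X ((copy 13 a).eval X σ) with hω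
  have h13 : ω.var 13 = σ.var a := by simp [hω, eval]
  have h14 : ω.var 14 = σ.var b := by
    have : b ≠ 13 := by omega
    simp [hω, eval, this]
  have hp : Progress ρ k ω := (hσ.set (x := 13) (by simp) _).set (x := 14) (by simp) _
  obtain ⟨h1, h2, h3⟩ := h.cell_spec (X := X) hk hkm hp (hc _ _)
  refine ⟨h1, (h2 _ _).2 (.inr ⟨h13.symm, h14.symm⟩), fun cx cy hne => (h2 _ _).2 (.inl hne), ?_,
    h3⟩
  intro z hz
  rw [(frame X cell ω).var z (by revert z; decide)]
  have : z ≠ 13 ∧ z ≠ 14 := by clear * - hz; revert z; decide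
  simp [hω, eval, this]

/-- A point in a square lies in one of the four cells around the crossing of the two lines that stab
the square. Visiting these cells for every square therefore reaches each cell with a point to be
covered. -/
theorem Prepared.cells_spec (h : Prepared X n m w ρ) (hk : 1 ≤ k) (hkm : k ≤ m)
    (hσ : Progress ρ k σ) (hc : ∀ cx cy, Coverable ρ (fun _ => True) k cx cy) :
    (Progress ρ k (cells.eval X σ) ∧ ∀ j < m, ∀ a < 2, ∀ b < 2,
      (cells.eval X σ).mem 11 [ρ.mem 5 [j] + a, ρ.mem 6 [j] + b] ≠ 0) ∧
    cells.cost X σ ≤ 4 + m * (25 + 4 * cellCost m k) := by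
  have hm : σ.var 1 = m := by rw [← h.var1, ← hσ.1.var 1 (by simp)]
  have hloop := loop_spec (X := X) (a := seqs [load 30 5 [29], load 31 6 [29], succ 32 30,
    succ 33 31, copy 13 30, copy 14 31, cell, copy 13 32, copy 14 31, cell,
    copy 13 30, copy 14 33, cell, copy 13 32, copy 14 33, cell]) (x := 29) (y := 1) (σ := σ)
    (T := 20 + 4 * cellCost m k)
    (fun l υ => Progress ρ k υ ∧ ∀ j < l, ∀ a < 2, ∀ b < 2,
      υ.mem 11 [ρ.mem 5 [j] + a, ρ.mem 6 [j] + b] ≠ 0) ⟨hσ, by simp⟩ ?_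
  · rw [hm] at hloop
    exact ⟨hloop.1, hloop.2.trans (le_of_eq (by ring))⟩
  · rintro l - υ - ⟨hI1, hI2⟩
    set ω := ((((υ.set 29 l).set 30 (ρ.mem 5 [l])).set 31 (ρ.mem 6 [l])).set 32
      (ρ.mem 5 [l] + 1)).set 33 (ρ.mem 6 [l] + 1) with hω
    have hω' : (succ 33 31).eval X ((succ 32 30).eval X ((load 31 6 [29]).eval X
        ((load 30 5 [29]).eval X (υ.set 29 l)))) = ω := by
      simp [eval, hω, hI1.1.mem 5 (by simp), hI1.1.mem 6 (by simp)]
    have hp : Progress ρ k ω := ((((hI1.set (by simp) _).set (by simp) _).set (by simp) _).set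
      (by simp) _).set (by simp) _
    set τ₁ := cell.eval X ((copy 14 31).eval X ((copy 13 30).eval X ω)) with hτ₁
    set τ₂ := cell.eval X ((copy 14 31).eval X ((copy 13 32).eval X τ₁)) with hτ₂
    set τ₃ := cell.eval X ((copy 14 33).eval X ((copy 13 30).eval X τ₂)) with hτ₃
    set τ₄ := cell.eval X ((copy 14 33).eval X ((copy 13 32).eval X τ₃)) with hτ₄
    obtain ⟨p1, q1, r1, s1, c1⟩ := h.cellAt_spec hk hkm hp hc (a := 30) (by omega) hτ₁
    obtain ⟨p2, q2, r2, s2, c2⟩ := h.cellAt_spec hk hkm p1 hc (a := 32) (by omega) hτ₂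
    obtain ⟨p3, q3, r3, s3, c3⟩ := h.cellAt_spec hk hkm p2 hc (a := 30) (by omega) hτ₃
    obtain ⟨p4, q4, r4, s4, c4⟩ := h.cellAt_spec hk hkm p3 hc (a := 32) (by omega) hτ₄
    have he : (seqs [load 30 5 [29], load 31 6 [29], succ 32 30,
        succ 33 31, copy 13 30, copy 14 31, cell, copy 13 32, copy 14 31, cell,
        copy 13 30, copy 14 33, cell, copy 13 32, copy 14 33, cell]).eval X (υ.set 29 l) = τ₄ := by
      rw [hτ₄, hτ₃, hτ₂, hτ₁, ← hω']
      rfl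
    have hcost : (seqs [load 30 5 [29], load 31 6 [29], succ 32 30,
        succ 33 31, copy 13 30, copy 14 31, cell, copy 13 32, copy 14 31, cell,
        copy 13 30, copy 14 33, cell, copy 13 32, copy 14 33, cell]).cost X (υ.set 29 l) =
        5 + (5 + (1 + (1 + (1 + (1 + (cell.cost X _ + (1 + (1 + (cell.cost X _ + (1 + (1 +
          (cell.cost X _ + (1 + (1 + cell.cost X _)))))))))))))) := rfl
    rw [he, hcost, hω', ← hτ₁, ← hτ₂, ← hτ₃]
    refine ⟨⟨p4, ?_⟩, by omega⟩
    have v1 : ∀ z ∈ [29, 30, 31, 32, 33], τ₂.var z = ω.var z :=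
      fun z hz => (s2 z hz).trans (s1 z hz)
    have v2 : ∀ z ∈ [29, 30, 31, 32, 33], τ₃.var z = ω.var z :=
      fun z hz => (s3 z hz).trans (v1 z hz)
    rw [s1 32 (by simp), s1 31 (by simp)] at q2
    rw [v1 30 (by simp), v1 33 (by simp)] at q3
    rw [v2 32 (by simp), v2 33 (by simp)] at q4
    intro j hj a ha b hb
    rcases Nat.lt_succ_iff_lt_or_eq.1 hj with hj | rfl
    · exact r4 _ _ (r3 _ _ (r2 _ _ (r1 _ _ (hI2 j hj a ha b hb))))
    · have w30 : ω.var 30 = ρ.mem 5 [j] := by simp [hω]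
      have w31 : ω.var 31 = ρ.mem 6 [j] := by simp [hω]
      have w32 : ω.var 32 = ρ.mem 5 [j] + 1 := by simp [hω]
      have w33 : ω.var 33 = ρ.mem 6 [j] + 1 := by simp [hω]
      rw [w30, w31] at q1
      rw [w32, w31] at q2
      rw [w30, w33] at q3
      rw [w32, w33] at q4
      interval_cases a <;> interval_cases b
      · exact r4 _ _ (r3 _ _ (r2 _ _ q1))
      · exact r4 _ _ q3
      · exact r4 _ _ (r3 _ _ q2)
      · exact q4

end Com

namespace Com

variable {X : ℕ → ℝ} {n m : ℕ} {σ : St}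

/-! ### Preprocessing -/

theorem objVal_point (σ : St) (d i : ℕ) : objVal X σ d false i = ptc X d (σ.var i) := by
  simp [objVal, ptc]

theorem objVal_square (σ : St) (d j : ℕ) : objVal X σ d true j = sqc X (σ.var 0) d (σ.var j) := by
  simp [objVal, sqc]

theorem setup_spec (h0 : σ.var 0 = n) (h1 : σ.var 1 = m) :
    (setup.eval X σ).var 0 = n ∧ (setup.eval X σ).var 1 = m ∧ (setup.eval X σ).var 2 = m + 1 ∧
      (setup.eval X σ).var 3 = 2 * m + 1 ∧ (setup.eval X σ).mem = σ.mem ∧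
      (setup.eval X σ).out = σ.out := by
  have hl : ∀ υ : St, υ.var 1 = m → ((loop 7 1 (succ 3 3)).eval X υ).var 3 = υ.var 3 + m := by
    intro υ hυ
    have := loop_inv (X := X) (a := succ 3 3) (x := 7) (y := 1) (σ := υ)
      (fun l τ => τ.var 3 = υ.var 3 + l) rfl (by
        intro l _ τ _ hI
        simp [eval, hI]
        ring)
    rwa [hυ] at this
  have hf := frame X setup σ
  refine ⟨(hf.var 0 (by decide)).trans h0, (hf.var 1 (by decide)).trans h1, ?_, ?_, ?_,
    hf.out (by decide)⟩
  · have hf2 := frame X (seqs [const 3 1, loop 7 1 (succ 3 3), loop 7 1 (succ 3 3)])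
      ((succ 2 1).eval X σ)
    rw [show setup.eval X σ = (seqs [const 3 1, loop 7 1 (succ 3 3), loop 7 1 (succ 3 3)]).eval X
      ((succ 2 1).eval X σ) from rfl, hf2.var 2 (by decide)]
    simp [eval, h1]
  · rw [show setup.eval X σ = (loop 7 1 (succ 3 3)).eval X ((loop 7 1 (succ 3 3)).eval X
      ((σ.set 2 (σ.var 1 + 1)).set 3 1)) from rfl, hl, hl]
    · simp
      ring
    · simp [h1]
    · rw [(frame X (loop 7 1 (succ 3 3)) _).var 1 (by decide)]
      simp [h1]
  · funext k
    exact hf.mem k (by simp [setup, seqs, modm])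

open Classical in
theorem whenInside_eval (a : Com) (h0 : σ.var 0 = n) : (whenInside a).eval X σ =
    if Inside X n (σ.var 6) (σ.var 7) then a.eval X (σ.set 8 0) else σ.set 8 1 := by
  rw [inside_iff]
  by_cases h1 : ptc X 0 (σ.var 6) < sqc X n 0 (σ.var 7)
  · simp [whenInside, seqs, eval, objVal_point, objVal_square, h0, h1, h1.not_ge]
  by_cases h2 : ptc X 1 (σ.var 6) < sqc X n 1 (σ.var 7)
  · simp [whenInside, seqs, eval, objVal_point, objVal_square, h0, h1, h2, h2.not_ge]
  by_cases h3 : sqc X n 0 (σ.var 7) + 1 < ptc X 0 (σ.var 6)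
  · simp [whenInside, seqs, eval, objVal_point, objVal_square, h0, h1, h2, h3, h3.not_ge]
  by_cases h4 : sqc X n 1 (σ.var 7) + 1 < ptc X 1 (σ.var 6)
  · simp [whenInside, seqs, eval, objVal_point, objVal_square, h0, h1, h2, h3, h4, h4.not_ge]
  · simp [whenInside, seqs, eval, objVal_point, objVal_square, h0, h1, h2, h3, h4, not_lt.1 h1,
      not_lt.1 h2, not_lt.1 h3, not_lt.1 h4]

theorem incidences_spec (h0 : σ.var 0 = n) (h1 : σ.var 1 = m) (hz : ∀ l, σ.mem 0 l = 0) (i j : ℕ) :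
    (incidences.eval X σ).mem 0 [i, j] ≠ 0 ↔ i < n ∧ j < m ∧ Inside X n i j := by
  classical
  have hrow := loop_inv (X := X) (a := loop 7 1 (whenInside (seqs [const 9 1, store 0 [6, 7] 9])))
    (x := 6) (y := 0) (σ := σ)
    (fun a υ => ∀ i j, υ.mem 0 [i, j] ≠ 0 ↔ i < a ∧ j < m ∧ Inside X n i j) (by simp [hz]) ?_
  · rw [h0] at hrow
    exact hrow i j
  · intro a ha υ hυ hI
    have hin := loop_inv (X := X) (a := whenInside (seqs [const 9 1, store 0 [6, 7] 9]))
      (x := 7) (y := 1) (σ := υ.set 6 a)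
      (fun b τ => ∀ i j, τ.mem 0 [i, j] ≠ 0 ↔
        (i < a ∧ j < m ∨ i = a ∧ j < b) ∧ Inside X n i j) (fun i j => by
          rw [St.set_mem, hI]
          tauto) ?_
    · rw [St.set_var, if_neg (by decide), hυ.var 1 (by decide), h1] at hin
      intro i j
      rw [hin]
      constructor
      · rintro ⟨h | h, h'⟩
        exacts [⟨by omega, h.2, h'⟩, ⟨by omega, h.2, h'⟩]
      · rintro ⟨h, h', h''⟩
        exact ⟨by omega, h''⟩
    · intro b hb τ hτ hJ i j
      have v0 : τ.var 0 = n := by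
        rw [hτ.var 0 (by decide), St.set_var, if_neg (by decide), hυ.var 0 (by decide), h0]
      have v6 : τ.var 6 = a := by
        rw [hτ.var 6 (by decide), St.set_var, if_pos rfl]
      rw [whenInside_eval (n := n) _ (by simp [v0])]
      simp only [St.set_var, show (6 : ℕ) ≠ 7 by decide, if_true, if_false, v6]
      split_ifs with hab
      · by_cases hij : i = a ∧ j = b
        · simp only [hij.1, hij.2]
          simp [seqs, eval, v6, hab]
        · have : (Com.eval X (seqs [const 9 1, store 0 [6, 7] 9]) ((τ.set 7 b).set 8 0)).mem 0 [i, j]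
              = τ.mem 0 [i, j] := by
            simp [seqs, eval, v6]
            tauto
          rw [this, hJ]
          refine and_congr_left fun _ => ?_
          omega
      · rw [St.set_mem, St.set_mem, hJ]
        refine and_congr_left fun hi => ?_
        have : ¬ (i = a ∧ j = b) := by
          rintro ⟨rfl, rfl⟩
          exact hab hi
        omega

theorem rankOf_spec (d x : ℕ) (hx : x ∈ [15, 16]) (h0 : σ.var 0 = n) (h1 : σ.var 1 = m) :
    ((rankOf d x).eval X σ).var x = rank X n m d (ptc X d (σ.var 6)) := by
  classical
  have hne : x ≠ 8 ∧ x ≠ 7 ∧ x ≠ 6 ∧ x ≠ 0 ∧ x ≠ 1 := by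
    revert x
    decide
  have := loop_inv (X := X) (a := seqs [rlt 8 d false 6 0 true 7, ite 8 skip (succ x x),
    rlt 8 d true 7 1 false 6, ite 8 (succ x x) skip]) (x := 7) (y := 1) (σ := σ.set x 0)
    (fun l υ => υ.var x = rank X n l d (ptc X d (σ.var 6))) (by simp [rank]) ?_
  · rw [St.set_var, if_neg hne.2.2.2.2.symm, h1] at this
    exact this
  · intro l _ υ hυ hI
    have v0 : υ.var 0 = n := by
      rw [hυ.var 0 (by simp [modv, seqs, hne.2.2.2.1.symm]), St.set_var,
        if_neg hne.2.2.2.1.symm, h0]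
    have v6 : υ.var 6 = σ.var 6 := by
      rw [hυ.var 6 (by simp [modv, seqs, hne.2.2.1.symm]), St.set_var, if_neg hne.2.2.1.symm]
    have h07 : (0 : ℕ) ≠ x := hne.2.2.2.1.symm
    have e1 : 6 ≠ x := hne.2.2.1.symm
    have e2 : 7 ≠ x := hne.2.1.symm
    simp only [rank, Finset.range_add_one, Finset.filter_insert]
    rw [rank] at hI
    by_cases c1 : ptc X d (σ.var 6) < sqc X n d l
    · have c2 : ¬ sqc X n d l + 1 < ptc X d (σ.var 6) := by linarith
      simp [seqs, eval, objVal_point, objVal_square, v0, v6, c1, c2, c1.not_ge, hne, hI]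
    · by_cases c2 : sqc X n d l + 1 < ptc X d (σ.var 6)
      · simp [seqs, eval, objVal_point, objVal_square, v0, v6, c1, c2, not_lt.1 c1, hne, hI, h07, e1,
          e2]
        omega
      · simp [seqs, eval, objVal_point, objVal_square, v0, v6, c1, c2, not_lt.1 c1, hne, hI, h07, e1,
          e2]
        omega

/-- A later point may overwrite the representative of its rank pair; only the ranks of the
representative matter, not its choice. -/
theorem table_spec (h0 : σ.var 0 = n) (h1 : σ.var 1 = m) (hz : ∀ l, σ.mem 1 l = 0) :
    (∀ x y, (table.eval X σ).mem 1 [x, y] ≠ 0 → (table.eval X σ).mem 2 [x, y] < n ∧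
      rank X n m 0 (ptc X 0 ((table.eval X σ).mem 2 [x, y])) = x ∧
      rank X n m 1 (ptc X 1 ((table.eval X σ).mem 2 [x, y])) = y) ∧
    ∀ i < n, (table.eval X σ).mem 1
      [rank X n m 0 (ptc X 0 i), rank X n m 1 (ptc X 1 i)] ≠ 0 := by
  have := loop_inv (X := X) (a := seqs [rankOf 0 15, rankOf 1 16, const 9 1, store 1 [15, 16] 9,
    store 2 [15, 16] 6]) (x := 6) (y := 0) (σ := σ)
    (fun a υ => (∀ x y, υ.mem 1 [x, y] ≠ 0 → υ.mem 2 [x, y] < a ∧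
      rank X n m 0 (ptc X 0 (υ.mem 2 [x, y])) = x ∧
      rank X n m 1 (ptc X 1 (υ.mem 2 [x, y])) = y) ∧
    ∀ i < a, υ.mem 1 [rank X n m 0 (ptc X 0 i), rank X n m 1 (ptc X 1 i)] ≠ 0) (by simp [hz]) ?_
  · rw [h0] at this
    exact this
  · rintro a - υ hυ ⟨hI1, hI2⟩
    have v0 : υ.var 0 = n := by rw [hυ.var 0 (by decide), h0]
    have v1 : υ.var 1 = m := by rw [hυ.var 1 (by decide), h1]
    set τ := (rankOf 0 15).eval X (υ.set 6 a) with hτ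
    set ω := (rankOf 1 16).eval X τ with hω
    have f1 : Frame (rankOf 0 15) (υ.set 6 a) τ := frame X _ _
    have f2 : Frame (rankOf 1 16) τ ω := frame X _ _
    have w15 : ω.var 15 = rank X n m 0 (ptc X 0 a) := by
      rw [f2.var 15 (by decide), hτ, rankOf_spec (n := n) (m := m) 0 15 (by simp) (by simp [v0])
        (by simp [v1])]
      simp
    have t6 : τ.var 6 = a := by rw [f1.var 6 (by decide)]; simp
    have w16 : ω.var 16 = rank X n m 1 (ptc X 1 a) := by
      rw [hω, rankOf_spec (n := n) (m := m) 1 16 (by simp), t6]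
      · rw [f1.var 0 (by decide)]; simp [v0]
      · rw [f1.var 1 (by decide)]; simp [v1]
    have w6 : ω.var 6 = a := by rw [f2.var 6 (by decide), t6]
    have hm : ω.mem = υ.mem := by
      funext k
      rw [f2.mem k (by simp [rankOf, seqs, modm]), f1.mem k (by simp [rankOf, seqs, modm])]
      rfl
    set r0 := rank X n m 0 (ptc X 0 a)
    set r1 := rank X n m 1 (ptc X 1 a)
    have he : (seqs [rankOf 0 15, rankOf 1 16, const 9 1, store 1 [15, 16] 9,
        store 2 [15, 16] 6]).eval X (υ.set 6 a) =
        (((ω.set 9 1).put 1 [r0, r1] 1).put 2 [r0, r1] a) := by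
      rw [show (seqs [rankOf 0 15, rankOf 1 16, const 9 1, store 1 [15, 16] 9,
        store 2 [15, 16] 6]).eval X (υ.set 6 a) = (store 2 [15, 16] 6).eval X
          ((store 1 [15, 16] 9).eval X ((const 9 1).eval X ω)) from rfl]
      simp [eval, w15, w16, w6]
    rw [he]
    refine ⟨fun x y => ?_, fun i hi => ?_⟩
    · simp only [St.put_mem, St.set_mem, hm]
      by_cases hxy : x = r0 ∧ y = r1
      · simp [hxy, r0, r1]
      · have := hI1 x y
        have hxy' : ¬ [x, y] = [r0, r1] := by simpa using hxy
        simp only [hxy', and_false, if_false]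
        intro h
        exact ⟨(this h).1.trans (Nat.lt_succ_self a), (this h).2⟩
    · simp only [St.put_mem, St.set_mem, hm]
      rcases Nat.lt_succ_iff_lt_or_eq.1 hi with hi | rfl
      · have := hI2 i hi
        simp only [show (1 : ℕ) ≠ 2 by decide, false_and, if_false]
        split_ifs
        · exact one_ne_zero
        · exact this
      · simp [r0, r1]

end Com

/-! ### Choosing the stabbing lines -/

/-- The lines `v 0, …, v (L - 1)` are chosen, the squares with property `A` are assigned to them by
`H`, and `G` counts the lines before points. -/
structure Stabbed (X : ℕ → ℝ) (n m d : ℕ) (A : ℕ → Prop) (H G : ℕ → ℕ) (L : ℕ) (v : ℕ → ℝ) :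
    Prop where
  gap : ∀ l < L, ∀ l' < l, v l' + 1 < v l
  mem : ∀ j < m, A j → H j < L ∧ sqc X n d j ≤ v (H j) ∧ v (H j) ≤ sqc X n d j + 1
  free : ∀ j < m, ¬ A j → ∀ l < L, v l < sqc X n d j
  point : ∀ i < n, G i ≤ L ∧ ∀ l < L, v l ≤ ptc X d i ↔ l < G i

/-- The new line is the right end of the leftmost unstabbed square `c`. Earlier lines lie left of
`c`, hence more than 1 before the new line. An unstabbed square starts no earlier than `c`, so it
contains the line if it starts at or before it, and otherwise lies entirely behind it. -/
theorem Stabbed.step {X : ℕ → ℝ} {n m d : ℕ} {A A' : ℕ → Prop} {H H' G G' : ℕ → ℕ} {L : ℕ}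
    {v : ℕ → ℝ} (h : Stabbed X n m d A H G L v) {c : ℕ} (hc : c < m) (hcA : ¬ A c)
    (hmin : ∀ j < m, ¬ A j → sqc X n d c ≤ sqc X n d j)
    (hA' : ∀ j < m, A' j ↔ A j ∨ sqc X n d j ≤ sqc X n d c + 1)
    (hH : ∀ j < m, A j → H' j = H j) (hH' : ∀ j < m, ¬ A j → A' j → H' j = L)
    (hG : ∀ i < n, ptc X d i < sqc X n d c + 1 → G' i = G i)
    (hG' : ∀ i < n, sqc X n d c + 1 ≤ ptc X d i → G' i = L + 1) :
    Stabbed X n m d A' H' G' (L + 1) (Function.update v L (sqc X n d c + 1)) := by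
  have hv : ∀ l < L, Function.update v L (sqc X n d c + 1) l = v l :=
    fun l hl => Function.update_of_ne hl.ne _ _
  have hL : Function.update v L (sqc X n d c + 1) L = sqc X n d c + 1 := Function.update_self _ _ _
  refine ⟨fun l hl l' hl' => ?_, fun j hj hA => ?_, fun j hj hA l hl => ?_, fun i hi => ?_⟩
  · rw [hv l' (by omega)]
    rcases Nat.lt_succ_iff_lt_or_eq.1 hl with hl | rfl
    · rw [hv l hl]
      exact h.gap l hl l' hl'
    · rw [hL]
      linarith [h.free c hc hcA l' hl']
  · by_cases hj' : A j
    · obtain ⟨h1, h2⟩ := h.mem j hj hj'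
      rw [hH j hj hj', hv _ h1]
      exact ⟨by omega, h2⟩
    · rw [hH' j hj hj' hA, hL]
      have := ((hA' j hj).1 hA).resolve_left hj'
      exact ⟨by omega, this, by linarith [hmin j hj hj']⟩
  · rw [hA' j hj, not_or, not_le] at hA
    rcases Nat.lt_succ_iff_lt_or_eq.1 hl with hl | rfl
    · rw [hv l hl]
      exact h.free j hj hA.1 l hl
    · rw [hL]
      exact hA.2
  · obtain ⟨h1, h2⟩ := h.point i hi
    rcases lt_or_ge (ptc X d i) (sqc X n d c + 1) with hlt | hge
    · rw [hG i hi hlt]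
      refine ⟨by omega, fun l hl => ?_⟩
      rcases Nat.lt_succ_iff_lt_or_eq.1 hl with hl | rfl
      · rw [hv l hl]
        exact h2 l hl
      · rw [hL]
        exact iff_of_false (not_le.2 hlt) (by omega)
    · rw [hG' i hi hge]
      refine ⟨le_rfl, fun l hl => iff_of_true ?_ hl⟩
      rcases Nat.lt_succ_iff_lt_or_eq.1 hl with hl | rfl
      · rw [hv l hl]
        linarith [h.free c hc hcA l hl]
      · rwa [hL]

theorem exists_abs_le (f : ℕ → ℝ) (n : ℕ) : ∃ B : ℝ, 0 ≤ B ∧ ∀ i < n, |f i| ≤ B := by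
  refine ⟨∑ i ∈ Finset.range n, |f i|, Finset.sum_nonneg fun _ _ => abs_nonneg _, fun i hi => ?_⟩
  exact Finset.single_le_sum (f := fun i => |f i|) (fun _ _ => abs_nonneg _)
    (Finset.mem_range.2 hi)

/-- An interval of length 1 cannot contain two lines more than 1 apart. The finite list is extended
by a line before everything and by lines behind everything, so outer cells need no special
treatment; this shifts indices, `w (l + 1)` being `v l`. -/
theorem Stabbed.exists_lines {X : ℕ → ℝ} {n m d : ℕ} {A : ℕ → Prop} {H G : ℕ → ℕ} {L : ℕ}
    {v : ℕ → ℝ} (h : Stabbed X n m d A H G L v) (hA : ∀ j < m, A j) :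
    ∃ w, Lines X n m d H G w := by
  obtain ⟨B₁, hB₁, h1⟩ := exists_abs_le (sqc X n d) m
  obtain ⟨B₂, hB₂, h2⟩ := exists_abs_le (ptc X d) n
  obtain ⟨B₃, hB₃, h3⟩ := exists_abs_le v L
  simp only [abs_le] at h1 h2 h3
  set B := B₁ + B₂ + B₃ with hB
  let u : ℕ → ℝ := fun l => if l < L then v l else B + 2 + l
  have hu : ∀ l < L, u l = v l := fun l hl => if_pos hl
  have hu' : ∀ l, ¬ l < L → u l = B + 2 + l := fun l hl => if_neg hl
  let w : ℕ → ℝ := fun l => Nat.casesOn l (-B - 1) u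
  have hw0 : w 0 = -B - 1 := rfl
  have hws : ∀ l, w (l + 1) = u l := fun l => rfl
  refine ⟨w, strictMono_nat_of_lt_succ fun l => ?_, fun j hj => ?_, fun j hj => ?_, fun j hj => ?_,
    fun j hj => ?_, fun i hi => ?_⟩
  · rw [hws]
    cases l with
    | zero =>
      rw [hw0]
      by_cases hl : 0 < L
      · rw [hu 0 hl]
        linarith [h3 0 hl]
      · rw [hu' 0 hl]
        push_cast
        linarith
    | succ l =>
      rw [hws]
      by_cases hl : l + 1 < L
      · rw [hu _ hl, hu l (by omega)]
        linarith [h.gap (l + 1) hl l (by omega)]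
      · rw [hu' _ hl]
        push_cast
        have : (0 : ℝ) ≤ l := Nat.cast_nonneg l
        by_cases hl' : l < L
        · rw [hu l hl']
          linarith [h3 l hl']
        · rw [hu' l hl']
          linarith
  · obtain ⟨g1, g2, g3⟩ := h.mem j hj (hA j hj)
    rcases Nat.eq_zero_or_eq_succ_pred (H j) with h0 | h0
    · rw [h0, hw0]
      linarith [h1 j hj]
    · rw [h0, hws, hu _ (by omega)]
      linarith [h.gap (H j) g1 (H j).pred (by omega)]
  · obtain ⟨g1, g2, g3⟩ := h.mem j hj (hA j hj)
    rw [hws, hu _ g1]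
    exact g2
  · obtain ⟨g1, g2, g3⟩ := h.mem j hj (hA j hj)
    rw [hws, hu _ g1]
    exact g3
  · obtain ⟨g1, g2, g3⟩ := h.mem j hj (hA j hj)
    rw [show H j + 2 = (H j + 1) + 1 from rfl, hws]
    by_cases hl : H j + 1 < L
    · rw [hu _ hl]
      linarith [h.gap _ hl (H j) (by omega)]
    · rw [hu' _ hl]
      push_cast
      have : (0 : ℝ) ≤ H j := Nat.cast_nonneg _
      linarith [h1 j hj]
  · obtain ⟨g1, g2⟩ := h.point i hi
    refine ⟨?_, ?_⟩
    · rcases Nat.eq_zero_or_eq_succ_pred (G i) with h0 | h0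
      · rw [h0, hw0]
        linarith [h2 i hi]
      · rw [h0, hws, hu _ (by omega), g2 _ (by omega)]
        omega
    · rw [hws]
      by_cases hl : G i < L
      · rw [hu _ hl, ← not_le, g2 _ hl]
        omega
      · rw [hu' _ hl]
        have : (0 : ℝ) ≤ G i := Nat.cast_nonneg _
        linarith [h2 i hi]

/-! ### Correctness of the greedy choice of lines -/

namespace Com

variable {X : ℕ → ℝ} {n m : ℕ} {σ : St}

/-- The number `m` in variable 10 is the sentinel for no unstabbed square. -/
theorem leftmost_spec (d : ℕ) (h0 : σ.var 0 = n) (h1 : σ.var 1 = m) :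
    ((leftmost d).eval X σ).var 10 = m ∧ (∀ j < m, σ.mem (3 + d) [j] ≠ 0) ∨
    ((leftmost d).eval X σ).var 10 < m ∧ σ.mem (3 + d) [((leftmost d).eval X σ).var 10] = 0 ∧
      ∀ j < m, σ.mem (3 + d) [j] = 0 → sqc X n d (((leftmost d).eval X σ).var 10) ≤ sqc X n d j := by
  have := loop_inv (X := X) (a := seqs [load 8 (3 + d) [7], ite 8 skip (seqs [eq 9 10 1,
    ite 9 (copy 10 7) (seqs [rlt 8 d true 7 0 true 10, ite 8 (copy 10 7) skip])])]) (x := 7) (y := 1)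
    (σ := σ.set 10 m)
    (fun l υ => υ.var 10 = m ∧ (∀ j < l, σ.mem (3 + d) [j] ≠ 0) ∨
      υ.var 10 < l ∧ σ.mem (3 + d) [υ.var 10] = 0 ∧
      ∀ j < l, σ.mem (3 + d) [j] = 0 → sqc X n d (υ.var 10) ≤ sqc X n d j) (by simp) ?_
  · rw [St.set_var, if_neg (by decide), h1] at this
    have he : (leftmost d).eval X σ = (loop 7 1 (seqs [load 8 (3 + d) [7], ite 8 skip
      (seqs [eq 9 10 1, ite 9 (copy 10 7) (seqs [rlt 8 d true 7 0 true 10,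
      ite 8 (copy 10 7) skip])])])).eval X (σ.set 10 m) := by
      rw [← h1]
      rfl
    rw [he]
    exact this
  · intro l hl υ hυ hI
    rw [St.set_var, if_neg (by decide), h1] at hl
    have v0 : υ.var 0 = n := by rw [hυ.var 0 (by simp [modv, seqs])]; simp [h0]
    have v1 : υ.var 1 = m := by rw [hυ.var 1 (by simp [modv, seqs])]; simp [h1]
    have hm : υ.mem = σ.mem := by
      funext k
      rw [hυ.mem k (by simp [modm, seqs])]
      rfl
    by_cases hl0 : σ.mem (3 + d) [l] = 0
    swap
    · have hv : ((seqs [load 8 (3 + d) [7], ite 8 skip (seqs [eq 9 10 1, ite 9 (copy 10 7)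
          (seqs [rlt 8 d true 7 0 true 10, ite 8 (copy 10 7) skip])])]).eval X (υ.set 7 l)).var 10 =
          υ.var 10 := by
        simp [seqs, eval, hm, hl0]
      rw [hv]
      rcases hI with ⟨hI1, hI2⟩ | ⟨hI1, hI2, hI3⟩
      · refine .inl ⟨hI1, fun j hj => ?_⟩
        rcases Nat.lt_succ_iff_lt_or_eq.1 hj with hj | rfl
        exacts [hI2 j hj, hl0]
      · refine .inr ⟨by omega, hI2, fun j hj hj0 => ?_⟩
        rcases Nat.lt_succ_iff_lt_or_eq.1 hj with hj | rfl
        exacts [hI3 j hj hj0, (hl0 hj0).elim]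
    rcases hI with ⟨hI1, hI2⟩ | ⟨hI1, hI2, hI3⟩
    · have hv : ((seqs [load 8 (3 + d) [7], ite 8 skip (seqs [eq 9 10 1, ite 9 (copy 10 7)
          (seqs [rlt 8 d true 7 0 true 10, ite 8 (copy 10 7) skip])])]).eval X (υ.set 7 l)).var 10 =
          l := by
        simp [seqs, eval, hm, hl0, hI1, v1]
      rw [hv]
      refine .inr ⟨by omega, hl0, fun j hj hj0 => ?_⟩
      rcases Nat.lt_succ_iff_lt_or_eq.1 hj with hj | rfl
      exacts [(hI2 j hj hj0).elim, le_rfl]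
    · have hne : υ.var 10 ≠ m := by omega
      have hv : ((seqs [load 8 (3 + d) [7], ite 8 skip (seqs [eq 9 10 1, ite 9 (copy 10 7)
          (seqs [rlt 8 d true 7 0 true 10, ite 8 (copy 10 7) skip])])]).eval X (υ.set 7 l)).var 10 =
          if sqc X n d l < sqc X n d (υ.var 10) then l else υ.var 10 := by
        by_cases hlt : sqc X n d l < sqc X n d (υ.var 10)
        · simp [seqs, eval, hm, hl0, v1, hne, objVal_square, v0, hlt]
        · simp [seqs, eval, hm, hl0, v1, hne, objVal_square, v0, hlt]
      rw [hv]
      split_ifs with hlt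
      · refine .inr ⟨by omega, hl0, fun j hj hj0 => ?_⟩
        rcases Nat.lt_succ_iff_lt_or_eq.1 hj with hj | rfl
        exacts [hlt.le.trans (hI3 j hj hj0), le_rfl]
      · refine .inr ⟨by omega, hI2, fun j hj hj0 => ?_⟩
        rcases Nat.lt_succ_iff_lt_or_eq.1 hj with hj | rfl
        exacts [hI3 j hj hj0, not_lt.1 hlt]

theorem stab_spec (d : ℕ) (h0 : σ.var 0 = n) (h1 : σ.var 1 = m) (j : ℕ) (hj : j < m) :
    (((stab d).eval X σ).mem (3 + d) [j] ≠ 0 ↔ σ.mem (3 + d) [j] ≠ 0 ∨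
      sqc X n d j ≤ sqc X n d (σ.var 10) + 1) ∧
    ((stab d).eval X σ).mem (5 + d) [j] = if σ.mem (3 + d) [j] = 0 ∧
      sqc X n d j ≤ sqc X n d (σ.var 10) + 1 then σ.var 11 else σ.mem (5 + d) [j] := by
  have hv : ∀ z, z ≠ 7 → z ≠ 8 → z ≠ 12 → (stab d).modv z = false := by
    intro z h1 h2 h3
    simp [stab, modv, seqs, h1, h2, h3]
  have hl := loop_inv (X := X) (a := seqs [load 8 (3 + d) [7], ite 8 skip (seqs
    [rlt 8 d true 10 1 true 7, ite 8 skip (seqs [store (3 + d) [7] 12, store (5 + d) [7] 11])])])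
    (x := 7) (y := 1) (σ := σ.set 12 1)
    (fun l υ => υ.var 12 = 1 ∧ (∀ j, l ≤ j → υ.mem (3 + d) [j] = σ.mem (3 + d) [j] ∧
        υ.mem (5 + d) [j] = σ.mem (5 + d) [j]) ∧
      ∀ j < l, (υ.mem (3 + d) [j] ≠ 0 ↔ σ.mem (3 + d) [j] ≠ 0 ∨
        sqc X n d j ≤ sqc X n d (σ.var 10) + 1) ∧
      υ.mem (5 + d) [j] = if σ.mem (3 + d) [j] = 0 ∧
      sqc X n d j ≤ sqc X n d (σ.var 10) + 1 then σ.var 11 else σ.mem (5 + d) [j]) (by simp) ?_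
  · rw [St.set_var, if_neg (by decide), h1] at hl
    exact hl.2.2 j hj
  · rintro l hl υ hυ ⟨hI0, hI1, hI2⟩
    have v0 : υ.var 0 = n := by rw [hυ.var 0 (by simp [modv, seqs])]; simp [h0]
    have v10 : υ.var 10 = σ.var 10 := by rw [hυ.var 10 (by simp [modv, seqs])]; simp
    have v11 : υ.var 11 = σ.var 11 := by rw [hυ.var 11 (by simp [modv, seqs])]; simp
    have hd : 3 + d ≠ 5 + d := by omega
    obtain ⟨e1, e2⟩ := hI1 l le_rfl
    by_cases c1 : σ.mem (3 + d) [l] = 0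
    swap
    · have he : (seqs [load 8 (3 + d) [7], ite 8 skip (seqs [rlt 8 d true 10 1 true 7, ite 8 skip
          (seqs [store (3 + d) [7] 12, store (5 + d) [7] 11])])]).eval X (υ.set 7 l) =
          (υ.set 7 l).set 8 (υ.mem (3 + d) [l]) := by
        simp [seqs, eval, e1, c1]
      rw [he]
      refine ⟨by simp [hI0], fun j hj => hI1 j (by omega), fun j hj => ?_⟩
      rcases Nat.lt_succ_iff_lt_or_eq.1 hj with hj | rfl
      · exact hI2 j hj
      · simp [e1, e2, c1]
    by_cases c2 : sqc X n d (σ.var 10) + 1 < sqc X n d l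
    · have he : (seqs [load 8 (3 + d) [7], ite 8 skip (seqs [rlt 8 d true 10 1 true 7, ite 8 skip
          (seqs [store (3 + d) [7] 12, store (5 + d) [7] 11])])]).eval X (υ.set 7 l) =
          (υ.set 7 l).set 8 1 := by
        simp [seqs, eval, e1, c1, objVal_square, v0, v10, c2]
      rw [he]
      refine ⟨by simp [hI0], fun j hj => hI1 j (by omega), fun j hj => ?_⟩
      rcases Nat.lt_succ_iff_lt_or_eq.1 hj with hj | rfl
      · exact hI2 j hj
      · simp [e1, e2, c1, c2]
    · have he : (seqs [load 8 (3 + d) [7], ite 8 skip (seqs [rlt 8 d true 10 1 true 7, ite 8 skip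
          (seqs [store (3 + d) [7] 12, store (5 + d) [7] 11])])]).eval X (υ.set 7 l) =
          (((υ.set 7 l).set 8 0).put (3 + d) [l] 1).put (5 + d) [l] (σ.var 11) := by
        simp [seqs, eval, e1, c1, objVal_square, v0, v10, c2, hI0, v11]
      rw [he]
      refine ⟨by simp [hI0], fun j hj => ?_, fun j hj => ?_⟩
      · have hne : j ≠ l := by omega
        simpa [hne] using hI1 j (by omega)
      rcases Nat.lt_succ_iff_lt_or_eq.1 hj with hj | rfl
      · have hne : j ≠ l := by omega
        simpa [hne] using hI2 j hj
      · simp [c1, not_lt.1 c2]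

theorem pass_spec (d : ℕ) (h0 : σ.var 0 = n) (i : ℕ) (hi : i < n) :
    ((pass d).eval X σ).mem (7 + d) [i] = if ptc X d i < sqc X n d (σ.var 10) + 1 then
      σ.mem (7 + d) [i] else σ.var 11 + 1 := by
  have hl := loop_inv (X := X) (a := seqs [rlt 8 d false 6 (-1) true 10,
    ite 8 skip (store (7 + d) [6] 12)]) (x := 6) (y := 0) (σ := σ.set 12 (σ.var 11 + 1))
    (fun l υ => υ.var 12 = σ.var 11 + 1 ∧
      (∀ i, l ≤ i → υ.mem (7 + d) [i] = σ.mem (7 + d) [i]) ∧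
      ∀ i < l, υ.mem (7 + d) [i] = if ptc X d i < sqc X n d (σ.var 10) + 1 then
        σ.mem (7 + d) [i] else σ.var 11 + 1) (by simp) ?_
  · rw [St.set_var, if_neg (by decide), h0] at hl
    exact hl.2.2 i hi
  · rintro l hl υ hυ ⟨hI0, hI1, hI2⟩
    have v0 : υ.var 0 = n := by rw [hυ.var 0 (by simp [modv, seqs])]; simp [h0]
    have v10 : υ.var 10 = σ.var 10 := by rw [hυ.var 10 (by simp [modv, seqs])]; simp
    have e1 := hI1 l le_rfl
    -- The command adds its constant to the first operand, so the right end of the square is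
    -- expressed by shifting the point back.
    have e2 : ptc X d l + -1 < sqc X n d (σ.var 10) ↔ ptc X d l < sqc X n d (σ.var 10) + 1 :=
      ⟨fun h => by linarith, fun h => by linarith⟩
    by_cases c : ptc X d l < sqc X n d (σ.var 10) + 1
    · have he : (seqs [rlt 8 d false 6 (-1) true 10, ite 8 skip (store (7 + d) [6] 12)]).eval X
          (υ.set 6 l) = (υ.set 6 l).set 8 1 := by
        simp [seqs, eval, objVal_square, objVal_point, v0, v10, e2, c]
      rw [he]
      refine ⟨by simp [hI0], fun j hj => hI1 j (by omega), fun j hj => ?_⟩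
      rcases Nat.lt_succ_iff_lt_or_eq.1 hj with hj | rfl
      · exact hI2 j hj
      · simp [e1, c]
    · have he : (seqs [rlt 8 d false 6 (-1) true 10, ite 8 skip (store (7 + d) [6] 12)]).eval X
          (υ.set 6 l) = ((υ.set 6 l).set 8 0).put (7 + d) [l] (σ.var 11 + 1) := by
        simp [seqs, eval, objVal_square, objVal_point, v0, v10, e2, c, hI0]
      rw [he]
      refine ⟨by simp [hI0], fun j hj => ?_, fun j hj => ?_⟩
      · have hne : j ≠ l := by omega
        simpa [hne] using hI1 j (by omega)
      rcases Nat.lt_succ_iff_lt_or_eq.1 hj with hj | rfl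
      · have hne : j ≠ l := by omega
        simpa [hne] using hI2 j hj
      · simp [c]

-- Every round that finds an unstabbed square stabs at least that one, so `m` rounds suffice. Until
-- all are stabbed, the number of lines equals the number of the round, which is why variable 11 can
-- serve as the number of the new line.
open Classical in
theorem lines_spec (d : ℕ) (h0 : σ.var 0 = n) (h1 : σ.var 1 = m)
    (hA : ∀ l, σ.mem (3 + d) l = 0) (hG : ∀ l, σ.mem (7 + d) l = 0) :
    ∃ w, Lines X n m d (fun j => ((lines d).eval X σ).mem (5 + d) [j])
      (fun i => ((lines d).eval X σ).mem (7 + d) [i]) w := by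
  have hloop := loop_inv (X := X) (a := seqs [leftmost d, eq 9 10 1,
    ite 9 skip (seqs [stab d, pass d])]) (x := 11) (y := 1) (σ := σ)
    (fun r υ => ∃ L v, Stabbed X n m d (fun j => υ.mem (3 + d) [j] ≠ 0)
      (fun j => υ.mem (5 + d) [j]) (fun i => υ.mem (7 + d) [i]) L v ∧
      ((∀ j < m, υ.mem (3 + d) [j] ≠ 0) ∨ L = r ∧
        r ≤ ((Finset.range m).filter fun j => υ.mem (3 + d) [j] ≠ 0).card))
    ⟨0, fun _ => 0, ⟨by simp, fun j _ h => (h (hA _)).elim, by simp, by simp [hG]⟩, .inr (by simp)⟩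
    ?_
  · rw [h1] at hloop
    obtain ⟨L, v, h2, h3⟩ := hloop
    refine h2.exists_lines ?_
    rcases h3 with h3 | ⟨-, h3⟩
    · exact h3
    · have h4 : (Finset.range m).filter (fun j => ((lines d).eval X σ).mem (3 + d) [j] ≠ 0) =
          Finset.range m :=
        Finset.eq_of_subset_of_card_le (Finset.filter_subset _ _) (by rw [Finset.card_range]; exact h3)
      intro j hj
      have := Finset.mem_range.2 hj
      rw [← h4] at this
      exact (Finset.mem_filter.1 this).2
  · rintro r hr υ hυ ⟨L, v, hS, hor⟩
    have hm3 : ∀ k, (leftmost d).modm k = false := by intro k; simp [leftmost, modm, seqs]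
    have v0 : υ.var 0 = n := by
      rw [hυ.var 0 (by simp [modv, seqs, leftmost, stab, pass]), h0]
    have v1 : υ.var 1 = m := by
      rw [hυ.var 1 (by simp [modv, seqs, leftmost, stab, pass]), h1]
    set τ := (leftmost d).eval X (υ.set 11 r) with hτ
    have fτ : Frame (leftmost d) (υ.set 11 r) τ := frame X _ _
    have tm : τ.mem = υ.mem := by
      funext k
      exact fτ.mem k (hm3 k)
    have t0 : τ.var 0 = n := by rw [fτ.var 0 (by simp [leftmost, modv, seqs])]; simp [v0]
    have t1 : τ.var 1 = m := by rw [fτ.var 1 (by simp [leftmost, modv, seqs])]; simp [v1]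
    have t11 : τ.var 11 = r := by rw [fτ.var 11 (by simp [leftmost, modv, seqs])]; simp
    have hl := leftmost_spec (X := X) (σ := υ.set 11 r) (n := n) (m := m) d (by simp [v0])
      (by simp [v1])
    rw [← hτ] at hl
    simp only [St.set_mem] at hl
    have he : (seqs [leftmost d, eq 9 10 1, ite 9 skip (seqs [stab d, pass d])]).eval X
        (υ.set 11 r) = (ite 9 skip (seqs [stab d, pass d])).eval X
          (τ.set 9 (if τ.var 10 = τ.var 1 then 1 else 0)) := rfl
    rw [he, t1]
    rcases hl with ⟨hl1, hl2⟩ | ⟨hl1, hl2, hl3⟩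
    · rw [if_pos hl1]
      simp only [eval, St.set_var, if_true, ne_eq, one_ne_zero, not_false_eq_true, St.set_mem, tm]
      exact ⟨L, v, hS, .inl hl2⟩
    · rw [if_neg (by omega)]
      obtain ⟨rfl, hcard⟩ := hor.resolve_left fun h => h _ hl1 hl2
      set c := τ.var 10 with hc
      set ω := τ.set 9 0 with hω
      set ψ := (stab d).eval X ω with hψ
      have he' : (ite 9 skip (seqs [stab d, pass d])).eval X ω = (pass d).eval X ψ := by
        simp [eval, hω, seqs, hψ]
      rw [he']
      have wv : ∀ z, z ≠ 9 → ω.var z = τ.var z := fun z hz => by simp [hω, hz]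
      have fψ : Frame (stab d) ω ψ := frame X _ _
      have fp : Frame (pass d) ψ ((pass d).eval X ψ) := frame X _ _
      have p0 : ψ.var 0 = n := by
        rw [fψ.var 0 (by simp [stab, modv, seqs]), wv 0 (by decide), t0]
      have p10 : ψ.var 10 = c := by
        rw [fψ.var 10 (by simp [stab, modv, seqs]), wv 10 (by decide)]
      have p11 : ψ.var 11 = L := by
        rw [fψ.var 11 (by simp [stab, modv, seqs]), wv 11 (by decide), t11]
      have m3 : ((pass d).eval X ψ).mem (3 + d) = ψ.mem (3 + d) :=
        fp.mem _ (by simp [pass, modm, seqs])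
      have m5 : ((pass d).eval X ψ).mem (5 + d) = ψ.mem (5 + d) :=
        fp.mem _ (by simp [pass, modm, seqs])
      have m7 : ψ.mem (7 + d) = υ.mem (7 + d) := by
        rw [fψ.mem (7 + d) (by simp [stab, modm, seqs]), hω, St.set_mem, tm]
      have hstab := stab_spec (X := X) (σ := ω) (n := n) (m := m) d (by rw [wv 0 (by decide), t0])
        (by rw [wv 1 (by decide), t1])
      rw [← hψ, wv 10 (by decide), wv 11 (by decide), t11, ← hc, hω, St.set_mem, tm] at hstab
      have hpass := pass_spec (X := X) (σ := ψ) (n := n) d p0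
      rw [p10, p11, m7] at hpass
      rw [m3, m5]
      refine ⟨L + 1, _, hS.step (c := c) hl1 (by simpa using hl2)
        (fun j hj hA => hl3 j hj (by simpa using hA)) (fun j hj => (hstab j hj).1) ?_ ?_ ?_ ?_,
        .inr ⟨rfl, ?_⟩⟩
      · intro j hj hA
        rw [(hstab j hj).2, if_neg fun h => hA h.1]
      · intro j hj hA hA'
        rw [(hstab j hj).2, if_pos ⟨by simpa using hA, ((hstab j hj).1.1 hA').resolve_left hA⟩]
      · intro i hi hlt
        rw [hpass i hi, if_pos hlt]
      · intro i hi hlt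
        rw [hpass i hi, if_neg (not_lt.2 hlt)]
      · refine Nat.succ_le_of_lt (hcard.trans_lt (Finset.card_lt_card ⟨fun j => ?_, fun hsub => ?_⟩))
        · simp only [Finset.mem_filter, Finset.mem_range]
          exact fun hj => ⟨hj.1, (hstab j hj.1).1.2 (.inl hj.2)⟩
        · have hcm := hsub (x := c) (by
            simp only [Finset.mem_filter, Finset.mem_range]
            exact ⟨hl1, (hstab c hl1).1.2 (.inr (by linarith))⟩)
          exact (Finset.mem_filter.1 hcm).2 hl2

end Com

namespace Com

variable {X : ℕ → ℝ} {n m k : ℕ} {σ : St}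

/-! ### Running time -/

/-- One loop with bound `β ≥ 1` adds at most `4 + 5 * β ≤ 9 * β` to `β` times the cost of its body.
-/
theorem nest_bound (β : ℕ → ℕ) (a : Com) (L : List (ℕ × ℕ)) (h : ∀ p ∈ L, 1 ≤ β p.2) :
    (nest L a).bound β ≤ (L.map fun p => β p.2).prod * (a.bound β + 9 * L.length) := by
  induction L with
  | nil => simp [nest]
  | cons p L ih =>
    simp only [List.mem_cons, forall_eq_or_imp] at h
    have h1 := ih h.2
    have h2 : 1 ≤ (L.map fun p => β p.2).prod := by
      refine Nat.one_le_iff_ne_zero.2 (List.prod_ne_zero fun h0 => ?_)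
      obtain ⟨q, hq, hq0⟩ := List.mem_map.1 h0
      have := h.2 q hq
      omega
    simp only [nest, bound, List.map_cons, List.prod_cons, List.length_cons]
    generalize (L.map fun p => β p.2).prod = N at *
    have h3 := h.1
    calc 4 + β p.2 * (5 + (nest L a).bound β)
        ≤ β p.2 * (9 + N * (a.bound β + 9 * L.length)) := by nlinarith
      _ ≤ β p.2 * (N * (a.bound β + 9 * (L.length + 1))) := by
          refine Nat.mul_le_mul_left _ ?_
          nlinarith
      _ = _ := by ring

/-- The bounds of the loops in a feasibility test. -/
def testBounds (m k z : ℕ) : ℕ :=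
  if z = 1 then m else if z = 2 then m + 1 else if z = 3 then 2 * m + 1 else k + 1

theorem nest_stateLoops_bound (m k : ℕ) (a : Com) : (nest stateLoops a).bound (testBounds m k) ≤
    (k + 1) ^ 4 * (m + 1) ^ 4 * (a.bound (testBounds m k) + 72) := by
  refine (nest_bound _ a stateLoops ?_).trans (le_of_eq ?_)
  · simp [stateLoops, testBounds]
  · simp [stateLoops, testBounds]
    ring

/-- There are `(k + 1) ^ 4 * (m + 1) ^ 4` states. For each of the `2 * m + 1` columns they are
visited a constant number of times, with work linear in `m` per state for trying squares or checking
points. -/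
theorem testCost_le (m k : ℕ) : testCost m k ≤ 10000 * (k + 1) ^ 4 * (m + 1) ^ 6 := by
  change feasible.bound (testBounds m k) ≤ _
  set N := (k + 1) ^ 4 * (m + 1) ^ 4 with hN
  have hN1 : 1 ≤ N := Nat.one_le_iff_ne_zero.2 (by positivity)
  have i1 : initStates.bound (testBounds m k) ≤ 200 * N := by
    have := nest_stateLoops_bound m k (store 10 stateVars 9)
    simp only [initStates, seqs, bound] at this ⊢
    simp only [stateVars, List.length_cons, List.length_nil] at this ⊢
    rw [← hN] at this
    omega
  have i2 : findState.bound (testBounds m k) ≤ 200 * N := by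
    have := nest_stateLoops_bound m k (seqs [load 8 10 stateVars, ite 8 (const 17 1) skip])
    simp only [findState, seqs, bound] at this ⊢
    simp only [stateVars, List.length_cons, List.length_nil] at this ⊢
    rw [← hN] at this
    omega
  have i3 : ∀ g < 4, (switchAll g).bound (testBounds m k) ≤ N * (200 * (m + 1)) := by
    intro g hg
    refine (nest_stateLoops_bound m k _).trans ?_
    rw [← hN]
    refine Nat.mul_le_mul_left _ ?_
    interval_cases g <;>
      simp [seqs, bound, switch, whenLine, stateVars, testBounds] <;> omega
  have i4 : checkAll.bound (testBounds m k) ≤ N * (300 * (m + 1)) := by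
    refine (nest_stateLoops_bound m k _).trans ?_
    rw [← hN]
    refine Nat.mul_le_mul_left _ ?_
    simp [seqs, bound, checkPoint, stateVars, testBounds]
    omega
  have i5 : column.bound (testBounds m k) ≤ N * (1100 * (m + 1)) := by
    have g0 := i3 0 (by omega)
    have g1 := i3 1 (by omega)
    have g2 := i3 2 (by omega)
    have g3 := i3 3 (by omega)
    simp only [column, seqs, bound]
    linarith
  have h3 : testBounds m k 3 = 2 * m + 1 := by simp [testBounds]
  have : feasible.bound (testBounds m k) ≤ 400 * N + 4 + (2 * m + 1) * (5 + N * (1100 * (m + 1))) := by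
    simp only [feasible, seqs, bound, h3]
    have := Nat.mul_le_mul_left (2 * m + 1) (Nat.add_le_add_left i5 5)
    linarith
  refine this.trans ?_
  have e : 10000 * (k + 1) ^ 4 * (m + 1) ^ 6 = N * (10000 * (m + 1) ^ 2) := by
    rw [hN]
    ring
  rw [e]
  calc 400 * N + 4 + (2 * m + 1) * (5 + N * (1100 * (m + 1)))
      ≤ 400 * N + 4 * N + (2 * m + 1) * (5 * N + N * (1100 * (m + 1))) := by gcongr <;> omega
    _ = N * (404 + (2 * m + 1) * (5 + 1100 * (m + 1))) := by ring
    _ ≤ N * (10000 * (m + 1) ^ 2) := Nat.mul_le_mul_left _ (by nlinarith)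

/-- The computation before the cells are processed. -/
def prep : Com := seqs [setup, incidences, table, lines 0, lines 1]

theorem prep_cost (h0 : σ.var 0 = n) (h1 : σ.var 1 = m) (hn : 1 ≤ n) (hm : 1 ≤ m) :
    prep.cost X σ ≤ 1000 * (m * n + m * m) := by
  have h := cost_le_bound (X := X) (β := fun z => if z = 0 then n else m) prep (σ := σ) (by
    have hb : ∀ y ∈ prep.loopBounds, (y = 0 ∨ y = 1) ∧ prep.modv y = false := by decide
    intro y hy
    refine ⟨(hb y hy).2, ?_⟩
    rcases (hb y hy).1 with rfl | rfl <;> simp [h0, h1])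
  refine h.trans ?_
  simp [prep, seqs, bound, setup, incidences, whenInside, table, rankOf, lines, leftmost, stab, pass]
  have : 1 ≤ m * n := Nat.mul_pos hm hn
  nlinarith

/-- Four cell visits per square with `2 * m` tests each multiply the cost of a test by about `8 * m
^ 2`. The estimates `k + 1 ≤ 2 * k` and `m + 1 ≤ 2 * m` give the constant. -/
theorem cells_cost_le (hm : 1 ≤ m) (hk : 1 ≤ k) :
    4 + m * (25 + 4 * cellCost m k) ≤ 90000000 * (m ^ 8 * k ^ 4) := by
  have h1 := testCost_le m k
  have h2 : (k + 1) ^ 4 ≤ (2 * k) ^ 4 := Nat.pow_le_pow_left (by omega) _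
  have h3 : (m + 1) ^ 6 ≤ (2 * m) ^ 6 := Nat.pow_le_pow_left (by omega) _
  have h4 : testCost m k ≤ 10240000 * (m ^ 6 * k ^ 4) :=
    calc testCost m k ≤ 10000 * (k + 1) ^ 4 * (m + 1) ^ 6 := h1
      _ ≤ 10000 * (2 * k) ^ 4 * (2 * m) ^ 6 := by gcongr
      _ = _ := by ring
  have h5 : m ^ 2 * testCost m k ≤ 10240000 * (m ^ 8 * k ^ 4) :=
    calc m ^ 2 * testCost m k ≤ m ^ 2 * (10240000 * (m ^ 6 * k ^ 4)) := by gcongr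
      _ = _ := by ring
  have h6 : m ^ 2 ≤ m ^ 8 * k ^ 4 := (Nat.pow_le_pow_right hm (by omega)).trans
    (Nat.le_mul_of_pos_right _ (Nat.pow_pos hk))
  have h7 : m ≤ m ^ 2 := Nat.le_self_pow (by omega) m
  rw [cellCost]
  nlinarith

/-! ### Correctness of the preprocessing and of the whole computation -/

theorem prep_spec (n m : ℕ) (hσ : σ.var 0 = n ∧ σ.var 1 = m) (hmem : ∀ k l, σ.mem k l = 0) :
    ∃ w, Prepared X n m w (prep.eval X σ) := by
  obtain ⟨a0, a1, a2, a3, am, -⟩ := setup_spec (X := X) hσ.1 hσ.2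
  set σ₁ := setup.eval X σ with h1
  set σ₂ := incidences.eval X σ₁ with h2
  set σ₃ := table.eval X σ₂ with h3
  set σ₄ := (lines 0).eval X σ₃ with h4
  set σ₅ := (lines 1).eval X σ₄ with h5
  have he : prep.eval X σ = σ₅ := rfl
  rw [he]
  have f2 : Frame incidences σ₁ σ₂ := frame X _ _
  have f3 : Frame table σ₂ σ₃ := frame X _ _
  have f4 : Frame (lines 0) σ₃ σ₄ := frame X _ _
  have f5 : Frame (lines 1) σ₄ σ₅ := frame X _ _
  have mz : ∀ k l, σ₁.mem k l = 0 := by simp [am, hmem]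
  have v2 : ∀ z ∈ [0, 1, 2, 3], σ₂.var z = σ₁.var z := fun z hz =>
    f2.var z ((show ∀ z ∈ [0, 1, 2, 3], incidences.modv z = false by decide) z hz)
  have v3 : ∀ z ∈ [0, 1, 2, 3], σ₃.var z = σ₁.var z := fun z hz =>
    (f3.var z ((show ∀ z ∈ [0, 1, 2, 3], table.modv z = false by decide) z hz)).trans (v2 z hz)
  have v4 : ∀ z ∈ [0, 1, 2, 3], σ₄.var z = σ₁.var z := fun z hz =>
    (f4.var z ((show ∀ z ∈ [0, 1, 2, 3], (lines 0).modv z = false by decide) z hz)).trans (v3 z hz)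
  have v5 : ∀ z ∈ [0, 1, 2, 3], σ₅.var z = σ₁.var z := fun z hz =>
    (f5.var z ((show ∀ z ∈ [0, 1, 2, 3], (lines 1).modv z = false by decide) z hz)).trans (v4 z hz)
  have m2 : ∀ k, k ≠ 0 → σ₂.mem k = σ₁.mem k := fun k hk =>
    f2.mem k (by simp [incidences, whenInside, seqs, modm, hk])
  have m3 : ∀ k, k ≠ 1 → k ≠ 2 → σ₃.mem k = σ₂.mem k := fun k hk hk' =>
    f3.mem k (by simp [table, rankOf, seqs, modm, hk, hk'])
  have m4 : ∀ k ∈ [0, 1, 2, 4, 8], σ₄.mem k = σ₃.mem k := fun k hk => f4.mem k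
    ((show ∀ k ∈ [0, 1, 2, 4, 8], (lines 0).modm k = false by decide) k hk)
  have m5 : ∀ k ∈ [0, 1, 2, 5, 7], σ₅.mem k = σ₄.mem k := fun k hk => f5.mem k
    ((show ∀ k ∈ [0, 1, 2, 5, 7], (lines 1).modm k = false by decide) k hk)
  obtain ⟨t1, t2⟩ := table_spec (X := X) (σ := σ₂) (n := n) (m := m)
    (by rw [v2 0 (by simp), a0]) (by rw [v2 1 (by simp), a1])
    (fun l => by rw [m2 1 (by simp), mz])
  obtain ⟨w0, hw0⟩ := lines_spec (X := X) (σ := σ₃) (n := n) (m := m) 0 (by rw [v3 0 (by simp), a0])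
    (by rw [v3 1 (by simp), a1])
    (fun l => by rw [m3 _ (by simp) (by simp), m2 _ (by simp), mz])
    (fun l => by rw [m3 _ (by simp) (by simp), m2 _ (by simp), mz])
  obtain ⟨w1, hw1⟩ := lines_spec (X := X) (σ := σ₄) (n := n) (m := m) 1 (by rw [v4 0 (by simp), a0])
    (by rw [v4 1 (by simp), a1])
    (fun l => by rw [m4 _ (by simp), m3 _ (by simp) (by simp), m2 _ (by simp), mz])
    (fun l => by rw [m4 _ (by simp), m3 _ (by simp) (by simp), m2 _ (by simp), mz])
  have e0 : σ₅.mem 0 = σ₂.mem 0 := by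
    rw [m5 0 (by simp), m4 0 (by simp), m3 0 (by simp) (by simp)]
  have e1 : σ₅.mem 1 = σ₃.mem 1 := by rw [m5 1 (by simp), m4 1 (by simp)]
  have e2 : σ₅.mem 2 = σ₃.mem 2 := by rw [m5 2 (by simp), m4 2 (by simp)]
  refine ⟨fun d => if d = 0 then w0 else w1, by rw [v5 0 (by simp), a0], by rw [v5 1 (by simp), a1],
    by rw [v5 2 (by simp), a2], by rw [v5 3 (by simp), a3], ?_, ?_, ?_, ?_⟩
  · intro i j
    rw [e0]
    exact incidences_spec a0 a1 (mz 0) i j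
  · rw [e1, e2]
    exact t1
  · rw [e1]
    exact t2
  · intro d hd
    interval_cases d
    · rw [m5 (5 + 0) (by simp), m5 (7 + 0) (by simp)]
      exact hw0
    · exact hw1

theorem main_spec {w : ℕ → ℕ → ℝ} (hσ : σ.var 0 = n ∧ σ.var 1 = m) (hmem : ∀ k l, σ.mem k l = 0)
    (hout : ∀ j, σ.out j = 0) (hn : 1 ≤ n) (hk : 1 ≤ k) (hkm : k ≤ m)
    (hw : Prepared X n m w (prep.eval X σ))
    (hc : ∀ cx cy, Coverable (prep.eval X σ) (fun _ => True) k cx cy) :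
    Progress (prep.eval X σ) k (main.eval X σ) ∧ (∀ j < m, ∀ a < 2, ∀ b < 2, (main.eval X σ).mem 11
      [(prep.eval X σ).mem 5 [j] + a, (prep.eval X σ).mem 6 [j] + b] ≠ 0) ∧
    main.cost X σ ≤ 100000000 * (m * n + m ^ 8 * k ^ 4) := by
  have he : main.eval X σ = cells.eval X (prep.eval X σ) := rfl
  have hcost : main.cost X σ = prep.cost X σ + cells.cost X (prep.eval X σ) := by
    simp only [main, prep, seqs, cost, eval]
    ring
  have f := frame X prep σ
  have hp : Progress (prep.eval X σ) k (prep.eval X σ) := by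
    refine ⟨.refl _, fun _ _ => ∅, fun cx cy h => ?_, fun j => ?_⟩
    · rw [f.mem 11 (by decide)] at h
      exact (h (hmem _ _)).elim
    · simp [f.out (by decide), hout]
  obtain ⟨⟨h1, h2⟩, h3⟩ := hw.cells_spec (X := X) hk hkm hp hc
  rw [he]
  refine ⟨h1, h2, ?_⟩
  have h4 := prep_cost (X := X) hσ.1 hσ.2 hn (hk.trans hkm)
  have h5 := cells_cost_le (hk.trans hkm) hk
  have h6 : m ^ 2 ≤ m ^ 8 * k ^ 4 := (Nat.pow_le_pow_right (hk.trans hkm) (by omega)).trans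
    (Nat.le_mul_of_pos_right _ (Nat.pow_pos hk))
  rw [hcost]
  nlinarith

end Com

/-! ### Minimal covers of a cell -/

/-- Two private points in the same corner group lie beyond a common point in different coordinates. -/
theorem beyond {α β α' β' u v u' v' y z : ℝ} (hu : u ≤ α) (hv : v ≤ β) (hu' : u' ≤ α') (hv' : v' ≤ β')
    (h : u ≤ α' → β' < v) (h' : u' ≤ α → β < v') (hy : y ≤ α) (hy' : y ≤ α') (hz : z ≤ β)
    (hz' : z ≤ β') : y < u ∧ z < v' ∨ y < u' ∧ z < v := by
  -- If the second square reaches at least as far in the first coordinate, the private point of the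
  -- first square must escape it in the second coordinate. The private point of the second square
  -- must then exceed `α`; otherwise `β < v' ≤ β' < v ≤ β`.
  rcases le_total α α' with hα | hα
  · have h1 := h (hu.trans hα)
    refine .inr ⟨hy.trans_lt (not_le.1 fun h2 => ?_), hz'.trans_lt h1⟩
    linarith [h' h2]
  · have h1 := h' (hu'.trans hα)
    refine .inl ⟨hy'.trans_lt (not_le.1 fun h2 => ?_), hz.trans_lt h1⟩
    linarith [h h2]

/-- The square that reaches less far in the first coordinate has its private point beyond the other
square in the second. -/
theorem beyond_snd {α β α' β' u v u' v' z : ℝ} (hu : u ≤ α) (hu' : u' ≤ α')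
    (h : u ≤ α' → β' < v) (h' : u' ≤ α → β < v') (hz : z ≤ β)
    (hz' : z ≤ β') : z < v' ∨ z < v := by
  rcases le_total α α' with hα | hα
  · exact .inr (hz'.trans_lt (h (hu.trans hα)))
  · exact .inl (hz.trans_lt (h' (hu'.trans hα)))

/-- One of two neighbouring corner groups has at most one square through a common point. -/
theorem card_le_one_or {α β u v : ℕ → ℝ} {z : ℝ} {S S' : Finset ℕ} (hd : Disjoint S S')
    (h : ∀ a ∈ S, u a ≤ α a ∧ z ≤ β a) (h' : ∀ b ∈ S', u b ≤ α b ∧ -z ≤ β b)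
    (hS : ∀ a ∈ S, ∀ e ∈ S ∪ S', e ≠ a → u e ≤ α a → β a < v e)
    (hS' : ∀ b ∈ S', ∀ e ∈ S ∪ S', e ≠ b → u e ≤ α b → β b < -v e) :
    S.card ≤ 1 ∨ S'.card ≤ 1 := by
  -- With two squares in both groups, some `e` in `S` has its private point on one side of `z` in
  -- the second coordinate, and some `f` in `S'` on the other side. In that coordinate `f` covers
  -- the private point of `e` and vice versa, so each private point must escape in the first
  -- coordinate: `u e ≤ α e < u f ≤ α f < u e`.
  by_contra! hc
  obtain ⟨a, ha, a', ha', hne⟩ := Finset.one_lt_card.1 hc.1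
  obtain ⟨b, hb, b', hb', hne'⟩ := Finset.one_lt_card.1 hc.2
  have hdis : ∀ a ∈ S, ∀ b ∈ S', a ≠ b := fun a ha b hb => Finset.disjoint_iff_ne.1 hd a ha b hb
  have h1 : ∃ e ∈ S, z < v e := by
    rcases beyond_snd (h a ha).1 (h a' ha').1
      (hS a' ha' a (Finset.mem_union_left _ ha) hne)
      (hS a ha a' (Finset.mem_union_left _ ha') hne.symm) (h a ha).2 (h a' ha').2 with h | h
    exacts [⟨a', ha', h⟩, ⟨a, ha, h⟩]
  have h2 : ∃ e ∈ S', -z < -v e := by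
    rcases beyond_snd (v := -v b) (v' := -v b') (h' b hb).1 (h' b' hb').1
      (hS' b' hb' b (Finset.mem_union_right _ hb) hne')
      (hS' b hb b' (Finset.mem_union_right _ hb') hne'.symm) (h' b hb).2 (h' b' hb').2 with h | h
    exacts [⟨b', hb', h⟩, ⟨b, hb, h⟩]
  obtain ⟨e, he, hze⟩ := h1
  obtain ⟨f, hf, hzf⟩ := h2
  have h3 : α f < u e := by
    by_contra! hle
    have := hS' f hf e (Finset.mem_union_left _ he) (hdis e he f hf) hle
    linarith [(h' f hf).2]
  have h4 : α e < u f := by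
    by_contra! hle
    have := hS e he f (Finset.mem_union_right _ hf) (hdis e he f hf).symm hle
    linarith [(h e he).2]
  linarith [(h e he).1, (h' f hf).1]

/-- One of three squares of a corner group has its private point beyond a common point. -/
theorem exists_beyond {α β u v : ℕ → ℝ} {y z : ℝ} {S : Finset ℕ}
    (h : ∀ a ∈ S, (u a ≤ α a ∧ v a ≤ β a) ∧ y ≤ α a ∧ z ≤ β a)
    (hS : ∀ a ∈ S, ∀ e ∈ S, e ≠ a → u e ≤ α a → β a < v e) (hc : 2 < S.card) :
    ∃ e ∈ S, y < u e ∧ z < v e := by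
  obtain ⟨a, b, c, ha, hb, hc, hab, hac, hbc⟩ := Finset.two_lt_card_iff.1 hc
  have key : ∀ a ∈ S, ∀ b ∈ S, a ≠ b → y < u a ∧ z < v b ∨ y < u b ∧ z < v a :=
    fun a ha b hb hab => beyond (h a ha).1.1 (h a ha).1.2 (h b hb).1.1 (h b hb).1.2
      (hS b hb a ha hab) (hS a ha b hb hab.symm) (h a ha).2.1 (h b hb).2.1 (h a ha).2.2 (h b hb).2.2
  have h1 := key a ha b hb hab
  have h2 := key a ha c hc hac
  have h3 := key b hb c hc hbc
  -- If no private point is beyond in both coordinates, each pair of squares must be beyond in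
  -- different coordinates, which is impossible for three squares and two coordinates.
  by_contra! hno
  have n1 := hno a ha
  have n2 := hno b hb
  have n3 := hno c hc
  rw [← not_lt] at n1 n2 n3
  tauto

namespace Com

theorem dir_not (b : Bool) (z : ℝ) : dir (!b) z = -dir b z := by
  cases b <;> simp [dir]

theorem dir_le_reach {a z : ℝ} (h : a ≤ z) (h' : z ≤ a + 1) (b : Bool) : dir b z ≤ reach b a := by
  cases b <;> simp [dir, reach, h, h']

/-- Square `j` is in corner group `g` of the cell `cx`, `cy`. -/
def Corner (ρ : St) (cx cy g j : ℕ) : Prop :=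
  ρ.mem 5 [j] + 1 = cx + g % 2 ∧ ρ.mem 6 [j] + 1 = cy + g / 2

instance (ρ : St) (cx cy g : ℕ) : DecidablePred (Corner ρ cx cy g) :=
  fun _ => inferInstanceAs (Decidable (_ ∧ _))

theorem Corner.unique {ρ : St} {cx cy g g' j : ℕ} (h : Corner ρ cx cy g j)
    (h' : Corner ρ cx cy g' j) : g = g' := by
  obtain ⟨h1, h2⟩ := h
  obtain ⟨h3, h4⟩ := h'
  omega

/-- A set of squares for a cell whose corner groups are small, and in which each square has a private
point. -/
structure Tidy (X : ℕ → ℝ) (n m k : ℕ) (ρ : St) (cx cy : ℕ) (A : Finset ℕ) : Prop where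
  lt : ∀ j ∈ A, j < m
  corner : ∀ j ∈ A, ∃ g < 4, Corner ρ cx cy g j
  card : ∀ g < 4, (A.filter (Corner ρ cx cy g)).card ≤ k
  priv : ∀ j ∈ A, ∃ i < n, ρ.mem 7 [i] = cx ∧ ρ.mem 8 [i] = cy ∧ Inside X n i j ∧
    ∀ j' ∈ A, j' ≠ j → ¬ Inside X n i j'
  one : Coverable ρ (fun _ => True) 1 cx cy → ∀ g < 4, (A.filter (Corner ρ cx cy g)).card ≤ 1

variable {X : ℕ → ℝ} {n m k : ℕ} {w : ℕ → ℕ → ℝ} {ρ : St} {cx cy : ℕ} {A : Finset ℕ}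

theorem Tidy.empty (X : ℕ → ℝ) (n m k : ℕ) (ρ : St) (cx cy : ℕ) : Tidy X n m k ρ cx cy ∅ := by
  constructor <;> simp

/-- By minimality, deleting `j` from the covering family `S` must leave some representative
uncovered. So `j` occurs in `S` and covers a representative that no other square of `S` covers.
Hence `A` lies within `S`, which bounds its groups by `κ`, and minimality of `κ` gives the last
property. -/
theorem Optimal.tidy (h : Prepared X n m w ρ) (hA : Optimal ρ k cx cy A) :
    Tidy X n m k ρ cx cy A := by
  obtain ⟨hlt, κ, h1, hκ, ⟨S, hS, hcov, hcard⟩, hmin, hpriv⟩ := hA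
  have hlt' : ∀ j ∈ A, j < m := fun j hj => h.var1 ▸ hlt j hj
  have hpriv' : ∀ j ∈ A, (∃ g < 4, j ∈ S g) ∧ ∃ i < n, ρ.mem 7 [i] = cx ∧ ρ.mem 8 [i] = cy ∧
      Inside X n i j ∧ ∀ g < 4, ∀ j' ∈ S g, j' ≠ j → ¬ Inside X n i j' := by
    intro j hj
    by_contra hno
    refine hpriv j hj ⟨fun g => (S g).erase j, fun g hg s hs => ?_, fun x hx y hy ht hx' hy' => ?_,
      fun g hg => (Finset.card_le_card (Finset.erase_subset _ _)).trans (hcard g hg)⟩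
    · obtain ⟨hs1, hs2⟩ := Finset.mem_erase.1 hs
      obtain ⟨g1, g2, g3⟩ := hS g hg s hs2
      exact ⟨g1, ⟨g2, hs1⟩, g3⟩
    · by_contra hno'
      push Not at hno'
      obtain ⟨g, hg, s, hs, hi⟩ := hcov x hx y hy ht hx' hy'
      have hsj : s = j := by
        by_contra hne
        exact hi (hno' g hg s (Finset.mem_erase.2 ⟨hne, hs⟩))
      subst hsj
      obtain ⟨hin, -, hins⟩ := (h.inc _ _).1 hi
      refine hno ⟨⟨g, hg, hs⟩, _, hin, hx', hy', hins, fun g' hg' j' hj' hne hins' => ?_⟩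
      have hj'm : j' < m := h.var1 ▸ (hS g' hg' j' hj').1
      exact (h.inc _ _).2 ⟨hin, hj'm, hins'⟩ (hno' g' hg' j' (Finset.mem_erase.2 ⟨hne, hj'⟩))
  have hmem : ∀ g < 4, ∀ j ∈ A, Corner ρ cx cy g j → j ∈ S g := by
    intro g hg j hj hc
    obtain ⟨⟨g', hg', hj'⟩, -⟩ := hpriv' j hj
    rwa [hc.unique (hS g' hg' j hj').2.2]
  have hsub : ∀ g < 4, (A.filter (Corner ρ cx cy g)).card ≤ κ := fun g hg =>
    (Finset.card_le_card fun j hj => hmem g hg j (Finset.mem_filter.1 hj).1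
      (Finset.mem_filter.1 hj).2).trans (hcard g hg)
  refine ⟨hlt', fun j hj => ?_, fun g hg => (hsub g hg).trans hκ, fun j hj => ?_,
    fun hc g hg => (hsub g hg).trans (hmin 1 le_rfl hc)⟩
  · obtain ⟨⟨g, hg, hjg⟩, -⟩ := hpriv' j hj
    exact ⟨g, hg, (hS g hg j hjg).2.2⟩
  · obtain ⟨-, i, hi, hx, hy, hin, hno⟩ := hpriv' j hj
    refine ⟨i, hi, hx, hy, hin, fun j' hj' hne => ?_⟩
    obtain ⟨⟨g, hg, hjg⟩, -⟩ := hpriv' j' hj'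
    exact hno g hg j' hjg hne

/-- Square `j` contains the point with coordinates `z`. -/
def Through (X : ℕ → ℝ) (n : ℕ) (z : ℕ → ℝ) (j : ℕ) : Prop :=
  ∀ d < 2, sqc X n d j ≤ z d ∧ z d ≤ sqc X n d j + 1

/-- The possible sizes `c` of the parts in the four corner groups of a set of `s` squares through a
common point. -/
structure Profile (k s : ℕ) (c : ℕ → ℕ) : Prop where
  le : s ≤ c 0 + c 1 + c 2 + c 3
  each : ∀ g < 4, c g ≤ k
  horizontal : (c 0 ≤ 1 ∨ c 1 ≤ 1) ∧ (c 2 ≤ 1 ∨ c 3 ≤ 1)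
  vertical : (c 0 ≤ 1 ∨ c 2 ≤ 1) ∧ (c 1 ≤ 1 ∨ c 3 ≤ 1)
  opposite : (c 0 = 0 ∨ c 3 ≤ 2) ∧ (c 3 = 0 ∨ c 0 ≤ 2) ∧ (c 1 = 0 ∨ c 2 ≤ 2) ∧ (c 2 = 0 ∨ c 1 ≤ 2)

/-- How the squares of a tidy set through a common point are distributed over the corner groups. -/
theorem Tidy.profile (h : Prepared X n m w ρ) (hA : Tidy X n m k ρ cx cy A) {T : Finset ℕ}
    (hTA : T ⊆ A) {z : ℕ → ℝ} (hz : ∀ j ∈ T, Through X n z j) {c : ℕ → ℕ}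
    (hc : ∀ g, c g = (T.filter (Corner ρ cx cy g)).card) :
    Profile k T.card c := by
  classical
  have hp : ∀ j, ∃ i, j ∈ A → i < n ∧ ρ.mem 7 [i] = cx ∧ ρ.mem 8 [i] = cy ∧ Inside X n i j ∧
      ∀ j' ∈ A, j' ≠ j → ¬ Inside X n i j' := by
    intro j
    by_cases hj : j ∈ A
    · obtain ⟨i, hi⟩ := hA.priv j hj
      exact ⟨i, fun _ => hi⟩
    · exact ⟨0, fun h => (hj h).elim⟩
  choose p hp using hp
  let S : ℕ → Finset ℕ := fun g => T.filter (Corner ρ cx cy g)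
  have hSA : ∀ {g j}, j ∈ S g → j ∈ A := fun hj => hTA (Finset.mem_filter.1 hj).1
  have hin : ∀ g < 4, ∀ j ∈ S g, ∀ e ∈ A, (Inside X n (p e) j ↔
      dir (g % 2 == 1) (ptc X 0 (p e)) ≤ reach (g % 2 == 1) (sqc X n 0 j) ∧
      dir (g / 2 == 1) (ptc X 1 (p e)) ≤ reach (g / 2 == 1) (sqc X n 1 j)) := by
    intro g hg j hj e he
    obtain ⟨q1, q2, q3, -⟩ := hp e he
    have hcj := (Finset.mem_filter.1 hj).2
    exact h.inside_iff q1 (hA.lt j (hSA hj)) hg q2 q3 hcj.1 hcj.2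
  have hself : ∀ g < 4, ∀ j ∈ S g,
      dir (g % 2 == 1) (ptc X 0 (p j)) ≤ reach (g % 2 == 1) (sqc X n 0 j) ∧
      dir (g / 2 == 1) (ptc X 1 (p j)) ≤ reach (g / 2 == 1) (sqc X n 1 j) :=
    fun g hg j hj => (hin g hg j hj j (hSA hj)).1 (hp j (hSA hj)).2.2.2.1
  have hother : ∀ g < 4, ∀ j ∈ S g, ∀ e ∈ A, e ≠ j →
      ¬ (dir (g % 2 == 1) (ptc X 0 (p e)) ≤ reach (g % 2 == 1) (sqc X n 0 j) ∧
      dir (g / 2 == 1) (ptc X 1 (p e)) ≤ reach (g / 2 == 1) (sqc X n 1 j)) :=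
    fun g hg j hj e he hne => (hin g hg j hj e he).not.1 ((hp e he).2.2.2.2 j (hSA hj) hne.symm)
  have hzr : ∀ g, ∀ j ∈ S g, ∀ b, ∀ d < 2, dir b (z d) ≤ reach b (sqc X n d j) :=
    fun g j hj b d hd => dir_le_reach (hz j (Finset.mem_filter.1 hj).1 d hd).1
      (hz j (Finset.mem_filter.1 hj).1 d hd).2 b
  have hdis : ∀ g g', g ≠ g' → Disjoint (S g) (S g') := fun g g' hne =>
    Finset.disjoint_left.2 fun j hj hj' =>
      hne ((Finset.mem_filter.1 hj).2.unique (Finset.mem_filter.1 hj').2)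
  have hun : ∀ {g g' e}, e ∈ S g ∪ S g' → e ∈ A := fun he =>
    (Finset.mem_union.1 he).elim hSA hSA
  -- Groups at the same vertical line and at opposite horizontal lines. The second coordinate has
  -- opposite signs for them, so `β` is defined by cases on the group.
  have hadj : ∀ g < 4, ∀ g' < 4, (g % 2 == 1) = (g' % 2 == 1) → (g' / 2 == 1) = !(g / 2 == 1) →
      c g ≤ 1 ∨ c g' ≤ 1 := by
    intro g hg g' hg' e1 e2
    rw [hc, hc]
    have s1 := hself g hg
    have s2 := hself g' hg'
    have o1 := hother g hg
    have o2 := hother g' hg'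
    have ne : g ≠ g' := by
      rintro rfl
      revert e2
      cases (g / 2 == 1) <;> decide
    rw [← e1, e2] at s2 o2
    generalize (g % 2 == 1) = bx at *
    generalize (g / 2 == 1) = bY at *
    refine card_le_one_or (α := fun j => reach bx (sqc X n 0 j))
      (β := fun j => if j ∈ S g then reach bY (sqc X n 1 j) else reach (!bY) (sqc X n 1 j))
      (u := fun j => dir bx (ptc X 0 (p j))) (v := fun j => dir bY (ptc X 1 (p j)))
      (z := dir bY (z 1)) (hdis g g' ne) ?_ ?_ ?_ ?_
    · intro a ha
      have : a ∈ S g := ha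
      simp only [this, if_true]
      exact ⟨(s1 a ha).1, hzr g a ha bY 1 (by omega)⟩
    · intro b hb
      have : b ∉ S g := Finset.disjoint_right.1 (hdis g g' ne) hb
      simp only [this, if_false, ← dir_not]
      exact ⟨(s2 b hb).1, hzr g' b hb _ 1 (by omega)⟩
    · intro a ha e he hne hle
      have : a ∈ S g := ha
      simp only [this, if_true]
      by_contra hlt
      exact o1 a ha e (hun he) hne ⟨hle, not_lt.1 hlt⟩
    · intro b hb e he hne hle
      have : b ∉ S g := Finset.disjoint_right.1 (hdis g g' ne) hb
      simp only [this, if_false, ← dir_not]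
      by_contra hlt
      exact o2 b hb e (hun he) hne ⟨hle, not_lt.1 hlt⟩
  -- The same with the two coordinates exchanged.
  have hadj' : ∀ g < 4, ∀ g' < 4, (g / 2 == 1) = (g' / 2 == 1) → (g' % 2 == 1) = !(g % 2 == 1) →
      c g ≤ 1 ∨ c g' ≤ 1 := by
    intro g hg g' hg' e1 e2
    rw [hc, hc]
    have s1 := hself g hg
    have s2 := hself g' hg'
    have o1 := hother g hg
    have o2 := hother g' hg'
    have ne : g ≠ g' := by
      rintro rfl
      revert e2
      cases (g % 2 == 1) <;> decide
    rw [← e1, e2] at s2 o2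
    generalize (g % 2 == 1) = bx at *
    generalize (g / 2 == 1) = bY at *
    refine card_le_one_or (α := fun j => reach bY (sqc X n 1 j))
      (β := fun j => if j ∈ S g then reach bx (sqc X n 0 j) else reach (!bx) (sqc X n 0 j))
      (u := fun j => dir bY (ptc X 1 (p j))) (v := fun j => dir bx (ptc X 0 (p j)))
      (z := dir bx (z 0)) (hdis g g' ne) ?_ ?_ ?_ ?_
    · intro a ha
      have : a ∈ S g := ha
      simp only [this, if_true]
      exact ⟨(s1 a ha).2, hzr g a ha bx 0 (by omega)⟩
    · intro b hb
      have : b ∉ S g := Finset.disjoint_right.1 (hdis g g' ne) hb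
      simp only [this, if_false, ← dir_not]
      exact ⟨(s2 b hb).2, hzr g' b hb _ 0 (by omega)⟩
    · intro a ha e he hne hle
      have : a ∈ S g := ha
      simp only [this, if_true]
      by_contra hlt
      exact o1 a ha e (hun he) hne ⟨not_lt.1 hlt, hle⟩
    · intro b hb e he hne hle
      have : b ∉ S g := Finset.disjoint_right.1 (hdis g g' ne) hb
      simp only [this, if_false, ← dir_not]
      by_contra hlt
      exact o2 b hb e (hun he) hne ⟨not_lt.1 hlt, hle⟩
  -- Three squares in one group yield a private point beyond `z` in both directions away from the
  -- corner. A square of the opposite group through `z` contains everything in the cell beyond `z`,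
  -- hence also this private point.
  have hopp : ∀ g < 4, ∀ g' < 4, (g' % 2 == 1) = !(g % 2 == 1) → (g' / 2 == 1) = !(g / 2 == 1) →
      c g' = 0 ∨ c g ≤ 2 := by
    intro g hg g' hg' e1 e2
    rw [hc, hc]
    by_contra! hno
    obtain ⟨b, hb⟩ := Finset.card_pos.1 (Nat.pos_of_ne_zero hno.1)
    have ne : g ≠ g' := by
      rintro rfl
      revert e2
      cases (g / 2 == 1) <;> decide
    obtain ⟨e, he, h1, h2⟩ := exists_beyond (S := S g)
      (α := fun j => reach (g % 2 == 1) (sqc X n 0 j)) (β := fun j => reach (g / 2 == 1) (sqc X n 1 j))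
      (u := fun j => dir (g % 2 == 1) (ptc X 0 (p j))) (v := fun j => dir (g / 2 == 1) (ptc X 1 (p j)))
      (y := dir (g % 2 == 1) (z 0)) (z := dir (g / 2 == 1) (z 1))
      (fun a ha => ⟨hself g hg a ha, hzr g a ha _ 0 (by omega), hzr g a ha _ 1 (by omega)⟩)
      (fun a ha e he hne hle => by
        by_contra hlt
        exact hother g hg a ha e (hSA he) hne ⟨hle, not_lt.1 hlt⟩) hno.2
    have hb' : b ∈ S g' := hb
    refine hother g' hg' b hb e (hSA he)
      (fun heb => Finset.disjoint_left.1 (hdis g g' ne) he (heb ▸ hb')) ⟨?_, ?_⟩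
    · have := hzr g' b hb (g' % 2 == 1) 0 (by omega)
      rw [e1, dir_not] at this ⊢
      linarith
    · have := hzr g' b hb (g' / 2 == 1) 1 (by omega)
      rw [e2, dir_not] at this ⊢
      linarith
  refine ⟨?_, fun g hg => ?_, ⟨?_, ?_⟩, ⟨?_, ?_⟩, ⟨?_, ?_, ?_, ?_⟩⟩
  · have hsub : T ⊆ S 0 ∪ S 1 ∪ S 2 ∪ S 3 := by
      intro j hj
      obtain ⟨g, hg, hcj⟩ := hA.corner j (hTA hj)
      have : j ∈ S g := Finset.mem_filter.2 ⟨hj, hcj⟩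
      simp only [Finset.mem_union]
      interval_cases g <;> tauto
    refine (Finset.card_le_card hsub).trans ?_
    rw [hc, hc, hc, hc]
    refine (Finset.card_union_le _ _).trans (Nat.add_le_add_right ?_ _)
    refine (Finset.card_union_le _ _).trans (Nat.add_le_add_right ?_ _)
    exact Finset.card_union_le _ _
  · rw [hc]
    exact (Finset.card_le_card (Finset.filter_subset_filter _ hTA)).trans (hA.card g hg)
  · exact hadj' 0 (by omega) 1 (by omega) rfl rfl
  · exact hadj' 2 (by omega) 3 (by omega) rfl rfl
  · exact hadj 0 (by omega) 2 (by omega) rfl rfl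
  · exact hadj 1 (by omega) 3 (by omega) rfl rfl
  · exact hopp 3 (by omega) 0 (by omega) rfl rfl
  · exact hopp 0 (by omega) 3 (by omega) rfl rfl
  · exact hopp 2 (by omega) 1 (by omega) rfl rfl
  · exact hopp 1 (by omega) 2 (by omega) rfl rfl

end Com

/-! ### Counting over the nine cells around a point -/

namespace Com

variable {X : ℕ → ℝ} {n m k : ℕ} {w : ℕ → ℕ → ℝ} {ρ : St}

theorem Lines.exists_cell {d : ℕ} {H G : ℕ → ℕ} {w : ℕ → ℝ} (h : Lines X n m d H G w) {j : ℕ}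
    (hj : j < m) {z : ℝ} (h1 : sqc X n d j ≤ z) (h2 : z ≤ sqc X n d j + 1) :
    ∃ c, w c ≤ z ∧ z < w (c + 1) := by
  rcases le_or_gt (w (H j + 1)) z with hle | hlt
  · exact ⟨H j + 1, hle, h2.trans_lt (h.after j hj)⟩
  · exact ⟨H j, ((h.before j hj).trans_le h1).le, hlt⟩

/-- What is known about a set of `s` squares through a common point in the cell with offset `a`, `b`
from the cell of that point, where `y t` says whether there are squares of type `t` relative to the
cell of the point. -/
structure Share (k : ℕ) (y : ℕ → ℕ) (a b s : ℕ) (c : ℕ → ℕ) : Prop where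
  profile : Profile k s c
  type : ∀ g < 4, c g = 0 ∨ ∃ t < 4, y t = 1 ∧ a + g % 2 = 1 + t % 2 ∧ b + g / 2 = 1 + t / 2
  one : a = 1 → b = 1 → (∀ t < 4, y t = 1) → ∀ g < 4, c g ≤ 1

/-- The only corner group of a diagonal cell that can contribute is the one at the corner shared
with the central cell, and its squares have type `t` relative to the central cell. -/
theorem Share.diagonal {y c : ℕ → ℕ} {s t : ℕ} (ht : t < 4)
    (h : Share k y (2 * (t % 2)) (2 * (t / 2)) s c) : s ≤ k ∧ (y t = 0 → s = 0) := by
  obtain ⟨⟨h1, h2, -, -, -⟩, h3, -⟩ := h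
  have z : ∀ g < 4, c g = 0 ∨ g = 3 - t ∧ y t = 1 := by
    intro g hg
    rcases h3 g hg with h | ⟨t', ht', hy', e1, e2⟩
    · exact .inl h
    · obtain rfl : t' = t := by
        clear h1 h2 h3
        interval_cases t <;> interval_cases t' <;> omega
      exact .inr ⟨by clear h1 h2 h3; interval_cases t' <;> omega, hy'⟩
  have k0 := h2 0 (by omega)
  have k1 := h2 1 (by omega)
  have k2 := h2 2 (by omega)
  have k3 := h2 3 (by omega)
  have z0 := z 0 (by omega)
  have z1 := z 1 (by omega)
  have z2 := z 2 (by omega)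
  have z3 := z 3 (by omega)
  omega

/-- Only the two groups at the shared side can contribute. They are neighbours, so one of them has
at most one square. -/
theorem Share.side {y c : ℕ → ℕ} {a b s : ℕ} (h : Share k y a b s c)
    (hab : a = 1 ∧ (b = 0 ∨ b = 2) ∨ (a = 0 ∨ a = 2) ∧ b = 1) : s ≤ k + 1 := by
  obtain ⟨⟨h1, h2, h4, h5, -⟩, h3, -⟩ := h
  have z : ∀ g < 4, ¬ (1 ≤ a + g % 2 ∧ a + g % 2 ≤ 2 ∧ 1 ≤ b + g / 2 ∧ b + g / 2 ≤ 2) →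
      c g = 0 := by
    intro g hg hno
    rcases h3 g hg with h | ⟨t', ht', -, e1, e2⟩
    · exact h
    · exact (hno (by omega)).elim
  have k0 := h2 0 (by omega)
  have k1 := h2 1 (by omega)
  have k2 := h2 2 (by omega)
  have k3 := h2 3 (by omega)
  clear h3 h2
  rcases hab with ⟨rfl, rfl | rfl⟩ | ⟨rfl | rfl, rfl⟩
  · have q0 := z 0 (by omega) (by omega)
    have q1 := z 1 (by omega) (by omega)
    rcases h4.2 with h | h <;> clear h4 h5 z <;> omega
  · have q0 := z 2 (by omega) (by omega)
    have q1 := z 3 (by omega) (by omega)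
    rcases h4.1 with h | h <;> clear h4 h5 z <;> omega
  · have q0 := z 0 (by omega) (by omega)
    have q1 := z 2 (by omega) (by omega)
    rcases h5.2 with h | h <;> clear h4 h5 z <;> omega
  · have q0 := z 1 (by omega) (by omega)
    have q1 := z 3 (by omega) (by omega)
    rcases h5.1 with h | h <;> clear h4 h5 z <;> omega

/-- If all four types occur, each group has at most one square. Otherwise one group is empty; of the
other three, two are opposite and the third neighbours both. If both opposite groups occur they have
at most two squares each, and the neighbour conditions control the third. -/
theorem Share.own {y c : ℕ → ℕ} {s : ℕ} (hy : ∀ t, y t ≤ 1) (h : Share k y 1 1 s c) :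
    s ≤ 4 ∨ (y 0 = 0 ∨ y 1 = 0 ∨ y 2 = 0 ∨ y 3 = 0) ∧ s ≤ k + 4 := by
  obtain ⟨⟨h1, h2, ⟨h4, h4'⟩, ⟨h5, h5'⟩, ⟨h6, h6', h8, h8'⟩⟩, h3, h7⟩ := h
  by_cases hall : ∀ t < 4, y t = 1
  · have := h7 rfl rfl hall
    have q0 := this 0 (by omega)
    have q1 := this 1 (by omega)
    have q2 := this 2 (by omega)
    have q3 := this 3 (by omega)
    exact .inl (by omega)
  · push Not at hall
    obtain ⟨t, ht, hne⟩ := hall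
    have e : y t = 0 := by
      have := hy t
      omega
    have z : c t = 0 := by
      rcases h3 t ht with h | ⟨t', ht', hy', e1, e2⟩
      · exact h
      · obtain rfl : t' = t := by omega
        exact (hne hy').elim
    have k0 := h2 0 (by omega)
    have k1 := h2 1 (by omega)
    have k2 := h2 2 (by omega)
    have k3 := h2 3 (by omega)
    clear h2 h3 h7 hy hne
    refine .inr ⟨by interval_cases t <;> simp [e], ?_⟩
    interval_cases t
    · clear h4 h5 h6 h6' e
      omega
    · clear h4 h5' h8 h8' e
      omega
    · clear h4' h5 h8 h8' e
      omega
    · clear h4' h5' h6 h6' e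
      omega

/-- Counting the squares through a common point in all nine cells around it. -/
theorem sum_share_le {s : ℕ → ℕ → ℕ} {y : ℕ → ℕ} (hy : ∀ t, y t ≤ 1)
    (hs : ∀ a b, ∃ c : ℕ → ℕ, Share k y a b (s a b) c) :
    s 0 0 + s 0 1 + s 0 2 + (s 1 0 + s 1 1 + s 1 2) + (s 2 0 + s 2 1 + s 2 2) ≤ 8 * k + 8 := by
  have diagonal : ∀ t < 4, s (2 * (t % 2)) (2 * (t / 2)) ≤ k ∧
      (y t = 0 → s (2 * (t % 2)) (2 * (t / 2)) = 0) := fun t ht => (hs _ _).choose_spec.diagonal ht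
  have d0 : s 0 0 ≤ k ∧ (y 0 = 0 → s 0 0 = 0) := diagonal 0 (by omega)
  have d1 : s 2 0 ≤ k ∧ (y 1 = 0 → s 2 0 = 0) := diagonal 1 (by omega)
  have d2 : s 0 2 ≤ k ∧ (y 2 = 0 → s 0 2 = 0) := diagonal 2 (by omega)
  have d3 : s 2 2 ≤ k ∧ (y 3 = 0 → s 2 2 = 0) := diagonal 3 (by omega)
  have s1 := (hs 0 1).choose_spec.side (by omega)
  have s2 := (hs 2 1).choose_spec.side (by omega)
  have s3 := (hs 1 0).choose_spec.side (by omega)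
  have s4 := (hs 1 2).choose_spec.side (by omega)
  -- Either the total is at most `4 * k + 4 * (k + 1) + 4`, or one diagonal cell contributes nothing
  -- and it is at most `3 * k + 4 * (k + 1) + (k + 4)`.
  rcases (hs 1 1).choose_spec.own hy with ho | ⟨e | e | e | e, ho⟩
  · omega
  · have := d0.2 e; omega
  · have := d1.2 e; omega
  · have := d2.2 e; omega
  · have := d3.2 e; omega

/-- Squares through a common point that belong to tidy sets for the different cells are few. -/
theorem Prepared.card_le (h : Prepared X n m w ρ) {E : ℕ → ℕ → Finset ℕ}
    (hE : ∀ cx cy, Tidy X n m k ρ cx cy (E cx cy)) {T : Finset ℕ}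
    (hT : ∀ j ∈ T, ∃ cx cy, j ∈ E cx cy) {z : ℕ → ℝ} (hz : ∀ j ∈ T, Through X n z j) :
    T.card ≤ 8 * k + 8 := by
  classical
  rcases T.eq_empty_or_nonempty with rfl | ⟨j₀, hj₀⟩
  · simp
  have hlt : ∀ j ∈ T, j < m := fun j hj => by
    obtain ⟨cx, cy, hc⟩ := hT j hj
    exact (hE cx cy).lt j hc
  have l0 := h.lines 0 (by omega)
  have l1 := h.lines 1 (by omega)
  obtain ⟨c₀, hc₀, hc₀'⟩ := Lines.exists_cell l0 (hlt j₀ hj₀) (hz j₀ hj₀ 0 (by omega)).1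
    (hz j₀ hj₀ 0 (by omega)).2
  obtain ⟨c₁, hc₁, hc₁'⟩ := Lines.exists_cell l1 (hlt j₀ hj₀) (hz j₀ hj₀ 1 (by omega)).1
    (hz j₀ hj₀ 1 (by omega)).2
  have hx : ∀ j ∈ T, ρ.mem 5 [j] + 1 = c₀ ∨ ρ.mem 5 [j] = c₀ := fun j hj =>
    l0.eq_or_eq hc₀ hc₀' (hlt j hj) (hz j hj 0 (by omega)).1 (hz j hj 0 (by omega)).2
  have hy : ∀ j ∈ T, ρ.mem 6 [j] + 1 = c₁ ∨ ρ.mem 6 [j] = c₁ := fun j hj =>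
    l1.eq_or_eq hc₁ hc₁' (hlt j hj) (hz j hj 1 (by omega)).1 (hz j hj 1 (by omega)).2
  let y : ℕ → ℕ := fun t => if ∃ j ∈ T, Corner ρ c₀ c₁ t j then 1 else 0
  have hy1 : ∀ t, y t ≤ 1 := fun t => by
    simp only [y]
    split_ifs <;> omega
  -- The offsets 0, 1, 2 stand for -1, 0, 1; the condition guards the truncated subtraction at the
  -- border.
  let D : ℕ → ℕ → Finset ℕ := fun a b =>
    if 1 ≤ c₀ + a ∧ 1 ≤ c₁ + b then T ∩ E (c₀ + a - 1) (c₁ + b - 1) else ∅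
  -- A square of type `t` through `z` contains the quarter of the cell between `z` and the corner of
  -- type `t`. One square of each type thus covers the whole cell.
  have hone : (∀ t < 4, y t = 1) → Coverable ρ (fun _ => True) 1 c₀ c₁ := by
    intro hall
    have : ∀ t, ∃ j, t < 4 → j ∈ T ∧ Corner ρ c₀ c₁ t j := by
      intro t
      by_cases ht : t < 4
      · have := hall t ht
        simp only [y, ite_eq_left_iff, zero_ne_one, imp_false, not_not] at this
        obtain ⟨j, hj⟩ := this
        exact ⟨j, fun _ => hj⟩
      · exact ⟨0, fun h => (ht h).elim⟩
    choose q hq using this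
    refine ⟨fun t => {q t}, fun t ht s hs => ?_, fun x _ y _ ht hx hy => ?_, fun t _ => by simp⟩
    · rw [Finset.mem_singleton.1 hs, h.var1]
      exact ⟨hlt _ (hq t ht).1, trivial, (hq t ht).2⟩
    · obtain ⟨hin, -⟩ := h.tab x y ht
      set i := ρ.mem 2 [x, y]
      -- The quarter, as seen from `z`, that contains the point.
      let t := (if ptc X 0 i ≤ z 0 then 0 else 1) + 2 * (if ptc X 1 i ≤ z 1 then 0 else 1)
      have ht4 : t < 4 := by simp only [t]; split_ifs <;> omega
      obtain ⟨hqT, hqc⟩ := hq t ht4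
      refine ⟨t, ht4, q t, Finset.mem_singleton_self _, (h.inc _ _).2 ⟨hin, hlt _ hqT, ?_⟩⟩
      rw [h.inside_iff hin (hlt _ hqT) ht4 hx hy hqc.1 hqc.2]
      have r0 := dir_le_reach (hz _ hqT 0 (by omega)).1 (hz _ hqT 0 (by omega)).2 (t % 2 == 1)
      have r1 := dir_le_reach (hz _ hqT 1 (by omega)).1 (hz _ hqT 1 (by omega)).2 (t / 2 == 1)
      refine ⟨le_trans ?_ r0, le_trans ?_ r1⟩
      · by_cases c1 : ptc X 0 i ≤ z 0
        · have : (t % 2 == 1) = false := by simp only [t, c1, if_true]; split_ifs <;> rfl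
          simpa [this, dir] using c1
        · have : (t % 2 == 1) = true := by simp only [t, c1, if_false]; split_ifs <;> rfl
          simpa [this, dir] using (not_le.1 c1).le
      · by_cases c1 : ptc X 1 i ≤ z 1
        · have : (t / 2 == 1) = false := by simp only [t, c1, if_true]; split_ifs <;> rfl
          simpa [this, dir] using c1
        · have : (t / 2 == 1) = true := by simp only [t, c1, if_false]; split_ifs <;> rfl
          simpa [this, dir] using (not_le.1 c1).le
  have hD : ∀ a b, ∃ c : ℕ → ℕ, Share k y a b (D a b).card c := by
    intro a b
    by_cases hab : 1 ≤ c₀ + a ∧ 1 ≤ c₁ + b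
    swap
    · have : D a b = ∅ := if_neg hab
      exact ⟨fun _ => 0, ⟨by rw [this]; constructor <;> simp, by simp, by simp⟩⟩
    have hDab : D a b = T ∩ E (c₀ + a - 1) (c₁ + b - 1) := if_pos hab
    refine ⟨fun g => ((D a b).filter (Corner ρ (c₀ + a - 1) (c₁ + b - 1) g)).card,
      ⟨(hE _ _).profile h (by rw [hDab]; exact Finset.inter_subset_right)
        (fun j hj => hz j (by rw [hDab] at hj; exact Finset.inter_subset_left hj)) fun _ => rfl, ?_, ?_⟩⟩
    · intro g hg
      rw [or_iff_not_imp_left]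
      intro hne
      obtain ⟨j, hj⟩ := Finset.card_pos.1 (Nat.pos_of_ne_zero hne)
      obtain ⟨hj1, hj2, hj3⟩ := Finset.mem_filter.1 hj
      have hjT : j ∈ T := by
        rw [hDab] at hj1
        exact Finset.inter_subset_left hj1
      have gx := hx j hjT
      have gy := hy j hjT
      refine ⟨(ρ.mem 5 [j] + 1 - c₀) + 2 * (ρ.mem 6 [j] + 1 - c₁), by omega, ?_, by omega, by omega⟩
      exact if_pos ⟨j, hjT, by omega, by omega⟩
    · rintro rfl rfl hall g hg
      refine (Finset.card_le_card (Finset.filter_subset_filter _ ?_)).trans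
        ((hE (c₀ + 1 - 1) (c₁ + 1 - 1)).one (hone hall) g hg)
      rw [hDab]
      exact Finset.inter_subset_right
  have hsub : T ⊆ (Finset.range 3 ×ˢ Finset.range 3).biUnion fun p => D p.1 p.2 := by
    intro j hj
    obtain ⟨cx, cy, hc⟩ := hT j hj
    obtain ⟨g, hg, g1, g2⟩ := (hE cx cy).corner j hc
    have gx := hx j hj
    have gy := hy j hj
    refine Finset.mem_biUnion.2 ⟨(cx + 1 - c₀, cy + 1 - c₁), ?_, ?_⟩
    · simp only [Finset.mem_product, Finset.mem_range]
      omega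
    · have e1 : c₀ + (cx + 1 - c₀) - 1 = cx := by omega
      have e2 : c₁ + (cy + 1 - c₁) - 1 = cy := by omega
      simp only [D, e1, e2]
      rw [if_pos (by omega)]
      exact Finset.mem_inter.2 ⟨hj, hc⟩
  have hsum := (Finset.card_le_card hsub).trans Finset.card_biUnion_le
  simp only [Finset.sum_product, Finset.sum_range_succ, Finset.sum_range_zero, zero_add] at hsum
  exact hsum.trans (sum_share_le hy1 hD)

/-- A cover of ply `k` gives feasible bounds for all cells. -/
theorem Prepared.coverable (h : Prepared X n m w ρ) {S : Finset ℕ} (hS : ∀ j ∈ S, j < m)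
    (hcov : ∀ i < n, ∃ j ∈ S, Inside X n i j)
    (hply : ∀ T ⊆ S, ∀ z, (∀ j ∈ T, Through X n z j) → T.card ≤ k) (cx cy : ℕ) :
    Coverable ρ (fun _ => True) k cx cy := by
  have l0 := h.lines 0 (by omega)
  have l1 := h.lines 1 (by omega)
  refine ⟨fun g => S.filter (Corner ρ cx cy g), fun g hg s hs => ?_, fun x _ y _ ht hx hy => ?_,
    fun g hg => hply _ (Finset.filter_subset _ _)
      (fun d => if d = 0 then w 0 (cx + g % 2) else w 1 (cy + g / 2)) fun j hj d hd => ?_⟩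
  · rw [h.var1]
    exact ⟨hS s (Finset.mem_filter.1 hs).1, trivial, (Finset.mem_filter.1 hs).2⟩
  · obtain ⟨hin, -⟩ := h.tab x y ht
    set i := ρ.mem 2 [x, y]
    obtain ⟨j, hj, hij⟩ := hcov i hin
    have p0 := l0.point i hin
    have p1 := l1.point i hin
    have q0 : ρ.mem 5 [j] + 1 = ρ.mem 7 [i] ∨ ρ.mem 5 [j] = ρ.mem 7 [i] :=
      l0.eq_or_eq p0.1 p0.2 (hS j hj) (hij 0 (by omega)).1 (hij 0 (by omega)).2
    have q1 : ρ.mem 6 [j] + 1 = ρ.mem 8 [i] ∨ ρ.mem 6 [j] = ρ.mem 8 [i] :=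
      l1.eq_or_eq p1.1 p1.2 (hS j hj) (hij 1 (by omega)).1 (hij 1 (by omega)).2
    rw [hx] at q0
    rw [hy] at q1
    refine ⟨(ρ.mem 5 [j] + 1 - cx) + 2 * (ρ.mem 6 [j] + 1 - cy), by omega, j,
      Finset.mem_filter.2 ⟨hj, ?_, ?_⟩, (h.inc _ _).2 ⟨hin, hS j hj, hij⟩⟩ <;> omega
  -- The lines that stab a square of the group cross at the corner of the cell, so the ply at this
  -- corner bounds the size of the group.
  · obtain ⟨hj1, hj2, hj3⟩ := Finset.mem_filter.1 hj
    have a0 := l0.left j (hS j hj1)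
    have b0 := l0.right j (hS j hj1)
    have a1 := l1.left j (hS j hj1)
    have b1 := l1.right j (hS j hj1)
    interval_cases d
    · simp only [if_true, ← hj2]
      exact ⟨a0, b0⟩
    · simp only [one_ne_zero, if_false, ← hj3]
      exact ⟨a1, b1⟩

/-- The program selects a cover of small ply, within the time bound. -/
theorem main_correct {σ : St} (hσ : σ.var 0 = n ∧ σ.var 1 = m) (hmem : ∀ k l, σ.mem k l = 0)
    (hout : ∀ j, σ.out j = 0) (hn : 1 ≤ n) (hk : 1 ≤ k) (hkm : k ≤ m) {S : Finset ℕ}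
    (hS : ∀ j ∈ S, j < m) (hcov : ∀ i < n, ∃ j ∈ S, Inside X n i j)
    (hply : ∀ T ⊆ S, ∀ z, (∀ j ∈ T, Through X n z j) → T.card ≤ k) :
    (∀ i < n, ∃ j < m, (main.eval X σ).out j ≠ 0 ∧ Inside X n i j) ∧
    (∀ T : Finset ℕ, (∀ j ∈ T, (main.eval X σ).out j ≠ 0) → ∀ z, (∀ j ∈ T, Through X n z j) →
      T.card ≤ 8 * k + 8) ∧
    main.cost X σ ≤ 100000000 * (m * n + m ^ 8 * k ^ 4) := by
  obtain ⟨w, hw⟩ := prep_spec (X := X) n m hσ hmem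
  obtain ⟨⟨hs, F, hF, ho⟩, hdone, hcost⟩ := main_spec (X := X) hσ hmem hout hn hk hkm hw
    (hw.coverable hS hcov hply)
  set ρ := prep.eval X σ
  set τ := main.eval X σ
  refine ⟨fun i hi => ?_, fun T hT z hz => ?_, hcost⟩
  -- The point is replaced by its representative, which lies in the same squares. A square of the
  -- given cover that contains it shows that its cell has been processed.
  · set x := rank X n m 0 (ptc X 0 i) with hx
    set y := rank X n m 1 (ptc X 1 i) with hy
    have ht := hw.rep i hi
    rw [← hx, ← hy] at ht
    obtain ⟨hin, r0, r1⟩ := hw.tab x y ht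
    set i' := ρ.mem 2 [x, y]
    have hsame : ∀ j < m, Inside X n i j ↔ Inside X n i' j := fun j hj => inside_congr hj (by
      intro d hd
      interval_cases d
      exacts [r0.symm, r1.symm])
    obtain ⟨j, hj, hij⟩ := hcov i hi
    rw [hsame j (hS j hj)] at hij
    have l0 := hw.lines 0 (by omega)
    have l1 := hw.lines 1 (by omega)
    have p0 := l0.point i' hin
    have p1 := l1.point i' hin
    have q0 : ρ.mem 5 [j] + 1 = ρ.mem 7 [i'] ∨ ρ.mem 5 [j] = ρ.mem 7 [i'] :=
      l0.eq_or_eq p0.1 p0.2 (hS j hj) (hij 0 (by omega)).1 (hij 0 (by omega)).2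
    have q1 : ρ.mem 6 [j] + 1 = ρ.mem 8 [i'] ∨ ρ.mem 6 [j] = ρ.mem 8 [i'] :=
      l1.eq_or_eq p1.1 p1.2 (hS j hj) (hij 1 (by omega)).1 (hij 1 (by omega)).2
    have hd : τ.mem 11 [ρ.mem 7 [i'], ρ.mem 8 [i']] ≠ 0 := by
      have := hdone j (hS j hj) (ρ.mem 7 [i'] - ρ.mem 5 [j]) (by omega)
        (ρ.mem 8 [i'] - ρ.mem 6 [j]) (by omega)
      rwa [show ρ.mem 5 [j] + (ρ.mem 7 [i'] - ρ.mem 5 [j]) = ρ.mem 7 [i'] by omega,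
        show ρ.mem 6 [j] + (ρ.mem 8 [i'] - ρ.mem 6 [j]) = ρ.mem 8 [i'] by omega] at this
    obtain ⟨-, κ, -, -, ⟨S', hS', hcov', -⟩, -⟩ := hF _ _ hd
    obtain ⟨g, hg, s, hsg, hinc⟩ := hcov' x (by rw [hw.var3]; exact rank_lt _ _ _ _ _) y
      (by rw [hw.var3]; exact rank_lt _ _ _ _ _) ht rfl rfl
    obtain ⟨-, hsm, hins⟩ := (hw.inc _ _).1 hinc
    exact ⟨s, hsm, (ho s).2 ⟨_, _, hd, (hS' g hg s hsg).2.1⟩, (hsame s hsm).2 hins⟩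
  -- Cells that have not been processed get the empty set, which is tidy.
  · refine hw.card_le
      (E := fun cx cy => if τ.mem 11 [cx, cy] = 0 then ∅ else F cx cy) (fun cx cy => ?_)
      (fun j hj => ?_) hz
    · split_ifs with hd
      · exact .empty ..
      · exact (hF cx cy hd).tidy hw
    · obtain ⟨cx, cy, hd, hj'⟩ := (ho j).1 (hT j hj)
      refine ⟨cx, cy, ?_⟩
      rwa [if_neg hd]

end Com

/-! ### Ply and reductions -/

theorem mem_unitSquare {a z : Plane} :
    z ∈ unitSquare a ↔ (a.1 ≤ z.1 ∧ z.1 ≤ a.1 + 1) ∧ (a.2 ≤ z.2 ∧ z.2 ≤ a.2 + 1) := by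
  simp only [unitSquare, Set.mem_Icc, Prod.le_def]
  tauto

theorem mem_interior_unitSquare {a z : Plane} : z ∈ interior (unitSquare a) ↔
    (a.1 < z.1 ∧ z.1 < a.1 + 1) ∧ (a.2 < z.2 ∧ z.2 < a.2 + 1) := by
  rw [unitSquare, Set.Icc_prod_eq, interior_prod_eq, interior_Icc, interior_Icc]
  simp [Set.mem_prod]

theorem isClosed_unitSquare (a : Plane) : IsClosed (unitSquare a) := isClosed_Icc

theorem mem_frontier_unitSquare {a z : Plane} : z ∈ frontier (unitSquare a) ↔
    z ∈ unitSquare a ∧ z ∉ interior (unitSquare a) := by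
  rw [(isClosed_unitSquare a).frontier_eq]
  rfl

theorem card_le_ply {S T : Finset Plane} (h : T ⊆ S) {z : Plane} (hz : ∀ s ∈ T, z ∈ unitSquare s) :
    T.card ≤ ply S := by
  classical
  exact Finset.le_sup (f := Finset.card)
    (Finset.mem_filter.2 ⟨Finset.mem_powerset.2 h, z, Set.mem_iInter₂.2 hz⟩)

theorem ply_le {S : Finset Plane} {b : ℕ}
    (h : ∀ T ⊆ S, ∀ z, (∀ s ∈ T, z ∈ unitSquare s) → T.card ≤ b) : ply S ≤ b := by
  classical
  refine Finset.sup_le fun T hT => ?_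
  obtain ⟨h1, z, hz⟩ := Finset.mem_filter.1 hT
  exact h T (Finset.mem_powerset.1 h1) z (Set.mem_iInter₂.1 hz)

theorem ply_le_card (S : Finset Plane) : ply S ≤ S.card :=
  ply_le fun _ hT _ _ => Finset.card_le_card hT

variable {P Q U : Finset Plane}

theorem plyNumber_le {S : Finset Plane} (hS : S ⊆ U) (h : Covers S P) : plyNumber P U ≤ ply S :=
  Nat.sInf_le ⟨S, hS, h, rfl⟩

theorem exists_ply_eq (h : Covers U P) : ∃ S ⊆ U, Covers S P ∧ ply S = plyNumber P U :=
  Nat.sInf_mem (s := {k | ∃ S ⊆ U, Covers S P ∧ ply S = k}) ⟨_, U, subset_rfl, h, rfl⟩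

/-- One covering square for each point gives a cover by at most as many squares as points, and the
ply never exceeds the number of squares. -/
theorem plyNumber_le_min (h : Covers U P) : plyNumber P U ≤ min P.card U.card := by
  classical
  refine le_min ?_ ((plyNumber_le subset_rfl h).trans (ply_le_card U))
  choose f hf using h
  refine (plyNumber_le (S := P.attach.image fun z => f z.1 z.2) ?_ ?_).trans
    ((ply_le_card _).trans (Finset.card_image_le.trans_eq Finset.card_attach))
  · intro s hs
    obtain ⟨z, -, rfl⟩ := Finset.mem_image.1 hs
    exact (hf z.1 z.2).1
  · intro z hz
    exact ⟨f z hz, Finset.mem_image.2 ⟨⟨z, hz⟩, Finset.mem_attach _ _, rfl⟩, (hf z hz).2⟩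

theorem one_le_plyNumber (h : Covers U P) (hP : P.Nonempty) : 1 ≤ plyNumber P U := by
  obtain ⟨S, hS, hc, hp⟩ := exists_ply_eq h
  obtain ⟨z, hz⟩ := hP
  obtain ⟨s, hs, hzs⟩ := hc z hz
  rw [← hp]
  exact card_le_ply (T := {s}) (by simpa using hs) (z := z) (by simpa using hzs)

/-- A closed square is the union of its interior and its frontier, so points of one face lie in the
same squares. -/
theorem IsReduction.covers_iff (h : IsReduction U P Q) {S : Finset Plane} (hS : S ⊆ U) :
    Covers S Q ↔ Covers S P := by
  refine ⟨fun hc z hz => ?_, fun hc z hz => hc z (h.1 hz)⟩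
  obtain ⟨r, ⟨hr, hrz⟩, -⟩ := h.2 z hz
  obtain ⟨s, hs, hrs⟩ := hc r hr
  have hsame : SamePosition U r z := connectedComponentIn_subset _ _ hrz
  obtain ⟨h1, h2⟩ := hsame s (hS hs)
  refine ⟨s, hs, ?_⟩
  have hcl : ∀ w, w ∈ unitSquare s ↔ w ∈ interior (unitSquare s) ∨ w ∈ frontier (unitSquare s) := by
    intro w
    rw [← Set.mem_union, ← closure_eq_interior_union_frontier, (isClosed_unitSquare s).closure_eq]
  rw [hcl] at hrs ⊢
  rwa [← h1, ← h2]

theorem IsReduction.plyNumber_eq (h : IsReduction U P Q) : plyNumber Q U = plyNumber P U := by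
  refine congrArg sInf (Set.ext fun k => exists_congr fun S => and_congr_right fun hS => ?_)
  rw [h.covers_iff hS]

/-! ### The number of representatives after the reduction -/

open Classical in
/-- The position of `z` relative to the numbers in `V`. -/
noncomputable def place (V : Finset ℝ) (z : ℝ) : ℕ :=
  (V.filter (· < z)).card + (V.filter (· ≤ z)).card

theorem place_le (V : Finset ℝ) (z : ℝ) : place V z ≤ 2 * V.card := by
  have h1 := Finset.card_filter_le V (· < z)
  have h2 := Finset.card_filter_le V (· ≤ z)
  unfold place
  omega

/-- Both counts in `place` are monotone, so equal sums force equal counts, and hence equal sets. -/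
theorem place_eq_of_le {V : Finset ℝ} {y z : ℝ} (hyz : y ≤ z) (h : place V y = place V z) {v : ℝ}
    (hv : v ∈ V) : (v < z → v < y) ∧ (v ≤ z → v ≤ y) := by
  classical
  have h1 : V.filter (· < y) ⊆ V.filter (· < z) :=
    Finset.monotone_filter_right V fun _ _ h => lt_of_lt_of_le h hyz
  have h2 : V.filter (· ≤ y) ⊆ V.filter (· ≤ z) :=
    Finset.monotone_filter_right V fun _ _ h => le_trans h hyz
  have c1 := Finset.card_le_card h1
  have c2 := Finset.card_le_card h2
  unfold place at h
  have e1 := Finset.eq_of_subset_of_card_le h1 (by omega)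
  have e2 := Finset.eq_of_subset_of_card_le h2 (by omega)
  refine ⟨fun hz => ?_, fun hz => ?_⟩
  · have : v ∈ V.filter (· < y) := e1 ▸ Finset.mem_filter.2 ⟨hv, hz⟩
    exact (Finset.mem_filter.1 this).2
  · have : v ∈ V.filter (· ≤ y) := e2 ▸ Finset.mem_filter.2 ⟨hv, hz⟩
    exact (Finset.mem_filter.1 this).2

theorem lt_iff_of_place_eq {V : Finset ℝ} {y z t : ℝ} (h : place V y = place V z)
    (ht : t ∈ segment ℝ y z) {v : ℝ} (hv : v ∈ V) : (v < t ↔ v < y) ∧ (v ≤ t ↔ v ≤ y) := by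
  rw [segment_eq_uIcc, Set.mem_uIcc] at ht
  rcases ht with ⟨h1, h2⟩ | ⟨h1, h2⟩
  · obtain ⟨h3, h4⟩ := place_eq_of_le (h1.trans h2) h hv
    exact ⟨⟨fun hvt => h3 (hvt.trans_le h2), fun hvy => hvy.trans_le h1⟩,
      fun hvt => h4 (hvt.trans h2), fun hvy => hvy.trans h1⟩
  · obtain ⟨h3, h4⟩ := place_eq_of_le (h1.trans h2) h.symm hv
    exact ⟨⟨fun hvt => hvt.trans_le h2, fun hvy => (h3 hvy).trans_le h1⟩,
      fun hvt => hvt.trans h2, fun hvy => (h4 hvy).trans h1⟩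

open Classical in
/-- The coordinates of the sides of the squares in one direction. -/
noncomputable def sides (U : Finset Plane) (f : Plane → ℝ) : Finset ℝ :=
  U.image f ∪ U.image fun a => f a + 1

theorem card_sides_le (U : Finset Plane) (f : Plane → ℝ) : (sides U f).card ≤ 2 * U.card := by
  classical
  refine (Finset.card_union_le _ _).trans ?_
  have h1 := Finset.card_image_le (s := U) (f := f)
  have h2 := Finset.card_image_le (s := U) (f := fun a => f a + 1)
  omega

/-- Along the segment between the points, no comparison with a side changes. The segment is
connected and stays in one position, hence in one face. -/
theorem mem_face_of_place_eq {r r' : Plane}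
    (h1 : place (sides U Prod.fst) r.1 = place (sides U Prod.fst) r'.1)
    (h2 : place (sides U Prod.snd) r.2 = place (sides U Prod.snd) r'.2) : r' ∈ face U r := by
  classical
  have hsub : segment ℝ r r' ⊆ {w | SamePosition U w r} := by
    intro t ht s hs
    obtain ⟨t1, t2⟩ := Prod.segment_subset r r' ht
    have a1 := lt_iff_of_place_eq h1 t1 (v := s.1)
      (Finset.mem_union_left _ (Finset.mem_image_of_mem _ hs))
    have b1 := lt_iff_of_place_eq h1 t1 (v := s.1 + 1)
      (Finset.mem_union_right _ (Finset.mem_image_of_mem (fun a : Plane => a.1 + 1) hs))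
    have a2 := lt_iff_of_place_eq h2 t2 (v := s.2)
      (Finset.mem_union_left _ (Finset.mem_image_of_mem _ hs))
    have b2 := lt_iff_of_place_eq h2 t2 (v := s.2 + 1)
      (Finset.mem_union_right _ (Finset.mem_image_of_mem (fun a : Plane => a.2 + 1) hs))
    have c1 := not_congr b1.1
    have d1 := not_congr b1.2
    have c2 := not_congr b2.1
    have d2 := not_congr b2.2
    rw [not_lt, not_lt] at c1 c2
    rw [not_le, not_le] at d1 d2
    have hi : t ∈ interior (unitSquare s) ↔ r ∈ interior (unitSquare s) := by
      rw [mem_interior_unitSquare, mem_interior_unitSquare, a1.1, a2.1, d1, d2]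
    refine ⟨hi, ?_⟩
    rw [mem_frontier_unitSquare, mem_frontier_unitSquare, hi, mem_unitSquare, mem_unitSquare, a1.2,
      a2.2, c1, c2]
  exact (convex_segment r r').isPreconnected.subset_connectedComponentIn (left_mem_segment ℝ r r')
    hsub (right_mem_segment ℝ r r')

theorem self_mem_face (U : Finset Plane) (z : Plane) : z ∈ face U z :=
  mem_connectedComponentIn fun _ _ => ⟨Iff.rfl, Iff.rfl⟩

/-- At most `2 * U.card` side coordinates in each direction allow at most `4 * U.card + 1` places,
and distinct representatives have distinct pairs of places. The constant comes from `4 * U.card + 1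
≤ 5 * U.card`. -/
theorem IsReduction.card_le (h : IsReduction U P Q) (hU : U.Nonempty) :
    Q.card ≤ 25 * U.card ^ 2 := by
  classical
  have hinj : Set.InjOn (fun r : Plane => (place (sides U Prod.fst) r.1,
      place (sides U Prod.snd) r.2)) Q := by
    intro r hr r' hr' he
    obtain ⟨h1, h2⟩ := Prod.mk.inj he
    obtain ⟨q, -, hq⟩ := h.2 r (h.1 hr)
    rw [hq r ⟨hr, self_mem_face U r⟩, hq r' ⟨hr', mem_face_of_place_eq h1 h2⟩]
  have hmaps : ∀ r ∈ Q, (place (sides U Prod.fst) r.1, place (sides U Prod.snd) r.2) ∈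
      Finset.range (4 * U.card + 1) ×ˢ Finset.range (4 * U.card + 1) := by
    intro r _
    have p1 := place_le (sides U Prod.fst) r.1
    have p2 := place_le (sides U Prod.snd) r.2
    have c1 := card_sides_le U Prod.fst
    have c2 := card_sides_le U Prod.snd
    simp only [Finset.mem_product, Finset.mem_range]
    omega
  have := Finset.card_le_card_of_injOn _ hmaps hinj
  rw [Finset.card_product, Finset.card_range] at this
  have hpos := hU.card_pos
  nlinarith

/-! ### The algorithm -/

section
variable {n m : ℕ} (p : Fin n → Plane) (u : Fin m → Plane)

theorem ptc_initial {i : ℕ} (hi : i < n) :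
    ptc (initial p u).rmem 0 i = (p ⟨i, hi⟩).1 ∧ ptc (initial p u).rmem 1 i = (p ⟨i, hi⟩).2 := by
  have h1 : 2 * i / 2 = i := by omega
  have h2 : (2 * i + 1) / 2 = i := by omega
  have h3 : (2 * i + 1) % 2 = 1 := by omega
  constructor
  · simp only [ptc, initial, Nat.add_zero, h1, hi, dif_pos, Nat.mul_mod_right, if_true]
  · simp only [ptc, initial, h2, hi, dif_pos, h3, one_ne_zero, if_false]

theorem sqc_initial {j : ℕ} (hj : j < m) :
    sqc (initial p u).rmem n 0 j = (u ⟨j, hj⟩).1 ∧ sqc (initial p u).rmem n 1 j = (u ⟨j, hj⟩).2 := by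
  have h1 : 2 * (j + n) / 2 = j + n := by omega
  have h2 : (2 * (j + n) + 1) / 2 = j + n := by omega
  have h3 : (2 * (j + n) + 1) % 2 = 1 := by omega
  have h4 : ¬ j + n < n := by omega
  have h5 : j + n - n = j := by omega
  constructor
  · simp only [sqc, initial, Nat.add_zero, h1, h4, h5, hj, dif_pos, dif_neg, not_false_eq_true,
      Nat.mul_mod_right, if_true]
  · simp only [sqc, initial, h2, h4, h5, hj, dif_pos, dif_neg, not_false_eq_true, h3, one_ne_zero,
      if_false]

theorem inside_initial {i j : ℕ} (hi : i < n) (hj : j < m) :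
    Inside (initial p u).rmem n i j ↔ p ⟨i, hi⟩ ∈ unitSquare (u ⟨j, hj⟩) := by
  rw [Com.inside_iff, mem_unitSquare, (ptc_initial p u hi).1, (ptc_initial p u hi).2,
    (sqc_initial p u hj).1, (sqc_initial p u hj).2]

theorem through_initial {j : ℕ} (hj : j < m) (z : ℕ → ℝ) :
    Com.Through (initial p u).rmem n z j ↔ ((z 0, z 1) : Plane) ∈ unitSquare (u ⟨j, hj⟩) := by
  rw [mem_unitSquare, ← (sqc_initial p u hj).1, ← (sqc_initial p u hj).2]
  refine ⟨fun h => ⟨h 0 (by omega), h 1 (by omega)⟩, fun h d hd => ?_⟩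
  interval_cases d
  exacts [h.1, h.2]

end

theorem selected_subset {m : ℕ} {u : Fin m → Plane} (hU : Set.range u = ↑U) (c : Config) :
    selected u c ⊆ U := by
  classical
  intro s hs
  obtain ⟨j, -, rfl⟩ := Finset.mem_image.1 hs
  exact Finset.mem_coe.1 (hU ▸ Set.mem_range_self j)

/-- The exponent splits as 28 + 12: with `B = n + m + 2`, `B ^ 12` dominates both terms of the cost,
and `B ≥ 3` makes `B ^ 28` large enough for the constants. -/
theorem cost_lt_pow {n m k c : ℕ} (hn : 1 ≤ n) (hk : k ≤ m)
    (hc : c ≤ 100000000 * (m * n + m ^ 8 * k ^ 4)) : n + m + 20 + c < (n + m + 2) ^ 40 := by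
  obtain ⟨B, hB⟩ : ∃ B, n + m + 2 = B := ⟨_, rfl⟩
  have b1 : m * n ≤ B ^ 12 :=
    calc m * n ≤ B * B := Nat.mul_le_mul (by omega) (by omega)
      _ = B ^ 2 := by ring
      _ ≤ B ^ 12 := Nat.pow_le_pow_right (by omega) (by omega)
  have b2 : m ^ 8 * k ^ 4 ≤ B ^ 12 :=
    calc m ^ 8 * k ^ 4 ≤ B ^ 8 * B ^ 4 :=
          Nat.mul_le_mul (Nat.pow_le_pow_left (by omega) _) (Nat.pow_le_pow_left (by omega) _)
      _ = B ^ 12 := by ring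
  have b3 : B ≤ B ^ 12 := Nat.le_self_pow (by omega) B
  have b4 : 3 ^ 28 ≤ B ^ 28 := Nat.pow_le_pow_left (by omega) _
  have b5 : 3 ^ 28 * B ^ 12 ≤ B ^ 40 :=
    calc 3 ^ 28 * B ^ 12 ≤ B ^ 28 * B ^ 12 := Nat.mul_le_mul_right _ b4
      _ = B ^ 40 := by ring
  norm_num at b5
  rw [hB]
  generalize B ^ 12 = D at *
  generalize B ^ 40 = E at *
  linarith

/-- The algorithm computes a cover of small ply. -/
theorem exists_run_main (h : Covers U P) {n m : ℕ} {p : Fin n → Plane} {u : Fin m → Plane}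
    (hu : Function.Injective u) (hU : Set.range u = ↑U) (hP : Set.range p = ↑P) :
    ∃ t c, run (Com.main.program 40) ((n + m + 2) ^ (9 * 40 + 1)) t (initial p u) = some c ∧
      (Com.main.program 40)[c.pc]? = some .halt ∧
      t ≤ 47 + 100000000 * (m * n + m ^ 8 * plyNumber P U ^ 4) ∧ Covers (selected u c) P ∧
      ply (selected u c) ≤ 8 * plyNumber P U + 32 := by
  classical
  have hpP : ∀ i, p i ∈ P := fun i => Finset.mem_coe.1 (hP ▸ Set.mem_range_self i)
  have huU : ∀ j, u j ∈ U := fun j => Finset.mem_coe.1 (hU ▸ Set.mem_range_self j)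
  have hPp : ∀ z ∈ P, ∃ i, p i = z := fun z hz => by
    have : z ∈ Set.range p := hP ▸ Finset.mem_coe.2 hz
    exact this
  have hUu : ∀ s ∈ U, ∃ j, u j = s := fun z hz => by
    have : z ∈ Set.range u := hU ▸ Finset.mem_coe.2 hz
    exact this
  -- Without points the program selects nothing and halts at once. Otherwise `1 ≤ k ≤ m`, as the
  -- analysis requires.
  rcases Nat.eq_zero_or_pos n with hn | hn
  · obtain ⟨c, h1, h2, h3⟩ := Com.program_halt p u Com.main 40 ((n + m + 2) ^ (9 * 40 + 1)) hn
    have hs : selected u c = ∅ := by simp [selected, h3]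
    refine ⟨1, c, h1, h2, by omega, fun z hz => ?_, ?_⟩
    · obtain ⟨i, -⟩ := hPp z hz
      exact absurd i.2 (by omega)
    · rw [hs]
      exact (ply_le_card _).trans (by simp)
  set k := plyNumber P U with hk
  have hne : P.Nonempty := ⟨p ⟨0, hn⟩, hpP _⟩
  have hk1 : 1 ≤ k := one_le_plyNumber h hne
  have hcard : U.card = m := by
    have : U = Finset.univ.image u := by
      ext s
      simp only [Finset.mem_image, Finset.mem_univ, true_and]
      exact ⟨hUu s, fun ⟨j, hj⟩ => hj ▸ huU j⟩
    rw [this, Finset.card_image_of_injective _ hu, Finset.card_univ, Fintype.card_fin]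
  have hkm : k ≤ m := hcard ▸ (plyNumber_le_min h).trans (min_le_right _ _)
  obtain ⟨S, hSU, hSP, hSk⟩ := exists_ply_eq h
  -- Squares indexed by all natural numbers; the value beyond `m` is irrelevant.
  let v : ℕ → Plane := fun j => if hj : j < m then u ⟨j, hj⟩ else 0
  have hv : ∀ {j} (hj : j < m), v j = u ⟨j, hj⟩ := fun hj => dif_pos hj
  have hvinj : Set.InjOn v (Set.Iio m) := by
    intro i hi j hj hij
    rw [hv hi, hv hj] at hij
    exact Fin.mk.inj (hu hij)
  have hstart : (Com.start n m).var 0 = n ∧ (Com.start n m).var 1 = m := by simp [Com.start]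
  obtain ⟨g1, g2, g3⟩ := Com.main_correct (X := (initial p u).rmem) (n := n) (m := m) (k := k)
    (σ := Com.start n m) hstart (fun _ _ => rfl) (fun _ => rfl) hn hk1 hkm
    (S := (Finset.range m).filter fun j => v j ∈ S)
    (fun j hj => Finset.mem_range.1 (Finset.mem_filter.1 hj).1) (fun i hi => by
      obtain ⟨s, hs, hps⟩ := hSP _ (hpP ⟨i, hi⟩)
      obtain ⟨j, rfl⟩ := hUu s (hSU hs)
      exact ⟨j, Finset.mem_filter.2 ⟨Finset.mem_range.2 j.2, by rwa [hv j.2]⟩,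
        (inside_initial p u hi j.2).2 hps⟩) (fun T hT z hz => by
      have hTm : ∀ j ∈ T, j < m := fun j hj =>
        Finset.mem_range.1 (Finset.mem_filter.1 (hT hj)).1
      rw [hk, ← hSk, ← Finset.card_image_of_injOn (hvinj.mono fun j hj => hTm j hj)]
      refine card_le_ply (z := (z 0, z 1)) (fun s hs => ?_) fun s hs => ?_
      · obtain ⟨j, hj, rfl⟩ := Finset.mem_image.1 hs
        exact (Finset.mem_filter.1 (hT hj)).2
      · obtain ⟨j, hj, rfl⟩ := Finset.mem_image.1 hs
        rw [hv (hTm j hj)]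
        exact (through_initial p u (hTm j hj) z).1 (hz j hj))
  have hbig := cost_lt_pow hn hkm g3
  obtain ⟨t, ht, c, c1, c2, c3⟩ := Com.exists_run_program p u Com.main 40 20 (by omega) (by omega)
    Com.small_main hbig
  refine ⟨t, c, c1, c2, by omega, fun z hz => ?_, ?_⟩
  · obtain ⟨i, rfl⟩ := hPp z hz
    obtain ⟨j, hj, ho, hin⟩ := g1 i i.2
    refine ⟨u ⟨j, hj⟩, Finset.mem_image.2 ⟨⟨j, hj⟩, ?_, rfl⟩, (inside_initial p u i.2 hj).1 hin⟩
    simp only [Finset.mem_filter, Finset.mem_univ, true_and]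
    rwa [c3 j hj]
  · refine ply_le fun T hT z hz => ?_
    have hTm : ∀ s ∈ T, ∃ j, ∃ hj : j < m, u ⟨j, hj⟩ = s ∧
        (Com.main.eval (initial p u).rmem (Com.start n m)).out j ≠ 0 := by
      intro s hs
      obtain ⟨j, hj, rfl⟩ := Finset.mem_image.1 (hT hs)
      refine ⟨j, j.2, rfl, ?_⟩
      rw [← c3 j j.2]
      exact (Finset.mem_filter.1 hj).2
    choose! q hqm hqu hqo using hTm
    have hinj : Set.InjOn q T := by
      intro s hs s' hs' he
      rw [← hqu s hs, ← hqu s' hs']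
      simp only [he]
    rw [← Finset.card_image_of_injOn hinj]
    refine (g2 (T.image q) (fun j hj => ?_) (fun d => if d = 0 then z.1 else z.2)
      fun j hj => ?_).trans (by omega)
    · obtain ⟨s, hs, rfl⟩ := Finset.mem_image.1 hj
      exact hqo s hs
    · obtain ⟨s, hs, rfl⟩ := Finset.mem_image.1 hj
      rw [through_initial p u (hqm s hs), hqu s hs]
      exact hz s hs

/-- This lets the bound without logarithms imply the claimed one, at the price of a factor 2. -/
theorem half_le_log {k : ℕ} (hk : 1 ≤ k) : (1 : ℝ) / 2 ≤ Real.log (k + 1) := by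
  have h1 : Real.log 2 ≤ Real.log (k + 1) := by
    refine Real.log_le_log (by norm_num) ?_
    have : (1 : ℝ) ≤ k := by exact_mod_cast hk
    linarith
  linarith [Real.log_two_gt_d9]

end PlyCover

theorem corollary5 :
    ∃ (prog : List PlyCover.Instr) (e : ℕ) (C : ℝ),
      ∀ (P U : Finset PlyCover.Plane), PlyCover.Covers U P →
        PlyCover.plyNumber P U ≤ min P.card U.card ∧
        ∀ (m : ℕ) (u : Fin m → PlyCover.Plane), Function.Injective u → Set.range u = ↑U →
          -- the reduction and the computation of the cover together, for arbitrary `P`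
          (∀ (n : ℕ) (p : Fin n → PlyCover.Plane), Function.Injective p → Set.range p = ↑P →
            PlyCover.ComputesCover prog e p u P (8 * PlyCover.plyNumber P U + 32)
              (C * (1 + (U.card : ℝ) ^ 2 * P.card
                + (U.card : ℝ) ^ 8 * (PlyCover.plyNumber P U : ℝ) ^ 4
                  * Real.log (PlyCover.plyNumber P U + 1)
                + (U.card : ℝ) ^ 8 * Real.log U.card
                  * Real.log (PlyCover.plyNumber P U + 1)))) ∧
          -- after the reduction of `P` to one representative point per face
          (∀ (Q : Finset PlyCover.Plane), PlyCover.IsReduction U P Q →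
            (Q.card : ℝ) ≤ C * (U.card : ℝ) ^ 2 ∧
            ∀ (n : ℕ) (q : Fin n → PlyCover.Plane), Function.Injective q → Set.range q = ↑Q →
              PlyCover.ComputesCover prog e q u P (8 * PlyCover.plyNumber P U + 32)
                (C * (1 + (Q.card : ℝ)
                  + (U.card : ℝ) ^ 8 * (PlyCover.plyNumber P U : ℝ) ^ 4
                    * Real.log (PlyCover.plyNumber P U + 1)
                  + (U.card : ℝ) ^ 8 * Real.log U.card
                    * Real.log (PlyCover.plyNumber P U + 1)))) := by
  open PlyCover in
  -- Words hold addresses with eight indices in radix `(n + m + 2) ^ 40`. The last constant suffices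
  -- because `100000000 * (25 + 1) * 2` is below it, where 25 comes from the number of
  -- representatives and 2 from `half_le_log`.
  refine ⟨Com.main.program 40, 9 * 40 + 1, 10000000000, fun P U hUP => ⟨plyNumber_le_min hUP,
    fun m u hu hU => ?_⟩⟩
  have card_eq : ∀ {k : ℕ} {w : Fin k → Plane} {V : Finset Plane}, Function.Injective w →
      Set.range w = ↑V → V.card = k := by
    intro k w V hw hV
    rw [← Set.ncard_coe_finset, ← hV, ← Set.image_univ, Set.ncard_image_of_injective _ hw,
      Set.ncard_univ, Nat.card_eq_fintype_card, Fintype.card_fin]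
  have hm : U.card = m := card_eq hu hU
  -- the bound in natural numbers implies the bound with logarithms
  have key : ∀ (R A : Finset Plane), Covers U R → plyNumber R U = plyNumber P U → ∀ x y : ℝ,
      0 ≤ x → (m * A.card : ℝ) ≤ x + y * (m ^ 8 * plyNumber P U ^ 4) → 0 ≤ y → y ≤ 25 →
      (R = ∅ → A = ∅) →
      (47 + 100000000 * (m * A.card + m ^ 8 * plyNumber P U ^ 4) : ℝ) ≤
        10000000000 * (1 + x + (U.card : ℝ) ^ 8 * (plyNumber P U : ℝ) ^ 4 *
          Real.log (plyNumber P U + 1) + (U.card : ℝ) ^ 8 * Real.log U.card *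
          Real.log (plyNumber P U + 1)) := by
    intro R A hR hRP x y hx hA hy0 hy hRA
    rw [hm]
    set k := plyNumber P U with hk
    have l0 : 0 ≤ Real.log ((k : ℝ) + 1) := Real.log_nonneg (by
      have : (0 : ℝ) ≤ k := Nat.cast_nonneg k
      linarith)
    have l1 : 0 ≤ (m : ℝ) ^ 8 * Real.log m * Real.log (k + 1) := by
      have := Real.log_natCast_nonneg m
      positivity
    have l2 : (0 : ℝ) ≤ (m : ℝ) ^ 8 * (k : ℝ) ^ 4 := by positivity
    have l3 : (m : ℝ) ^ 8 * (k : ℝ) ^ 4 ≤ 2 * ((m : ℝ) ^ 8 * (k : ℝ) ^ 4 * Real.log (k + 1)) := by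
      rcases R.eq_empty_or_nonempty with rfl | hne
      · have : k = 0 := by
          have := plyNumber_le_min hR
          rw [hRP] at this
          simpa using this
        simp [this]
      · have := half_le_log (hRP ▸ one_le_plyNumber hR hne : 1 ≤ k)
        nlinarith
    have l4 : y * ((m : ℝ) ^ 8 * (k : ℝ) ^ 4) ≤ 25 * ((m : ℝ) ^ 8 * (k : ℝ) ^ 4) :=
      mul_le_mul_of_nonneg_right hy l2
    linarith
  refine ⟨fun n p hp hP => ?_, fun Q hQ => ⟨?_, fun n q hq hQq => ?_⟩⟩
  · obtain ⟨t, c, h1, h2, h3, h4, h5⟩ := exists_run_main hUP hu hU hP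
    refine ⟨t, c, h1, h2, ?_, h4, h5⟩
    have hn : P.card = n := card_eq hp hP
    have h3' : (t : ℝ) ≤ 47 + 100000000 * (m * P.card + m ^ 8 * plyNumber P U ^ 4) := by
      rw [hn]
      exact_mod_cast h3
    -- Here `x` is `|U|^2 * |P|`, which already dominates `m * |P|`.
    refine h3'.trans (key P P hUP rfl _ 0 (by positivity) ?_ le_rfl (by norm_num) id)
    rw [hm, zero_mul, add_zero]
    refine mul_le_mul_of_nonneg_right ?_ (Nat.cast_nonneg _)
    exact_mod_cast Nat.le_self_pow (by omega) m
  · rcases U.eq_empty_or_nonempty with rfl | hne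
    · have : Q = ∅ := by
        refine Finset.eq_empty_of_forall_notMem fun z hz => ?_
        obtain ⟨s, hs, -⟩ := hUP z (hQ.1 hz)
        simp at hs
      simp [this]
    · have : (Q.card : ℝ) ≤ 25 * (U.card : ℝ) ^ 2 := by exact_mod_cast hQ.card_le hne
      refine this.trans (mul_le_mul_of_nonneg_right (by norm_num) (by positivity))
  · have hUQ : Covers U Q := (hQ.covers_iff subset_rfl).2 hUP
    obtain ⟨t, c, h1, h2, h3, h4, h5⟩ := exists_run_main hUQ hu hU hQq
    rw [hQ.plyNumber_eq] at h3 h5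
    refine ⟨t, c, h1, h2, ?_, (hQ.covers_iff (selected_subset hU c)).1 h4, h5⟩
    have hn : Q.card = n := card_eq hq hQq
    have h3' : (t : ℝ) ≤ 47 + 100000000 * (m * Q.card + m ^ 8 * plyNumber P U ^ 4) := by
      rw [hn]
      exact_mod_cast h3
    -- Here `x` is only `|Q|`; the preprocessing time is absorbed by the cells, as `m * |Q| ≤ 25 * m
    -- ^ 3`.
    refine h3'.trans (key Q Q hUQ hQ.plyNumber_eq _ 25 (by positivity) ?_ (by norm_num) le_rfl id)
    rcases Q.eq_empty_or_nonempty with rfl | hne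
    · simp
      positivity
    · obtain ⟨z, hz⟩ := hne
      obtain ⟨s, hs, -⟩ := hUQ z hz
      have hc := hQ.card_le ⟨s, hs⟩
      have hk := hQ.plyNumber_eq ▸ one_le_plyNumber hUQ ⟨z, hz⟩
      rw [hm] at hc
      have hm1 : 1 ≤ m := hm ▸ Finset.card_pos.2 ⟨s, hs⟩
      have : m * Q.card ≤ 25 * (m ^ 8 * plyNumber P U ^ 4) :=
        calc m * Q.card ≤ m * (25 * m ^ 2) := Nat.mul_le_mul_left _ hc
          _ = 25 * (m ^ 3 * 1) := by ring
          _ ≤ 25 * (m ^ 8 * plyNumber P U ^ 4) := by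
              refine Nat.mul_le_mul_left _ (Nat.mul_le_mul (Nat.pow_le_pow_right hm1 (by omega)) ?_)
              exact Nat.one_le_iff_ne_zero.2 (pow_ne_zero _ (by omega))
      have h' : (m * Q.card : ℝ) ≤ 25 * (m ^ 8 * plyNumber P U ^ 4) := by exact_mod_cast this
      have : (0 : ℝ) ≤ Q.card := Nat.cast_nonneg _
      linarith
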